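/- A global field is a finite extension of $\mathbb{Q}$ or of $\mathbb{F}_p(t)$, $p$ a prime. A valuation on a field is a nontrivial absolute value with real values, archimedean or non-archimedean. For a field $F$ and an integer $m\ge 1$, write $\mu_m\subset F$ if $F$ contains all $m$-th roots of unity of its algebraic closure. For a finite extension $L/K$ of global fields and a valuation $v$ on $K$, put $b_v=[L:K]$ if $v$ is non-archimedean, $b_v=\gcd(2,[L:K])$ if $v$ is real archimedean, and $b_v=1$ if $v$ is complex archimedean; $L/K$ has full local degree at $v$ if $[L_w:K_v]=b_v$ for every valuation $w$ on $L$ extending $v$, where $L_w$ and $K_v$ are the completions. Main Theorem. Let $K/k$ be a finite cyclic Galois extension of global fields, let $m\ge 1$ be an integer, and let $S$ be a finite set of pairwise inequivalent valuations on $K$. Call a field $L\supseteq K$ a solution if $L/K$ is cyclic of degree $m$, $L/K$ has full local degree at every $v\in S$, and $L/k$ is Galois. Then: (i) If $\mu_m\subset K$, there is a solution. (ii) If $\mu_m\subset k$, there is a solution $L$ such that $L/k$ is abelian. (iii) If $\mu_m\subset k$, there is a solution $L$ such that $L/k$ is cyclic if and only if every $m$-th root of unity in $k$ is the norm $N_{K/k}(x)$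 of some $x\in K$. In particular, if $k$ has characteristic $p>0$ and $m$ is a power of $p$, there is a solution $L$ such that $L/k$ is cyclic. -/

import Mathlib

universe u v

/-- A global field: a finite extension of `ℚ`, or a finite extension of the field `𝔽_p(t)` of
rational functions over a prime field. -/
def IsGlobalField (F : Type u) [Field F] : Prop :=
  NumberField F ∨
    ∃ (p : ℕ) (_ : Fact p.Prime) (_ : Algebra (RatFunc (ZMod p)) F),
      FiniteDimensional (RatFunc (ZMod p)) F

/-- `μ_m ⊂ F`: the field `F` contains all `m`-th roots of unity of its algebraic closure. -/
def ContainsRootsOfUnity (m : ℕ) (F : Type u) [Field F] : Prop :=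
  ∀ x : AlgebraicClosure F, x ^ m = 1 → x ∈ (algebraMap F (AlgebraicClosure F)).range

/-- `μ_m ⊂ N_{K/k}(K)`, for a field `k` with `μ_m ⊂ k`: every `m`-th root of unity in `k` is a norm
from `K`. -/
def RootsOfUnityAreNorms (m : ℕ) (k : Type u) (K : Type v) [Field k] [Field K] [Algebra k K] :
    Prop :=
  ∀ ζ : k, ζ ^ m = 1 → ∃ x : K, Algebra.norm k x = ζ

section LocalDegree

variable {K : Type u} {L : Type v} [Field K] [Field L] [Algebra K L]

/-- The embedding of `K` in `L` is isometric if `w` extends `v`. -/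
theorem isometry_algebraMap_withAbs (v : AbsoluteValue K ℝ) (w : AbsoluteValue L ℝ)
    (h : w.LiesOver v) : Isometry (algebraMap (WithAbs v) (WithAbs w)) :=
  AddMonoidHomClass.isometry_of_norm _ fun x ↦
    congrArg (fun u : AbsoluteValue K ℝ ↦ u x.ofAbs) h.comp_eq

/-- The embedding `K_v → L_w` of completions, for an absolute value `w` on `L` extending `v`. -/
noncomputable def completionEmbedding (v : AbsoluteValue K ℝ) (w : AbsoluteValue L ℝ)
    (h : w.LiesOver v) : v.Completion →+* w.Completion :=
  (isometry_algebraMap_withAbs v w h).mapRingHom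

/-- The local degree `[L : K]_w = [L_w : K_v]`, for an absolute value `w` on `L` extending `v`. -/
noncomputable def localDegree (v : AbsoluteValue K ℝ) (w : AbsoluteValue L ℝ)
    (h : w.LiesOver v) : ℕ :=
  letI : Algebra v.Completion w.Completion := (completionEmbedding v w h).toAlgebra
  Module.finrank v.Completion w.Completion

/-- A real archimedean absolute value: one that is equivalent to the absolute value induced by an
embedding of `K` in `ℝ`. -/
def IsRealArchimedean (v : AbsoluteValue K ℝ) : Prop :=
  ∃ σ : K →+* ℝ, v.IsEquiv ((AbsoluteValue.abs (S := ℝ)).comp σ.injective)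

variable (L) in
open Classical in
/-- The upper bound for the local degrees of `L / K` at `v`: it is `[L : K]` if `v` is
non-archimedean, `gcd (2, [L : K])` if `v` is real archimedean, and `1` if `v` is complex
archimedean. -/
noncomputable def localDegreeBound (v : AbsoluteValue K ℝ) : ℕ :=
  if IsNonarchimedean v then Module.finrank K L
  else if IsRealArchimedean v then Nat.gcd 2 (Module.finrank K L)
  else 1

variable (L) in
/-- `L / K` has full local degree at `v`: the bound for the local degree is attained at every
absolute value `w` on `L` extending `v`. -/
def HasFullLocalDegreeAt (v : AbsoluteValue K ℝ) : Prop :=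
  ∀ (w : AbsoluteValue L ℝ) (h : w.LiesOver v), localDegree v w h = localDegreeBound L v

end LocalDegree

/-- A finite set of nontrivial pairwise inequivalent absolute values on `K`. -/
structure IsFinitePlaceSet {K : Type u} [Field K] (S : Set (AbsoluteValue K ℝ)) : Prop where
  finite : S.Finite
  nontrivial : ∀ v ∈ S, v.IsNontrivial
  inequivalent : S.Pairwise fun v w ↦ ¬ v.IsEquiv w

/-- `L / K` is a finite cyclic Galois extension. -/
structure IsCyclicExtension (K : Type u) (L : Type v) [Field K] [Field L] [Algebra K L] :
    Prop where
  finite : FiniteDimensional K L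
  galois : IsGalois K L
  cyclic : IsCyclic Gal(L/K)

section Solutions

variable (k : Type u) (K : Type v) [Field k] [Field K] [Algebra k K]

/-- `L` is a solution to `(K/k, m, S)`: it is cyclic over `K` of degree `m`, has full local degree
in `S`, and is Galois over `k`. -/
structure IsSolution (m : ℕ) (S : Set (AbsoluteValue K ℝ)) (L : Type v) [Field L] [Algebra K L]
    [Algebra k L] : Prop where
  cyclic : IsCyclicExtension K L
  degree : Module.finrank K L = m
  full : ∀ v ∈ S, HasFullLocalDegreeAt L v
  galois : IsGalois k L

/-- `(K/k, m, S)` has a solution. -/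
def HasSolution (m : ℕ) (S : Set (AbsoluteValue K ℝ)) : Prop :=
  ∃ (L : Type v) (_ : Field L) (_ : Algebra K L) (_ : Algebra k L) (_ : IsScalarTower k K L),
    IsSolution k K m S L

/-- `(K/k, m, S)` has a solution that is abelian over `k`. -/
def HasAbelianSolution (m : ℕ) (S : Set (AbsoluteValue K ℝ)) : Prop :=
  ∃ (L : Type v) (_ : Field L) (_ : Algebra K L) (_ : Algebra k L) (_ : IsScalarTower k K L),
    IsSolution k K m S L ∧ IsAbelianGalois k L

/-- `(K/k, m, S)` has a solution that is cyclic over `k`. -/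
def HasCyclicSolution (m : ℕ) (S : Set (AbsoluteValue K ℝ)) : Prop :=
  ∃ (L : Type v) (_ : Field L) (_ : Algebra K L) (_ : Algebra k L) (_ : IsScalarTower k K L),
    IsSolution k K m S L ∧ IsCyclicExtension k L

end Solutions

/-! Write `m = q * n` with `q` a power of the characteristic (`q = 1` in characteristic 0) and `n`
invertible in `k`. A tower of Artin–Schreier steps produces `M / K` of degree `q` with `M / k`
cyclic and full local degrees; one Kummer step `L = M(c ^ (1/n))` then supplies the factor `n`. In
both kinds of step the shape of the group over `k` is settled by an element `a` of the current
field, while an element `b` of `k` remains free: replacing `a` by `a * b` (or `a + b`) does not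
disturb the group. The freedom in `b` is used for the local degrees.

Global structure. Let `σ` generate `Gal(M/k)` and let `σ a = x ^ n * a`. The lift of `σ` sending the
root `α` of `X ^ n - a` to `x * α` has `[M : k]`-th power `α ↦ N(x) * α`, so `L / k` is cyclic as
soon as `N(x)` is a primitive `n`-th root of unity (`isCyclicExtension_adjoinRoot_X_pow_sub_C`). If
a primitive root `ζ` is the norm of `x` from `K`, then `x ^ n` has norm 1 from `M` and Hilbert 90
supplies `a`. For (i) and (ii), `a = 1`, so that `c` lies in `k`. The Artin–Schreier version
replaces `N(x)` by an element of trace 1. Conversely, if `L / k` is cyclic, Hilbert 90 for `L / K`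
exhibits each `m`-th root of unity of `k` as a norm (`IsCyclicExtension.rootsOfUnityAreNorms`).

Local degrees. Since the roots of unity are present, `X ^ n - c` is irreducible over a completion
once `c` is not an `ℓ`-th power there for any prime `ℓ ∣ n`. Some `b` in `k` must therefore fail to
be an `ℓ`-th power in `M_w`. Here `M_w / k_u` is cyclic, so by Kummer theory the elements of `k_u`
that become `ℓ`-th powers form at most one nontrivial cyclic group of classes, or only the trivial
class if `k_u` lacks the `ℓ`-th roots of unity; a uniformizer and a suitable unit are too many
(`exists_ne_pow_of_isCyclic`). At a real place `-1` works for `ℓ = 2`, the only prime that can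
occur, and at a complex place nothing is needed. The local condition is open in `b`, and it passes
between conjugate places because `σ a / a` is an `n`-th power; hence one place of `M` above each
place of `k` suffices, and weak approximation in `k` gives a global `b`
(`AbsoluteValue.exists_forall_of_exists_local`). One auxiliary nonarchimedean place ensures global
irreducibility. -/

section

open Polynomial

/-- A nonarchimedean absolute value with discrete value group and finite residue field. -/
structure IsDiscreteFinite {F : Type*} [Field F] (v : AbsoluteValue F ℝ) : Prop where
  nonarch : IsNonarchimedean v
  discrete : ∃ ϖ : F, 0 < v ϖ ∧ v ϖ < 1 ∧ ∀ x : F, x ≠ 0 → ∃ n : ℤ, v x = v ϖ ^ n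
  residue : ∃ R : Set F, R.Finite ∧ (∀ r ∈ R, v r ≤ 1) ∧ ∀ x : F, v x ≤ 1 → ∃ r ∈ R, v (x - r) < 1

/-! ### Absolute values on fraction fields of principal ideal domains -/

section Base

variable {F : Type*} [Field F]

theorem AbsoluteValue.sub_le_max {v : AbsoluteValue F ℝ} (hv : IsNonarchimedean v) (x y : F) :
    v (x - y) ≤ max (v x) (v y) := by
  have := hv x (-y)
  rwa [← sub_eq_add_neg, v.map_neg] at this

/-- The elements of `A` of value less than 1 form a principal ideal `(ϖ)`. Each nonzero element of
`A` is a power of `ϖ` times an element of value 1, and the finite ring `A / (ϖ)` supplies the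
residues. -/
theorem isDiscreteFinite_of_isPrincipalIdealRing {A : Type*} [CommRing A] [IsDomain A]
    [IsPrincipalIdealRing A] [Algebra A F] [IsFractionRing A F]
    (hA : ∀ a : A, a ≠ 0 → Finite (A ⧸ Ideal.span {a})) {v : AbsoluteValue F ℝ}
    (hv : IsNonarchimedean v) (hn : v.IsNontrivial) (hle : ∀ a : A, v (algebraMap A F a) ≤ 1) :
    IsDiscreteFinite v := by
  classical
  let P : Ideal A :=
    { carrier := {a | v (algebraMap A F a) < 1}
      add_mem' := fun {a b} ha hb ↦ by
        simp only [Set.mem_ofPred_eq, map_add] at *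
        exact (hv _ _).trans_lt (max_lt ha hb)
      zero_mem' := by simp
      smul_mem' := fun c x hx ↦ by
        simp only [Set.mem_ofPred_eq, smul_eq_mul, map_mul] at *
        exact (mul_le_of_le_one_left (v.nonneg _) (hle c)).trans_lt hx }
  have hP (a : A) : a ∈ P ↔ v (algebraMap A F a) < 1 := Iff.rfl
  obtain ⟨ϖ, hϖ⟩ := IsPrincipalIdealRing.principal P
  have hϖP : ϖ ∈ P := by rw [hϖ]; exact Ideal.mem_span_singleton_self ϖ
  have hdvd (a : A) : v (algebraMap A F a) < 1 ↔ ϖ ∣ a := by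
    rw [← hP, hϖ]; exact Ideal.mem_span_singleton
  have hϖ0 : ϖ ≠ 0 := by
    rintro rfl
    obtain ⟨x, hx0, hx1⟩ := hn
    obtain ⟨a, s, hs, rfl⟩ := IsFractionRing.div_surjective (A := A) x
    have key : ∀ a : A, a ≠ 0 → v (algebraMap A F a) = 1 := fun a ha ↦
      le_antisymm (hle a) (not_lt.1 fun h ↦ ha (zero_dvd_iff.1 ((hdvd a).1 h)))
    apply hx1
    have ha : a ≠ 0 := by rintro rfl; simp at hx0
    rw [map_div₀, key a ha, key s (nonZeroDivisors.ne_zero hs), div_one]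
  have hinj := IsFractionRing.injective A F
  have hpos {a : A} (ha : a ≠ 0) : 0 < v (algebraMap A F a) :=
    v.pos ((map_ne_zero_iff _ hinj).2 ha)
  have hu : ¬ IsUnit ϖ := fun hu ↦ by
    have := (hdvd 1).2 (hu.dvd)
    simp at this
  have hpow (a : A) (ha : a ≠ 0) : ∃ n : ℕ, ∃ b : A, a = ϖ ^ n * b ∧ v (algebraMap A F b) = 1 := by
    obtain ⟨n, b, hb, rfl⟩ := WfDvdMonoid.max_power_factor' ha hu
    exact ⟨n, b, rfl, le_antisymm (hle b) (not_lt.1 fun h ↦ hb ((hdvd b).1 h))⟩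
  refine ⟨hv, ⟨algebraMap A F ϖ, hpos hϖ0, (hdvd ϖ).2 dvd_rfl, fun x hx ↦ ?_⟩, ?_⟩
  · obtain ⟨a, s, hs, rfl⟩ := IsFractionRing.div_surjective (A := A) x
    have ha : a ≠ 0 := by rintro rfl; simp at hx
    obtain ⟨n, b, rfl, hb⟩ := hpow a ha
    obtain ⟨k, c, rfl, hc⟩ := hpow s (nonZeroDivisors.ne_zero hs)
    refine ⟨n - k, ?_⟩
    have := (hpos hϖ0).ne'
    simp only [map_mul, map_pow, map_div₀, hb, hc, mul_one]
    rw [zpow_sub₀ this, zpow_natCast, zpow_natCast]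
  · have := hA ϖ hϖ0
    let q : A → A ⧸ Ideal.span {ϖ} := Ideal.Quotient.mk _
    have hq : Function.Surjective q := Ideal.Quotient.mk_surjective
    refine ⟨Set.range fun c ↦ algebraMap A F (Function.surjInv hq c), Set.finite_range _, ?_, ?_⟩
    · rintro _ ⟨c, rfl⟩; exact hle _
    · intro x hx
      rcases eq_or_ne x 0 with rfl | hx0
      · refine ⟨_, ⟨q 0, rfl⟩, ?_⟩
        rw [zero_sub, v.map_neg, hdvd]
        have := Function.surjInv_eq hq (q 0)
        rwa [Ideal.Quotient.eq, sub_zero, Ideal.mem_span_singleton] at this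
      -- Cancelling powers of `ϖ` makes the denominator a unit at `v`; its inverse `d` modulo the
      -- maximal ideal `P` then makes `b * d` a representative of `b / c` in `A`.
      · have : ∃ b c : A, v (algebraMap A F c) = 1 ∧ x = algebraMap A F b / algebraMap A F c := by
          obtain ⟨a, s, hs, rfl⟩ := IsFractionRing.div_surjective (A := A) x
          have ha : a ≠ 0 := by rintro rfl; simp at hx0
          obtain ⟨n, b, rfl, hb⟩ := hpow a ha
          obtain ⟨k, c, rfl, hc⟩ := hpow s (nonZeroDivisors.ne_zero hs)
          have h0 : algebraMap A F ϖ ≠ 0 := (map_ne_zero_iff _ hinj).2 hϖ0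
          have hkn : k ≤ n := by
            by_contra! hlt
            simp only [map_mul, map_pow, map_div₀, hb, hc, mul_one] at hx
            rw [div_le_one (pow_pos (hpos hϖ0) _)] at hx
            exact absurd (pow_lt_pow_right_of_lt_one₀ (hpos hϖ0) ((hdvd ϖ).2 dvd_rfl) hlt) hx.not_gt
          refine ⟨ϖ ^ (n - k) * b, c, hc, ?_⟩
          obtain ⟨j, rfl⟩ := Nat.exists_eq_add_of_le hkn
          have hc0 : algebraMap A F c ≠ 0 := by
            intro h; rw [h, map_zero] at hc; exact zero_ne_one hc
          simp only [map_mul, map_pow, Nat.add_sub_cancel_left]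
          field_simp
          ring
        obtain ⟨b, c, hc, rfl⟩ := this
        have hmax : P.IsMaximal := by
          rw [hϖ]
          refine PrincipalIdealRing.isMaximal_of_irreducible (irreducible_iff_prime.2 ⟨hϖ0, hu, ?_⟩)
          intro a b hab
          rw [← hdvd, map_mul, map_mul] at hab
          by_contra! h
          rw [← hdvd, ← hdvd, not_lt, not_lt] at h
          rw [le_antisymm (hle a) h.1, le_antisymm (hle b) h.2] at hab
          norm_num at hab
        have hcP : c ∉ P := fun h ↦ absurd ((hP c).1 h) hc.not_lt
        obtain ⟨d, y, hy, hd⟩ := hmax.exists_inv hcP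
        refine ⟨_, ⟨q (b * d), rfl⟩, ?_⟩
        set r := Function.surjInv hq (q (b * d)) with hr
        have h1 : v (algebraMap A F (b * d) - algebraMap A F r) < 1 := by
          rw [← map_sub, hdvd]
          have := Function.surjInv_eq hq (q (b * d))
          rw [Ideal.Quotient.eq, Ideal.mem_span_singleton] at this
          rw [← dvd_neg, neg_sub]; exact this
        have h2 : v (algebraMap A F b / algebraMap A F c - algebraMap A F (b * d)) < 1 := by
          have hc0 : algebraMap A F c ≠ 0 := by
            intro h; rw [h, map_zero] at hc; exact zero_ne_one hc
          have : algebraMap A F b / algebraMap A F c - algebraMap A F (b * d) =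
              algebraMap A F b * algebraMap A F y / algebraMap A F c := by
            have := congrArg (algebraMap A F) hd
            simp only [map_add, map_mul, map_one] at this ⊢
            field_simp
            linear_combination (- algebraMap A F b) * this
          rw [this, map_div₀, hc, div_one, map_mul]
          exact (mul_le_of_le_one_left (v.nonneg _) (hle b)).trans_lt hy
        have := hv (algebraMap A F b / algebraMap A F c - algebraMap A F (b * d))
          (algebraMap A F (b * d) - algebraMap A F r)
        rw [sub_add_sub_cancel] at this
        exact this.trans_lt (max_lt h2 h1)

end Base

end

/-! ### Discreteness and finite residue field in finite extensions -/

section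

open Polynomial

section Extension

variable {F E : Type*} [Field F] [Field E] [Algebra F E]

/-- Two terms of maximal absolute value in a vanishing sum. -/
theorem AbsoluteValue.exists_ne_eq_of_sum_eq_zero {v : AbsoluteValue E ℝ} (hv : IsNonarchimedean v)
    {ι : Type*} {s : Finset ι} (hs : s.Nonempty) {f : ι → E} (hf : ∀ i ∈ s, f i ≠ 0)
    (h0 : ∑ i ∈ s, f i = 0) :
    ∃ i ∈ s, ∃ j ∈ s, i ≠ j ∧ v (f i) = v (f j) ∧ ∀ l ∈ s, v (f l) ≤ v (f i) := by
  obtain ⟨k, hk, hmax⟩ := s.exists_max_image (fun i ↦ v (f i)) hs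
  by_contra! h
  have := IsNonarchimedean.apply_sum_eq_of_lt (l := f) hv (fun a ↦ (v.map_neg a).symm) hk
    (fun j hj hjk ↦ (hmax j hj).lt_of_ne fun he ↦ by
      obtain ⟨l, hl, hlt⟩ := h k hk j hj hjk.symm he.symm
      exact absurd (hmax l hl) hlt.not_ge)
  rw [h0, map_zero] at this
  exact hf k hk (v.eq_zero.1 this.symm)

/-- In the minimal equation of `x` two terms share the largest absolute value; comparing them
expresses a power of `v x` through a ratio of coefficients. -/
theorem AbsoluteValue.exists_pow_eq_of_finiteDimensional [FiniteDimensional F E]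
    {v : AbsoluteValue E ℝ} (hv : IsNonarchimedean v) {x : E} (hx : x ≠ 0) :
    ∃ j : ℕ, 0 < j ∧ j ≤ Module.finrank F E ∧ ∃ c : F, c ≠ 0 ∧ v x ^ j = v (algebraMap F E c) := by
  have hp : minpoly F x ≠ 0 := minpoly.ne_zero (Algebra.IsIntegral.isIntegral x)
  have hsum := minpoly.aeval F x
  rw [aeval_eq_sum_range, ← Finset.sum_subset supp_subset_range_natDegree_succ
    (fun i _ hi ↦ by rw [notMem_support_iff.1 hi, zero_smul])] at hsum
  obtain ⟨i, hi, j, hj, hij, he, -⟩ := AbsoluteValue.exists_ne_eq_of_sum_eq_zero hv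
    (nonempty_support_iff.2 hp) (fun i hi ↦ smul_ne_zero (mem_support_iff.1 hi) (pow_ne_zero i hx))
    hsum
  wlog hlt : i < j generalizing i j
  · exact this j hj i hi hij.symm he.symm (hij.lt_or_gt.resolve_left hlt)
  refine ⟨j - i, Nat.sub_pos_of_lt hlt, ?_, (minpoly F x).coeff i / (minpoly F x).coeff j,
    div_ne_zero (mem_support_iff.1 hi) (mem_support_iff.1 hj), ?_⟩
  · exact (Nat.sub_le _ _).trans ((le_natDegree_of_mem_supp _ hj).trans (minpoly.natDegree_le x))
  · have h1 : v (algebraMap F E ((minpoly F x).coeff j)) ≠ 0 := by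
      simpa using mem_support_iff.1 hj
    have h2 : v x ≠ 0 := by simpa using hx
    simp only [Algebra.smul_def, map_mul, map_pow] at he
    rw [map_div₀, map_div₀, eq_div_iff h1, mul_comm, pow_sub₀ _ h2 hlt.le]
    field_simp
    linarith

/-- The value group of `E`, raised to a fixed exponent `n`, lands in the infinite cyclic value group
of `F`. An element whose `n`-th power has the least positive exponent generates, by division with
remainder. -/
theorem exists_zpow_of_finiteDimensional [FiniteDimensional F E]
    {v : AbsoluteValue E ℝ} (hv : IsNonarchimedean v)
    (h : ∃ ϖ : F, 0 < v (algebraMap F E ϖ) ∧ v (algebraMap F E ϖ) < 1 ∧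
      ∀ x : F, x ≠ 0 → ∃ n : ℤ, v (algebraMap F E x) = v (algebraMap F E ϖ) ^ n) :
    ∃ ϖ : E, 0 < v ϖ ∧ v ϖ < 1 ∧ ∀ x : E, x ≠ 0 → ∃ n : ℤ, v x = v ϖ ^ n := by
  classical
  obtain ⟨ϖ, h0, h1, h⟩ := h
  set t := v (algebraMap F E ϖ)
  -- The exponent `j` attached to `x` varies with `x` but is at most the degree, so the factorial is
  -- a common multiple.
  set n := (Module.finrank F E).factorial with hn
  have hn0 : n ≠ 0 := Nat.factorial_ne_zero _
  have key (x : E) (hx : x ≠ 0) : ∃ z : ℤ, v x ^ n = t ^ z := by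
    obtain ⟨j, hj0, hj, c, hc, he⟩ := AbsoluteValue.exists_pow_eq_of_finiteDimensional (F := F) hv hx
    obtain ⟨z, hz⟩ := h c hc
    obtain ⟨q, hq⟩ := Nat.dvd_factorial hj0 hj
    exact ⟨z * q, by rw [hn, hq, pow_mul, he, hz, zpow_mul, zpow_natCast]⟩
  have hex : ∃ i : ℕ, 0 < i ∧ ∃ x : E, v x ^ n = t ^ i :=
    ⟨n, Nat.pos_of_ne_zero hn0, algebraMap F E ϖ, rfl⟩
  obtain ⟨hm0, π, hπ⟩ := Nat.find_spec hex
  set m := Nat.find hex with hm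
  have hπ0 : 0 < v π := by
    refine (v.nonneg π).lt_of_ne' fun h ↦ ?_
    rw [h, zero_pow hn0] at hπ
    exact (pow_pos h0 m).ne hπ
  have hπ1 : v π < 1 := by
    by_contra! hge
    have := one_le_pow₀ hge (n := n)
    rw [hπ] at this
    exact absurd (pow_lt_one₀ h0.le h1 hm0.ne') this.not_gt
  refine ⟨π, hπ0, hπ1, fun x hx ↦ ?_⟩
  obtain ⟨z, hz⟩ := key x hx
  refine ⟨z / m, ?_⟩
  have hr : v (x / π ^ (z / m)) ^ n = t ^ (z % m) := by
    rw [map_div₀, map_zpow₀, div_pow, ← zpow_natCast (_ ^ _), ← zpow_mul, mul_comm, zpow_mul,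
      zpow_natCast, hπ, hz, ← zpow_natCast t m, ← zpow_mul, ← zpow_sub₀ h0.ne', Int.emod_def]
  have hmz : (m : ℤ) ≠ 0 := by exact_mod_cast hm0.ne'
  obtain ⟨r, hr'⟩ := Int.eq_ofNat_of_zero_le (Int.emod_nonneg z hmz)
  have hrm : r < m := by
    have := Int.emod_lt_of_pos z (by exact_mod_cast hm0 : (0 : ℤ) < m)
    rw [hr'] at this
    exact_mod_cast this
  rw [hr', zpow_natCast] at hr
  have hr0 : r = 0 := by
    by_contra hr0
    exact Nat.find_min hex hrm ⟨Nat.pos_of_ne_zero hr0, _, hr⟩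
  rw [hr0, pow_zero, pow_eq_one_iff_of_nonneg (v.nonneg _) hn0, map_div₀, map_zpow₀,
    div_eq_one_iff_eq (zpow_pos hπ0 _).ne'] at hr
  exact hr

/-- The valuation ring of a nonarchimedean absolute value. -/
def AbsoluteValue.valuationSubring (v : AbsoluteValue E ℝ) (hv : IsNonarchimedean v) :
    ValuationSubring E where
  carrier := {x | v x ≤ 1}
  mul_mem' {a b} ha hb := by
    simp only [Set.mem_ofPred_eq, map_mul] at *
    exact mul_le_one₀ ha (v.nonneg _) hb
  one_mem' := by simp
  add_mem' {a b} ha hb := (hv a b).trans (max_le ha hb)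
  zero_mem' := by simp
  neg_mem' {a} ha := by simpa using ha
  mem_or_inv_mem' x := by
    simp only [Set.mem_ofPred_eq, map_inv₀]
    rcases le_total (v x) 1 with h | h
    · exact Or.inl h
    · exact Or.inr (inv_le_one_of_one_le₀ h)

theorem AbsoluteValue.residue_eq_iff (v : AbsoluteValue E ℝ) (hv : IsNonarchimedean v)
    (x y : v.valuationSubring hv) :
    IsLocalRing.residue _ x = IsLocalRing.residue _ y ↔ v (x - y : E) < 1 := by
  rw [← sub_eq_zero, ← map_sub, IsLocalRing.residue_eq_zero_iff, IsLocalRing.mem_maximalIdeal,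
    mem_nonunits_iff, not_iff_comm]
  have hz (z : v.valuationSubring hv) : IsUnit z ↔ v (z : E) = 1 := by
    refine ⟨fun ⟨u, hu⟩ ↦ ?_, fun h ↦ ?_⟩
    · have h1 : v (u : E) ≤ 1 := (u : v.valuationSubring hv).2
      have h2 : v ((u⁻¹ : (v.valuationSubring hv)ˣ) : E) ≤ 1 :=
        ((u⁻¹ : (v.valuationSubring hv)ˣ) : v.valuationSubring hv).2
      have h3 : v (u : E) * v ((u⁻¹ : (v.valuationSubring hv)ˣ) : E) = 1 := by
        rw [← map_mul, ← map_one v]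
        exact congrArg (fun a : v.valuationSubring hv ↦ v (a : E)) u.mul_inv
      rw [← hu]
      nlinarith [v.nonneg (u : E)]
    · have h0 : (z : E) ≠ 0 := by intro h0; rw [h0, map_zero] at h; exact zero_ne_one h
      exact IsUnit.of_mul_eq_one ⟨(z : E)⁻¹, by
        change v (z : E)⁻¹ ≤ 1; rw [map_inv₀, h, inv_one]⟩ (Subtype.ext (mul_inv_cancel₀ h0))
  rw [hz]
  exact ⟨fun h ↦ le_antisymm (x - y).2 (not_lt.1 h), fun h ↦ by
    simpa using h.ge⟩

/-- For the residue field: dividing an equation of an integral `x` by its largest coefficient leaves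
a nonzero equation after reduction, of bounded degree and with coefficients in the finite set of
residues coming from `F`. There are finitely many such equations, each with finitely many roots. -/
theorem IsDiscreteFinite.of_finiteDimensional [FiniteDimensional F E] {v : AbsoluteValue E ℝ}
    (h : IsDiscreteFinite (v.comp (algebraMap F E).injective)) (hv : IsNonarchimedean v) :
    IsDiscreteFinite v := by
  classical
  refine ⟨hv, exists_zpow_of_finiteDimensional hv h.discrete, ?_⟩
  let O := v.valuationSubring hv
  let κ := IsLocalRing.ResidueField O
  obtain ⟨R, hR, hR1, hR2⟩ := h.residue
  let C : Set κ := {c | ∃ r ∈ R, ∃ y : O, (y : E) = algebraMap F E r ∧ c = IsLocalRing.residue O y}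
  have hC : C.Finite := by
    have : C ⊆ R.image (fun r ↦ if hr : v (algebraMap F E r) ≤ 1 then
        IsLocalRing.residue O ⟨algebraMap F E r, hr⟩ else 0) := by
      rintro c ⟨r, hr, ⟨y, hy⟩, rfl, rfl⟩
      exact ⟨r, hr, dif_pos hy⟩
    exact (hR.image _).subset this
  let n := Module.finrank F E
  let Q : Set κ[X] := (fun f : Fin (n + 1) → κ ↦ ∑ i : Fin (n + 1), Polynomial.monomial (i : ℕ) (f i)) ''
    (Set.univ.pi fun _ ↦ C)
  have hQ : Q.Finite := (Set.Finite.pi fun _ ↦ hC).image _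
  have hcov : (Set.univ : Set κ) ⊆ insert 0 (⋃ g ∈ Q \ {0}, {x | x ∈ g.roots.toFinset}) := by
    intro x _
    obtain ⟨x, rfl⟩ := IsLocalRing.residue_surjective x
    by_cases hx0 : (x : E) = 0
    · left
      have : x = 0 := Subtype.ext hx0
      rw [this, map_zero]
    right
    obtain ⟨p, hp0, hpn, hpx⟩ : ∃ p : F[X], p ≠ 0 ∧ p.natDegree ≤ n ∧ aeval (x : E) p = 0 :=
      ⟨minpoly F (x : E), minpoly.ne_zero (Algebra.IsIntegral.isIntegral _),
        minpoly.natDegree_le _, minpoly.aeval _ _⟩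
    obtain ⟨k, hk, hkmax⟩ := p.support.exists_max_image (fun i ↦ v (algebraMap F E (p.coeff i)))
      (nonempty_support_iff.2 hp0)
    have hk0 : p.coeff k ≠ 0 := mem_support_iff.1 hk
    have hvk : 0 < v (algebraMap F E (p.coeff k)) := v.pos (by simpa using hk0)
    have hle (i : ℕ) : v (algebraMap F E (p.coeff i / p.coeff k)) ≤ 1 := by
      rw [map_div₀, map_div₀, div_le_one hvk]
      by_cases hi : i ∈ p.support
      · exact hkmax i hi
      · rw [notMem_support_iff.1 hi, map_zero, map_zero]; exact hvk.le
    choose r hr hr' using fun i ↦ hR2 (p.coeff i / p.coeff k) (hle i)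
    let a (i : ℕ) : O := ⟨algebraMap F E (p.coeff i / p.coeff k), hle i⟩
    let b (i : ℕ) : O := ⟨algebraMap F E (r i), hR1 _ (hr i)⟩
    have hab (i : ℕ) : IsLocalRing.residue O (b i) = IsLocalRing.residue O (a i) := by
      rw [eq_comm, AbsoluteValue.residue_eq_iff]
      have : v (algebraMap F E (p.coeff i / p.coeff k - r i)) < 1 := hr' i
      rwa [map_sub] at this
    let g : κ[X] := ∑ i : Fin (n + 1), Polynomial.monomial i (IsLocalRing.residue O (b i))
    have hkn : k < n + 1 := Nat.lt_succ_of_le ((le_natDegree_of_mem_supp _ hk).trans hpn)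
    have hg0 : g ≠ 0 := by
      intro h0
      have := congrArg (fun f ↦ f.coeff k) h0
      simp only [g, finsetSum_coeff, coeff_monomial, coeff_zero] at this
      rw [Finset.sum_eq_single ⟨k, hkn⟩ (fun i _ hi ↦ if_neg fun h ↦ hi (Fin.ext h)) (by simp),
        if_pos rfl, hab] at this
      have h1 : a k = 1 := Subtype.ext (by simp [a, hk0])
      rw [h1, map_one] at this
      exact one_ne_zero this
    simp only [Set.mem_iUnion]
    refine ⟨g, ⟨⟨fun i ↦ IsLocalRing.residue O (b i), fun i _ ↦ ⟨r i, hr i, b i, rfl, rfl⟩, rfl⟩, hg0⟩, ?_⟩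
    simp only [Multiset.mem_toFinset, Set.mem_ofPred_eq, mem_roots hg0, IsRoot.def]
    have : ∑ i : Fin (n + 1), a i * x ^ (i : ℕ) = 0 := by
      refine Subtype.ext ?_
      push_cast
      rw [aeval_eq_sum_range' (Nat.lt_succ_of_le hpn), Finset.sum_range] at hpx
      simp only [a, map_div₀, div_mul_eq_mul_div]
      rw [← Finset.sum_div]
      simp only [← Algebra.smul_def, hpx, zero_div]
    simp only [g, eval_finsetSum, eval_monomial, hab, ← map_pow, ← map_mul, ← map_sum, this,
      map_zero]
  have hfin : (Set.univ : Set κ).Finite := by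
    refine (((hQ.subset Set.sdiff_subset).biUnion fun g _ ↦ ?_).insert 0).subset hcov
    exact g.roots.toFinset.finite_toSet
  have : Finite κ := Set.finite_univ_iff.1 hfin
  have hq : Function.Surjective (IsLocalRing.residue O) := IsLocalRing.residue_surjective
  refine ⟨Set.range fun c : κ ↦ ((Function.surjInv hq c : O) : E), Set.finite_range _, ?_, fun x hx ↦ ?_⟩
  · rintro _ ⟨c, rfl⟩; exact (Function.surjInv hq c).2
  · refine ⟨_, ⟨IsLocalRing.residue O ⟨x, hx⟩, rfl⟩, ?_⟩
    exact (v.residue_eq_iff hv ⟨x, hx⟩ _).1 (Function.surjInv_eq hq _).symm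

end Extension

end

/-! ### Nonarchimedean absolute values of global fields -/

section

open Polynomial

theorem AbsoluteValue.isNonarchimedean_of_natCast_le_one {F : Type*} [Field F]
    {v : AbsoluteValue F ℝ} (h : ∀ n : ℕ, v n ≤ 1) : IsNonarchimedean v := by
  have : IsUltrametricDist (WithAbs v) :=
    IsUltrametricDist.isUltrametricDist_of_forall_norm_natCast_le_one fun n ↦ h n
  intro x y
  exact IsUltrametricDist.norm_add_le_max (WithAbs.toAbs v x) (WithAbs.toAbs v y)

/-- By Fermat `n ^ p = n` in `F`, so the integers have value 0 or 1. -/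
theorem AbsoluteValue.isNonarchimedean_of_charP {F : Type*} [Field F] (p : ℕ) [hp : Fact p.Prime]
    [CharP F p] (v : AbsoluteValue F ℝ) : IsNonarchimedean v := by
  refine AbsoluteValue.isNonarchimedean_of_natCast_le_one fun n ↦ ?_
  have h1 : ((n : F)) ^ p = n := by
    have := ZMod.pow_card (n : ZMod p)
    have := congrArg (ZMod.castHom dvd_rfl F) this
    rwa [map_pow, map_natCast] at this
  have h2 : v n ^ p = v n := by rw [← map_pow, h1]
  by_contra! h
  have := pow_lt_pow_right₀ h hp.out.one_lt
  rw [h2, pow_one] at this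
  exact lt_irrefl _ this

section

variable {F E : Type*} [Field F] [Field E] [Algebra F E]

theorem AbsoluteValue.isNonarchimedean_comp_iff (v : AbsoluteValue E ℝ) :
    IsNonarchimedean (v.comp (algebraMap F E).injective) ↔ IsNonarchimedean v := by
  refine ⟨fun h ↦ AbsoluteValue.isNonarchimedean_of_natCast_le_one fun n ↦ ?_, fun h x y ↦ ?_⟩
  · have : v (algebraMap F E n) ≤ 1 := h.apply_natCast_le_one
    rwa [map_natCast] at this
  · change v (algebraMap F E (x + y)) ≤ _
    rw [map_add]
    exact h _ _

/-- If `v` is trivial on `F`, then it is bounded on integers, hence nonarchimedean, and some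
positive power of each nonzero `x` has the value of an element of `F`, namely 1. -/
theorem AbsoluteValue.isNontrivial_comp_of_finiteDimensional [FiniteDimensional F E]
    {v : AbsoluteValue E ℝ} (hv : v.IsNontrivial) :
    (v.comp (algebraMap F E).injective).IsNontrivial := by
  by_contra h
  simp only [AbsoluteValue.IsNontrivial, not_exists, not_and, not_not] at h
  replace h (x : F) (hx : x ≠ 0) : v (algebraMap F E x) = 1 := h x hx
  have hna : IsNonarchimedean v := AbsoluteValue.isNonarchimedean_of_natCast_le_one fun n ↦ by
    by_cases hn : (n : F) = 0
    · have : (n : E) = 0 := by rw [← map_natCast (algebraMap F E), hn, map_zero]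
      simp [this]
    · rw [← map_natCast (algebraMap F E), h _ hn]
  obtain ⟨x, hx0, hx1⟩ := hv
  obtain ⟨j, hj, -, c, hc, he⟩ := AbsoluteValue.exists_pow_eq_of_finiteDimensional (F := F) hna hx0
  rw [h c hc, pow_eq_one_iff_of_nonneg (v.nonneg _) hj.ne'] at he
  exact hx1 he

end

section RationalFunctions

variable {k : Type*} [Field k] {v : AbsoluteValue (RatFunc k) ℝ}

theorem AbsoluteValue.algebraMap_le_pow_natDegree (hv : IsNonarchimedean v)
    (hc : ∀ c : k, v (RatFunc.C c) ≤ 1) (hX : 1 ≤ v RatFunc.X) (f : k[X]) {n : ℕ}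
    (hn : f.natDegree ≤ n) : v (algebraMap k[X] (RatFunc k) f) ≤ v RatFunc.X ^ n := by
  refine Polynomial.induction_with_natDegree_le
    (fun f ↦ v (algebraMap k[X] (RatFunc k) f) ≤ v RatFunc.X ^ n) n ?_ ?_ ?_ f hn
  · simp
  · intro i c hc0 hi
    rw [map_mul, map_pow, RatFunc.algebraMap_C, RatFunc.algebraMap_X, map_mul, map_pow]
    exact (mul_le_of_le_one_left (by positivity) (hc c)).trans (pow_le_pow_right₀ hX hi)
  · intro f g hlt hg hf1 hg1
    rw [map_add]
    exact (hv _ _).trans (max_le hf1 hg1)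

theorem AbsoluteValue.algebraMap_eq_pow_natDegree (hv : IsNonarchimedean v)
    (hc : ∀ c : k, c ≠ 0 → v (RatFunc.C c) = 1) (hX : 1 < v RatFunc.X) {f : k[X]} (hf : f ≠ 0) :
    v (algebraMap k[X] (RatFunc k) f) = v RatFunc.X ^ f.natDegree := by
  have hc' (c : k) : v (RatFunc.C c) ≤ 1 := by
    by_cases h : c = 0
    · simp [h]
    · exact (hc c h).le
  have hlead : v (algebraMap k[X] (RatFunc k) (C f.leadingCoeff * X ^ f.natDegree)) =
      v RatFunc.X ^ f.natDegree := by
    rw [map_mul, map_pow, RatFunc.algebraMap_C, RatFunc.algebraMap_X, map_mul, map_pow,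
      hc _ (leadingCoeff_ne_zero.2 hf), one_mul]
  rcases Nat.eq_zero_or_pos f.natDegree with h0 | h0
  · obtain ⟨c, rfl⟩ := natDegree_eq_zero.1 h0
    rw [RatFunc.algebraMap_C, hc c (by simpa using hf), h0, pow_zero]
  have hlt : v (algebraMap k[X] (RatFunc k) f.eraseLead) <
      v (algebraMap k[X] (RatFunc k) (C f.leadingCoeff * X ^ f.natDegree)) := by
    rw [hlead]
    exact (AbsoluteValue.algebraMap_le_pow_natDegree hv hc' hX.le _
      (eraseLead_natDegree_le f)).trans_lt (pow_lt_pow_right₀ hX (Nat.sub_lt h0 one_pos))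
  have := IsNonarchimedean.add_eq_right_of_lt hv hlt
  rwa [← map_add, eraseLead_add_C_mul_X_pow, hlead] at this

/-- This is the place at infinity: the degree determines the value, `X⁻¹` is a uniformizer and the
constants are the residues. -/
theorem isDiscreteFinite_of_one_lt_X [Finite k] (hv : IsNonarchimedean v)
    (hc : ∀ c : k, c ≠ 0 → v (RatFunc.C c) = 1) (hX : 1 < v RatFunc.X) : IsDiscreteFinite v := by
  have hc' (c : k) : v (RatFunc.C c) ≤ 1 := by
    by_cases h : c = 0
    · simp [h]
    · exact (hc c h).le
  have hX0 : 0 < v RatFunc.X := zero_lt_one.trans hX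
  refine ⟨hv, ⟨RatFunc.X⁻¹, ?_, ?_, fun x hx ↦ ?_⟩, Set.range fun c : k ↦ RatFunc.C c,
    Set.finite_range _, ?_, fun x hx ↦ ?_⟩
  · rw [map_inv₀]; positivity
  · rw [map_inv₀]; exact inv_lt_one_of_one_lt₀ hX
  · obtain ⟨f, g, hg, rfl⟩ := IsFractionRing.div_surjective (A := k[X]) x
    have hf : f ≠ 0 := by rintro rfl; simp at hx
    refine ⟨g.natDegree - f.natDegree, ?_⟩
    rw [map_div₀, AbsoluteValue.algebraMap_eq_pow_natDegree hv hc hX hf,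
      AbsoluteValue.algebraMap_eq_pow_natDegree hv hc hX (nonZeroDivisors.ne_zero hg), map_inv₀,
      inv_zpow', neg_sub, zpow_sub₀ hX0.ne', zpow_natCast, zpow_natCast]
  · rintro _ ⟨c, rfl⟩; exact hc' c
  · obtain ⟨f, g, hg, rfl⟩ := IsFractionRing.div_surjective (A := k[X]) x
    have hg0 := nonZeroDivisors.ne_zero hg
    have hvg := AbsoluteValue.algebraMap_eq_pow_natDegree hv hc hX hg0
    suffices h : ∃ c : k, v (algebraMap k[X] (RatFunc k) (f - C c * g)) <
        v (algebraMap k[X] (RatFunc k) g) by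
      obtain ⟨c, h⟩ := h
      refine ⟨_, ⟨c, rfl⟩, ?_⟩
      have h0 : algebraMap k[X] (RatFunc k) g ≠ 0 := by simpa using hg0
      rw [← div_lt_one (v.pos h0), ← map_div₀] at h
      rwa [map_sub, map_mul, RatFunc.algebraMap_C, sub_div, mul_div_cancel_right₀ _ h0] at h
    by_cases hf : f = 0
    · exact ⟨0, by simpa [hf] using hg0⟩
    have hvf := AbsoluteValue.algebraMap_eq_pow_natDegree hv hc hX hf
    have hle : f.natDegree ≤ g.natDegree := by
      rw [map_div₀, hvf, hvg, div_le_one (by positivity)] at hx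
      exact (pow_le_pow_iff_right₀ hX).1 hx
    rcases hle.lt_or_eq with hlt | heq
    · refine ⟨0, ?_⟩
      rw [C_0, zero_mul, sub_zero, hvf, hvg]
      exact pow_lt_pow_right₀ hX hlt
    -- Cancelling the leading terms lowers the degree, hence the value.
    · refine ⟨f.leadingCoeff / g.leadingCoeff, ?_⟩
      have hlg := leadingCoeff_ne_zero.2 hg0
      by_cases hz : f - C (f.leadingCoeff / g.leadingCoeff) * g = 0
      · rw [hz, map_zero, map_zero, hvg]; positivity
      rw [AbsoluteValue.algebraMap_eq_pow_natDegree hv hc hX hz, hvg]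
      refine pow_lt_pow_right₀ hX ?_
      have hlf := leadingCoeff_ne_zero.2 hf
      have hdeg : f.degree = (C (f.leadingCoeff / g.leadingCoeff) * g).degree := by
        rw [degree_C_mul (div_ne_zero hlf hlg), degree_eq_natDegree hf, degree_eq_natDegree hg0, heq]
      have := degree_sub_lt_left hdeg hf (by rw [leadingCoeff_mul, leadingCoeff_C, div_mul_cancel₀ _ hlg])
      rw [← heq]
      exact natDegree_lt_natDegree hz this

/-- Nonzero constants are roots of unity and have value 1. If `X` has value at most 1, all of `k[X]`
is integral at `v` and the principal ideal domain case applies; otherwise `v` is the place at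
infinity. -/
theorem isDiscreteFinite_ratFunc [Finite k] (hv : IsNonarchimedean v) (hn : v.IsNontrivial) :
    IsDiscreteFinite v := by
  have hc (c : k) (hc : c ≠ 0) : v (RatFunc.C c) = 1 := by
    have := Fintype.ofFinite k
    classical
    have h1 := FiniteField.pow_card_sub_one_eq_one c hc
    have h2 : v (RatFunc.C c) ^ (Fintype.card k - 1) = 1 := by
      rw [← map_pow, ← map_pow, h1, map_one, map_one]
    exact (pow_eq_one_iff_of_nonneg (v.nonneg _)
      (Nat.sub_pos_of_lt Fintype.one_lt_card).ne').1 h2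
  rcases lt_or_ge 1 (v RatFunc.X) with hX | hX
  · exact isDiscreteFinite_of_one_lt_X hv hc hX
  · refine isDiscreteFinite_of_isPrincipalIdealRing (A := k[X]) (fun a ha ↦ ?_) hv hn fun f ↦ ?_
    · have : Module.Finite k (AdjoinRoot a) := (AdjoinRoot.powerBasis ha).finite
      exact Module.finite_of_finite k (M := AdjoinRoot a)
    · induction f using Polynomial.induction_on' with
      | add f g hf hg => rw [map_add]; exact (hv _ _).trans (max_le hf hg)
      | monomial n c =>
        rw [← C_mul_X_pow_eq_monomial, map_mul, map_pow, RatFunc.algebraMap_C, RatFunc.algebraMap_X,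
          map_mul, map_pow]
        refine mul_le_one₀ ?_ (by positivity) (pow_le_one₀ (v.nonneg _) hX)
        by_cases h : c = 0
        · simp [h]
        · exact (hc c h).le

end RationalFunctions

theorem IsGlobalField.isDiscreteFinite {F : Type*} [Field F] (hF : IsGlobalField F)
    {v : AbsoluteValue F ℝ} (hv : IsNonarchimedean v) (hn : v.IsNontrivial) :
    IsDiscreteFinite v := by
  rcases hF with hF | ⟨p, hp, _, hF⟩
  · refine IsDiscreteFinite.of_finiteDimensional (F := ℚ) ?_ hv
    refine isDiscreteFinite_of_isPrincipalIdealRing (A := ℤ)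
      (fun a ha ↦ Ring.HasFiniteQuotients.finiteQuotient (by simpa using ha))
      ((AbsoluteValue.isNonarchimedean_comp_iff v).2 hv)
      (AbsoluteValue.isNontrivial_comp_of_finiteDimensional hn) fun a ↦ ?_
    change v (algebraMap ℚ F (algebraMap ℤ ℚ a)) ≤ 1
    rw [eq_intCast, map_intCast]
    exact hv.apply_intCast_le_one
  · exact IsDiscreteFinite.of_finiteDimensional (F := RatFunc (ZMod p))
      (isDiscreteFinite_ratFunc ((AbsoluteValue.isNonarchimedean_comp_iff v).2 hv)
      (AbsoluteValue.isNontrivial_comp_of_finiteDimensional hn)) hv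

end

/-! ### Completions, and existence of a nonarchimedean place -/

section

open Polynomial

namespace AbsoluteValue

variable {F : Type*} [Field F] (v : AbsoluteValue F ℝ)

theorem norm_algebraMap_completion (x : F) : ‖algebraMap F v.Completion x‖ = v x :=
  UniformSpace.Completion.norm_coe (WithAbs.toAbs v x)

theorem denseRange_algebraMap_completion : DenseRange (algebraMap F v.Completion) :=
  UniformSpace.Completion.denseRange_coe.comp (WithAbs.equiv v).symm.surjective.denseRange
    (UniformSpace.Completion.continuous_coe _)

instance isScalarTower_completion {k : Type*} [Field k] [Algebra k F] :
    IsScalarTower k F v.Completion :=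
  IsScalarTower.of_algebraMap_eq fun _ ↦ rfl

variable {v}

/-- The completion at a nontrivial absolute value, as a nontrivially normed field. -/
noncomputable abbrev nontriviallyNormedFieldCompletion (hn : v.IsNontrivial) :
    NontriviallyNormedField v.Completion :=
  NontriviallyNormedField.ofNormNeOne (by
    obtain ⟨x, hx0, hx1⟩ := hn
    exact ⟨algebraMap F v.Completion x, by simpa using hx0, by rwa [norm_algebraMap_completion]⟩)

theorem isUltrametricDist_completion (hv : IsNonarchimedean v) : IsUltrametricDist v.Completion :=
  IsUltrametricDist.isUltrametricDist_of_forall_norm_natCast_le_one fun n ↦ by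
    rw [← map_natCast (algebraMap F v.Completion), norm_algebraMap_completion]
    exact hv.apply_natCast_le_one

/-- An `F`-embedding of `E` in the algebraic closure of the completion pulls back the spectral norm.
-/
theorem exists_isNonarchimedean_of_finiteDimensional {E : Type*} [Field E] [Algebra F E]
    [FiniteDimensional F E] (hv : IsNonarchimedean v) (hn : v.IsNontrivial) :
    ∃ w : AbsoluteValue E ℝ, IsNonarchimedean w ∧ w.IsNontrivial := by
  let := nontriviallyNormedFieldCompletion hn
  have : IsUltrametricDist v.Completion := isUltrametricDist_completion hv
  let Ω := AlgebraicClosure v.Completion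
  let := spectralNorm.normedField v.Completion Ω
  let f : E →ₐ[F] Ω := IsAlgClosed.lift
  have hf (x : F) : ‖f (algebraMap F E x)‖ = v x := by
    rw [f.commutes, IsScalarTower.algebraMap_apply F v.Completion Ω]
    exact (spectralNorm_extends (L := Ω) (algebraMap F v.Completion x)).trans (norm_algebraMap_completion v x)
  let w : AbsoluteValue E ℝ := (NormedField.toAbsoluteValue Ω).comp f.toRingHom.injective
  refine ⟨w, isNonarchimedean_of_natCast_le_one fun n ↦ ?_, ?_⟩
  · have := hf n
    rw [map_natCast] at this
    exact this.trans_le hv.apply_natCast_le_one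
  · obtain ⟨x, hx0, hx1⟩ := hn
    exact ⟨algebraMap F E x, by simpa using hx0, by rw [← hf] at hx1; exact hx1⟩

end AbsoluteValue

/-- This supplies the auxiliary place at which local irreducibility forces global irreducibility,
even if `S` is empty or consists of complex places. -/
theorem IsGlobalField.exists_isNonarchimedean {F : Type*} [Field F] (hF : IsGlobalField F) :
    ∃ v : AbsoluteValue F ℝ, IsNonarchimedean v ∧ v.IsNontrivial := by
  rcases hF with hF | ⟨p, hp, _, hF⟩
  · refine AbsoluteValue.exists_isNonarchimedean_of_finiteDimensional
      (v := Rat.AbsoluteValue.padic 2)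
      (AbsoluteValue.isNonarchimedean_of_natCast_le_one fun n ↦ ?_) ⟨2, two_ne_zero, ?_⟩
    · exact_mod_cast Rat.AbsoluteValue.padic_le_one 2 n
    · rw [Rat.AbsoluteValue.padic_eq_padicNorm]
      rw [show padicNorm 2 2 = (2 : ℚ)⁻¹ from padicNorm.padicNorm_p_of_prime (p := 2)]
      norm_num
  · have hb : (1 : NNReal) < 2 := one_lt_two
    refine AbsoluteValue.exists_isNonarchimedean_of_finiteDimensional
      (v := (Polynomial.idealX (ZMod p)).adicAbv (K := RatFunc (ZMod p)) hb)
      ((Polynomial.idealX (ZMod p)).isNonarchimedean_adicAbv hb) ⟨algebraMap (ZMod p)[X] _ X, ?_, ?_⟩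
    · exact (map_ne_zero_iff _ (IsFractionRing.injective _ _)).2 X_ne_zero
    · refine ne_of_lt (((Polynomial.idealX (ZMod p)).adicAbv_coe_lt_one_iff hb X).2 ?_)
      rw [Polynomial.idealX_span]
      exact Ideal.mem_span_singleton_self X

namespace IsDiscreteFinite

variable {F : Type*} [Field F] {v : AbsoluteValue F ℝ}

theorem exists_max_lt_one (h : IsDiscreteFinite v) :
    ∃ ϖ : F, 0 < v ϖ ∧ v ϖ < 1 ∧ ∀ x : F, v x < 1 → v x ≤ v ϖ := by
  obtain ⟨ϖ, h0, h1, hd⟩ := h.discrete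
  refine ⟨ϖ, h0, h1, fun x hx ↦ ?_⟩
  rcases eq_or_ne x 0 with rfl | hx0
  · simp
  obtain ⟨n, hn⟩ := hd x hx0
  rw [hn] at hx ⊢
  have hn1 : 1 ≤ n := by
    by_contra! hlt
    exact absurd (one_le_zpow_of_nonpos₀ h0 h1.le (by lia)) hx.not_ge
  calc v ϖ ^ n ≤ v ϖ ^ (1 : ℤ) := zpow_le_zpow_right_of_le_one₀ h0 h1.le hn1
    _ = v ϖ := zpow_one _

/-- Finiteness of the residue field gives its multiplicative group an exponent: by the pigeonhole
principle two small powers of `x` are congruent, and a factorial handles all `x` at once. -/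
theorem exists_pow_sub_one_lt (h : IsDiscreteFinite v) :
    ∃ N : ℕ, 0 < N ∧ ∀ x : F, v x = 1 → v (x ^ N - 1) < 1 := by
  obtain ⟨R, hR, -, hR2⟩ := h.residue
  refine ⟨hR.toFinset.card.factorial, Nat.factorial_pos _, fun x hx ↦ ?_⟩
  choose f hf hf' using fun i : ℕ ↦ hR2 (x ^ i) (by rw [map_pow, hx, one_pow])
  have hcard : hR.toFinset.card < (Finset.range (hR.toFinset.card + 1)).card := by simp
  obtain ⟨i, hi, j, hj, hij, he⟩ := Finset.exists_ne_map_eq_of_card_lt_of_maps_to hcard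
    (f := f) (fun i _ ↦ by simpa using hf i)
  wlog hlt : i < j generalizing i j
  · exact this j hj i hi hij.symm he.symm (hij.lt_or_gt.resolve_left hlt)
  have h1 : v (x ^ (j - i) - 1) < 1 := by
    have h2 : v (x ^ j - x ^ i) < 1 := by
      have := AbsoluteValue.sub_le_max h.nonarch (x ^ j - f j) (x ^ i - f i)
      rw [← he, sub_sub_sub_cancel_right] at this
      exact this.trans_lt (max_lt (by rw [he]; exact hf' j) (hf' i))
    have h3 : x ^ j - x ^ i = x ^ i * (x ^ (j - i) - 1) := by
      rw [mul_sub, mul_one, ← pow_add, Nat.add_sub_cancel' hlt.le]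
    rwa [h3, map_mul, map_pow, hx, one_pow, one_mul] at h2
  obtain ⟨q, hq⟩ := Nat.dvd_factorial (Nat.sub_pos_of_lt hlt)
    (show j - i ≤ hR.toFinset.card by simp at hj; lia)
  rw [hq, pow_mul]
  clear hq
  have hy : v (x ^ (j - i)) = 1 := by rw [map_pow, hx, one_pow]
  generalize x ^ (j - i) = y at h1 hy
  induction q with
  | zero => simp
  | succ q ih =>
    have : y ^ (q + 1) - 1 = y * (y ^ q - 1) + (y - 1) := by ring
    rw [this]
    refine (h.nonarch _ _).trans_lt (max_lt ?_ h1)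
    rw [map_mul, hy, one_mul]
    exact ih

end IsDiscreteFinite

end

/-! ### Composita of fields, and powers in cyclic extensions -/

section

open Polynomial
open scoped TensorProduct

section Compositum

variable (k K F E : Type*) [Field k] [Field K] [Field F] [Field E] [Algebra k K] [Algebra k F]
  [Algebra K E] [Algebra F E] [Algebra k E] [IsScalarTower k K E] [IsScalarTower k F E]

/-- The canonical map from the tensor product to a field containing both factors. -/
noncomputable def compositumMap : F ⊗[k] K →ₐ[F] E :=
  Algebra.TensorProduct.lift (Algebra.ofId F E) (IsScalarTower.toAlgHom k K E)
    fun _ _ ↦ mul_comm _ _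

variable {k K F E}

theorem compositumMap_tmul (a : F) (x : K) :
    compositumMap k K F E (a ⊗ₜ x) = algebraMap F E a * algebraMap K E x := rfl

/-- The image is a finite-dimensional `𝕜`-subspace, hence closed, and it contains the dense image of
`K`. Consequently a completion of `K` is the compositum of `K` with the completion of `k`. -/
theorem compositumMap_surjective_of_denseRange [FiniteDimensional k K] {𝕜 : Type*}
    [NontriviallyNormedField 𝕜] [CompleteSpace 𝕜] [Algebra k 𝕜] [TopologicalSpace E]
    [IsTopologicalRing E] [T2Space E] [Algebra 𝕜 E] [IsScalarTower k 𝕜 E]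
    (hc : Continuous (algebraMap 𝕜 E)) (hd : DenseRange (algebraMap K E)) :
    Function.Surjective (compositumMap k K 𝕜 E) := by
  have : ContinuousSMul 𝕜 E := ⟨by
    simp only [Algebra.smul_def]
    exact (hc.comp continuous_fst).mul continuous_snd⟩
  let Φ : 𝕜 ⊗[k] K →ₗ[𝕜] E := (compositumMap k K 𝕜 E).toLinearMap
  have hΦ : DenseRange Φ := by
    refine hd.mono ?_
    rintro _ ⟨x, rfl⟩
    exact ⟨1 ⊗ₜ x, by simp [Φ, compositumMap_tmul]⟩
  have : Set.range Φ = Set.univ := by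
    rw [← LinearMap.coe_range, ← (LinearMap.range Φ).closed_of_finiteDimensional.closure_eq]
    exact hΦ.closure_range
  exact Set.range_eq_univ.1 this

variable (h : Function.Surjective (compositumMap k K F E))
include h

theorem finiteDimensional_of_compositumMap_surjective [FiniteDimensional k K] :
    FiniteDimensional F E :=
  Module.Finite.of_surjective (compositumMap k K F E).toLinearMap h

theorem finrank_le_of_compositumMap_surjective [FiniteDimensional k K] :
    Module.finrank F E ≤ Module.finrank k K := by
  have := LinearMap.finrank_le_finrank_of_surjective (f := (compositumMap k K F E).toLinearMap) h
  rwa [Module.finrank_baseChange] at this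

theorem induction_of_compositumMap_surjective {p : E → Prop}
    (hmul : ∀ (a : F) (x : K), p (algebraMap F E a * algebraMap K E x))
    (hadd : ∀ x y, p x → p y → p (x + y)) (z : E) : p z := by
  obtain ⟨t, rfl⟩ := h z
  induction t with
  | zero => simpa using hmul 0 0
  | tmul a x => exact hmul a x
  | add x y hx hy => rw [map_add]; exact hadd _ _ hx hy

theorem isGalois_of_compositumMap_surjective [FiniteDimensional k K] [IsGalois k K] :
    IsGalois F E := by
  obtain ⟨T, hT, hs⟩ := IsGalois.is_separable_splitting_field k K
  have : (T.map (algebraMap k F)).IsSplittingField F E := by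
    refine ⟨?_, ?_⟩
    · rw [Polynomial.map_map, ← IsScalarTower.algebraMap_eq]
      exact hs.splits.of_algHom (IsScalarTower.toAlgHom k K E)
    · refine eq_top_iff.2 fun z _ ↦ ?_
      refine induction_of_compositumMap_surjective (p := fun z ↦ z ∈ Algebra.adjoin F _) h
        (fun a x ↦ mul_mem (Subalgebra.algebraMap_mem _ a) ?_) (fun x y hx hy ↦ add_mem hx hy) z
      have hx : x ∈ Algebra.adjoin k (T.rootSet K) := by rw [hs.adjoin_rootSet]; trivial
      induction hx using Algebra.adjoin_induction with
      | mem x hx =>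
        refine Algebra.subset_adjoin ?_
        rw [mem_rootSet'] at hx ⊢
        refine ⟨?_, ?_⟩
        · rw [Polynomial.map_map, ← IsScalarTower.algebraMap_eq]
          exact (Polynomial.map_ne_zero_iff (algebraMap k E).injective).2 hT.ne_zero
        · rw [aeval_map_algebraMap, aeval_algebraMap_apply, hx.2, map_zero]
      | algebraMap r =>
        rw [← IsScalarTower.algebraMap_apply, IsScalarTower.algebraMap_apply k F E]
        exact Subalgebra.algebraMap_mem _ _
      | add x y _ _ hx hy => rw [map_add]; exact add_mem hx hy
      | mul x y _ _ hx hy => rw [map_mul]; exact mul_mem hx hy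
  exact IsGalois.of_separable_splitting_field (p := T.map (algebraMap k F)) hT.map

/-- Restriction to `K` embeds `Gal(E/F)` in `Gal(K/k)`, since `F` and `K` generate `E`:
decomposition groups in a cyclic group are cyclic. -/
theorem isCyclic_of_compositumMap_surjective [Normal k K] [IsCyclic Gal(K/k)] :
    IsCyclic Gal(E/F) := by
  refine isCyclic_of_injective
    ((AlgEquiv.restrictNormalHom (F := k) K).comp (AlgEquiv.restrictScalarsHom k))
    ((injective_iff_map_eq_one _).2 fun σ hσ ↦ AlgEquiv.ext fun z ↦ ?_)
  refine induction_of_compositumMap_surjective (p := fun z ↦ σ z = z) h (fun a x ↦ ?_)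
    (fun x y hx hy ↦ by rw [map_add, hx, hy]) z
  have := AlgEquiv.restrictNormal_commutes (AlgEquiv.restrictScalarsHom k σ) K x
  have h1 : (AlgEquiv.restrictScalarsHom k σ).restrictNormal K x = x :=
    congrArg (fun f : Gal(K/k) ↦ f x) hσ
  rw [h1] at this
  rw [map_mul, σ.commutes]
  exact congrArg _ this.symm

end Compositum

section Kummer

variable {k F E : Type*} [Field k] [Field F] [Field E] [Algebra k F] [Algebra F E] [Algebra k E]
  [IsScalarTower k F E] [FiniteDimensional F E] [IsGalois F E] [IsCyclic Gal(E/F)]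

/-- In a cyclic extension `E / F`, two elements of `F` that become `ℓ`-th powers in `E` are
dependent modulo `ℓ`-th powers of `F`. -/
theorem exists_pow_mul_eq_pow_of_isCyclic {ℓ : ℕ} (hℓ : ℓ.Prime) {ζ : F}
    (hζ : IsPrimitiveRoot ζ ℓ) {b c : F} (hb0 : b ≠ 0) (hc0 : c ≠ 0) {y z : E}
    (hy : y ^ ℓ = algebraMap F E b) (hz : z ^ ℓ = algebraMap F E c) :
    (∃ x : F, x ^ ℓ = b) ∨ ∃ (i : ℕ) (x : F), x ^ ℓ = c * b ^ i := by
  obtain ⟨τ, hτ⟩ := IsCyclic.exists_generator (α := Gal(E/F))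
  have hfix (x : E) (hx : τ x = x) : ∃ a : F, algebraMap F E a = x := by
    rw [← Set.mem_range, IsGalois.mem_range_algebraMap_iff_fixed]
    intro f
    have : f ∈ MulAction.stabilizer Gal(E/F) x := by
      refine (Subgroup.zpowers_le.2 ?_) (hτ f)
      exact hx
    exact this
  have hζE : IsPrimitiveRoot (algebraMap F E ζ) ℓ := hζ.map_of_injective (algebraMap F E).injective
  have hroot {w : E} {d : F} (hd : d ≠ 0) (hw : w ^ ℓ = algebraMap F E d) :
      ∃ i : ℕ, τ w = w * algebraMap F E ζ ^ i := by
    have hw0 : w ≠ 0 := by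
      rintro rfl
      rw [zero_pow hℓ.ne_zero, eq_comm, map_eq_zero] at hw
      exact hd hw
    have : (τ w / w) ^ ℓ = 1 := by
      rw [div_pow, ← map_pow, hw, AlgEquiv.commutes, div_self (by simpa using hd)]
    have : NeZero ℓ := ⟨hℓ.ne_zero⟩
    obtain ⟨i, -, hi⟩ := hζE.eq_pow_of_pow_eq_one ‹(τ w / w) ^ ℓ = 1›
    exact ⟨i, by rw [hi, mul_div_cancel₀ _ hw0]⟩
  obtain ⟨i, hi⟩ := hroot hb0 hy
  obtain ⟨j, hj⟩ := hroot hc0 hz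
  by_cases hil : ℓ ∣ i
  · left
    obtain ⟨q, rfl⟩ := hil
    rw [pow_mul, hζE.pow_eq_one, one_pow, mul_one] at hi
    obtain ⟨a, rfl⟩ := hfix y hi
    exact ⟨a, (algebraMap F E).injective (by rw [map_pow, hy])⟩
  · right
    -- With this `s` the generator fixes `z * y ^ s`, because the two powers of `ζ` cancel.
    obtain ⟨s, hs⟩ : ∃ s : ℕ, ℓ ∣ j + i * s := by
      have hcop : Nat.Coprime i ℓ := ((Nat.Prime.coprime_iff_not_dvd hℓ).2 hil).symm
      have : Fact ℓ.Prime := ⟨hℓ⟩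
      have hi0 : (i : ZMod ℓ) ≠ 0 := by rwa [Ne, ZMod.natCast_eq_zero_iff]
      refine ⟨(-(j : ZMod ℓ) / i).val, ?_⟩
      rw [← ZMod.natCast_eq_zero_iff]
      push_cast
      rw [ZMod.natCast_zmod_val]
      field_simp
      ring
    have : τ (z * y ^ s) = z * y ^ s := by
      rw [map_mul, map_pow, hi, hj, mul_pow, ← pow_mul]
      calc _ = z * y ^ s * algebraMap F E ζ ^ (j + i * s) := by rw [pow_add]; ring
        _ = _ := by
          obtain ⟨q, hq⟩ := hs
          rw [hq, pow_mul, hζE.pow_eq_one, one_pow, mul_one]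
    obtain ⟨a, ha⟩ := hfix _ this
    refine ⟨s, a, (algebraMap F E).injective ?_⟩
    rw [map_pow, ha, mul_pow, ← pow_mul, mul_comm s, pow_mul, hy, hz, map_mul, map_pow]

/-- In a cyclic extension `E / F` such that `F` does not contain the `ℓ`-th roots of unity, an
element of `F` that becomes an `ℓ`-th power in `E` is one in `F`. -/
theorem exists_pow_eq_of_isCyclic {ℓ : ℕ} (hℓ : ℓ.Prime) {ζ : E} (hζ : IsPrimitiveRoot ζ ℓ)
    (hF : ζ ∉ (algebraMap F E).range) {b : F} (hb0 : b ≠ 0) {y : E}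
    (hy : y ^ ℓ = algebraMap F E b) : ∃ x : F, x ^ ℓ = b := by
  obtain ⟨τ, hτ⟩ := IsCyclic.exists_generator (α := Gal(E/F))
  have hfix (x : E) (hx : τ x = x) : ∃ a : F, algebraMap F E a = x := by
    rw [← Set.mem_range, IsGalois.mem_range_algebraMap_iff_fixed]
    intro f
    have : f ∈ MulAction.stabilizer Gal(E/F) x := by
      refine (Subgroup.zpowers_le.2 ?_) (hτ f)
      exact hx
    exact this
  have : Fact ℓ.Prime := ⟨hℓ⟩
  have : NeZero ℓ := ⟨hℓ.ne_zero⟩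
  have hy0 : y ≠ 0 := by
    rintro rfl
    rw [zero_pow hℓ.ne_zero, eq_comm, map_eq_zero] at hy
    exact hb0 hy
  obtain ⟨j, -, hj⟩ := hζ.eq_pow_of_pow_eq_one (ξ := τ ζ) (by rw [← map_pow, hζ.pow_eq_one, map_one])
  obtain ⟨s, -, hs⟩ := hζ.eq_pow_of_pow_eq_one (ξ := τ y / y) (by
    rw [div_pow, ← map_pow, hy, AlgEquiv.commutes, div_self (by simpa using hb0)])
  have hj1 : (j : ZMod ℓ) ≠ 1 := by
    intro h
    have h1 : τ ζ = ζ := by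
      rw [← hj]
      conv_rhs => rw [← pow_one ζ]
      refine pow_eq_pow_of_modEq ((ZMod.natCast_eq_natCast_iff _ _ _).1 ?_) hζ.pow_eq_one
      simpa using h
    exact hF (hfix ζ h1)
  -- As `τ` moves `ζ`, the exponent `j` is not 1 modulo `ℓ`, and the congruence is solvable; it says
  -- that `y * ζ ^ i` is fixed by `τ`.
  obtain ⟨i, hi⟩ : ∃ i : ℕ, (s + j * i : ℕ) ≡ i [MOD ℓ] := by
    refine ⟨((s : ZMod ℓ) / (1 - j)).val, ?_⟩
    rw [← ZMod.natCast_eq_natCast_iff]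
    push_cast
    rw [ZMod.natCast_zmod_val]
    have := sub_ne_zero.2 hj1.symm
    field_simp
    ring
  have : τ (y * ζ ^ i) = y * ζ ^ i := by
    rw [map_mul, map_pow, ← hj, show τ y = y * ζ ^ s by rw [hs, mul_div_cancel₀ _ hy0], mul_assoc,
      ← pow_mul, ← pow_add, pow_eq_pow_of_modEq hi hζ.pow_eq_one]
  obtain ⟨a, ha⟩ := hfix _ this
  refine ⟨a, (algebraMap F E).injective ?_⟩
  rw [map_pow, ha, mul_pow, ← pow_mul, mul_comm i, pow_mul, hζ.pow_eq_one, one_pow, mul_one, hy]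

end Kummer

end

/-! ### Nonpowers in dense ultrametric completions -/

section

section DenseUltrametric

variable {k F : Type*} [Field k] [NormedField F] [IsUltrametricDist F] [Algebra k F]
  {u : AbsoluteValue k ℝ}

theorem isNonarchimedean_toAbsoluteValue (F : Type*) [NormedField F] [IsUltrametricDist F] :
    IsNonarchimedean (NormedField.toAbsoluteValue F) :=
  fun x y ↦ IsUltrametricDist.norm_add_le_max x y

variable (hu : ∀ x : k, ‖algebraMap k F x‖ = u x) (hd : DenseRange (algebraMap k F))
include hu hd

theorem exists_norm_sub_lt_of_denseRange {y : F} (hy : y ≠ 0) :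
    ∃ x : k, u x = ‖y‖ ∧ ‖y - algebraMap k F x‖ < ‖y‖ := by
  obtain ⟨x, hx⟩ := hd.exists_dist_lt y (norm_pos_iff.2 hy)
  rw [dist_eq_norm] at hx
  refine ⟨x, ?_, hx⟩
  rw [← hu]
  refine le_antisymm ?_ ?_
  · have := IsUltrametricDist.norm_add_le_max (algebraMap k F x - y) y
    rw [sub_add_cancel, norm_sub_rev, max_eq_right hx.le] at this
    exact this
  · have := IsUltrametricDist.norm_add_le_max (y - algebraMap k F x) (algebraMap k F x)
    rw [sub_add_cancel] at this
    rcases le_max_iff.1 this with h | h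
    · exact absurd h hx.not_ge
    · exact h

theorem norm_le_of_norm_lt_one {ϖ : k} (hϖ : ∀ x : k, u x < 1 → u x ≤ u ϖ) {y : F}
    (hy : ‖y‖ < 1) : ‖y‖ ≤ u ϖ := by
  rcases eq_or_ne y 0 with rfl | hy0
  · simp
  obtain ⟨x, hx, -⟩ := exists_norm_sub_lt_of_denseRange hu hd hy0
  rw [← hx] at hy ⊢
  exact hϖ x hy

/-- By density `F` has the same values as `k`, so an element of norm less than 1 has norm at most `u
ϖ`, and its `n`-th power has norm at most `u ϖ ^ 2 < u ϖ`. -/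
theorem norm_pow_ne_of_max {ϖ : k} (h0 : 0 < u ϖ) (h1 : u ϖ < 1)
    (hϖ : ∀ x : k, u x < 1 → u x ≤ u ϖ) {n : ℕ} (hn : 2 ≤ n) (y : F) : ‖y‖ ^ n ≠ u ϖ := by
  intro h
  have hy : ‖y‖ < 1 := by
    by_contra! hge
    exact absurd (one_le_pow₀ hge (n := n)) (by rw [h]; exact h1.not_ge)
  have hle := norm_le_of_norm_lt_one hu hd hϖ hy
  have h2 : ‖y‖ ^ n ≤ u ϖ ^ 2 :=
    (pow_le_pow_left₀ (norm_nonneg _) hle n).trans (pow_le_pow_of_le_one h0.le h1.le hn)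
  rw [h] at h2
  nlinarith

/-- If `ℓ` has norm less than 1, the element `1 + ϖ` is not an `ℓ`-th power. If `ℓ` has norm 1, `ζ`
still has order `ℓ` in the residue field, so `ℓ` divides the least exponent `N` of the residue
units; if all units were `ℓ`-th powers, `N / ℓ` would also be an exponent. -/
theorem exists_unit_ne_pow (h : IsDiscreteFinite u) {ℓ : ℕ} (hℓ : ℓ.Prime) {ζ : F}
    (hζ : IsPrimitiveRoot ζ ℓ) : ∃ b : k, u b = 1 ∧ ∀ y : F, y ^ ℓ ≠ algebraMap k F b := by
  classical
  obtain ⟨ϖ, h0, h1, hϖ⟩ := h.exists_max_lt_one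
  have hna := isNonarchimedean_toAbsoluteValue F
  have hℓ1 : ‖(ℓ : F)‖ ≤ 1 := hna.apply_natCast_le_one (n := ℓ)
  have hle1 {y : F} (hy : ‖y‖ ^ ℓ = 1) : ‖y‖ = 1 :=
    (pow_eq_one_iff_of_nonneg (norm_nonneg _) hℓ.ne_zero).1 hy
  by_contra! hall
  rcases hℓ1.lt_or_eq with hlt | heq
  · have hb : u (1 + ϖ) = 1 := by
      have := IsNonarchimedean.add_eq_left_of_lt h.nonarch (x := 1) (y := ϖ) (by simpa using h1)
      rwa [map_one] at this
    obtain ⟨y, hy⟩ := hall _ hb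
    have hy1 : ‖y‖ = 1 := hle1 (by rw [← norm_pow, hy, hu, hb])
    let O := (NormedField.toAbsoluteValue F).valuationSubring hna
    have hz1 : ‖y - 1‖ ≤ 1 := by
      have := AbsoluteValue.sub_le_max hna y 1
      rw [map_one] at this
      exact this.trans (max_le hy1.le le_rfl)
    -- With `y = 1 + z` this gives `ϖ = z ^ ℓ + ℓ * z * r` with `r` integral. Then `z` is not a
    -- unit, and both terms on the right have norm at most `u ϖ ^ 2`.
    obtain ⟨r, hr⟩ := exists_add_pow_prime_eq hℓ (1 : O) ⟨y - 1, hz1⟩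
    set z : F := y - 1 with hz
    have hr' : algebraMap k F ϖ = z ^ ℓ + ℓ * z * r := by
      have := congrArg (fun x : O ↦ (x : F)) hr
      push_cast at this
      rw [one_pow, add_sub_cancel, hy, map_add, map_one, ← hz] at this
      linear_combination this
    have hrle : ‖(r : F)‖ ≤ 1 := r.2
    have hz2 : ‖z‖ < 1 := by
      have h3 : z ^ ℓ = algebraMap k F ϖ - ℓ * z * r := by rw [hr']; ring
      have h4 : ‖z‖ ^ ℓ < 1 := by
        rw [← norm_pow, h3]
        refine (AbsoluteValue.sub_le_max hna _ _).trans_lt (max_lt ?_ ?_)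
        · change ‖_‖ < 1
          rw [hu]; exact h1
        · change ‖_‖ < 1
          rw [norm_mul, norm_mul]
          calc _ ≤ ‖(ℓ : F)‖ * 1 * 1 := by gcongr
            _ < 1 := by simpa using hlt
      by_contra! hge
      exact absurd (one_le_pow₀ hge (n := ℓ)) h4.not_ge
    have h5 := norm_le_of_norm_lt_one hu hd hϖ hz2
    have h6 := norm_le_of_norm_lt_one hu hd hϖ hlt
    have h7 : u ϖ ≤ u ϖ ^ 2 := by
      conv_lhs => rw [← hu, hr']
      refine (IsUltrametricDist.norm_add_le_max _ _).trans (max_le ?_ ?_)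
      · rw [norm_pow]
        exact (pow_le_pow_left₀ (norm_nonneg _) h5 ℓ).trans
          (pow_le_pow_of_le_one h0.le h1.le hℓ.two_le)
      · rw [norm_mul, norm_mul]
        calc _ ≤ u ϖ * u ϖ * 1 := by gcongr
          _ = _ := by ring
    nlinarith
  · have hζ1 : ‖ζ‖ = 1 := hle1 (by rw [← norm_pow, hζ.pow_eq_one, norm_one])
    have hex := h.exists_pow_sub_one_lt
    obtain ⟨hN0, hN⟩ := Nat.find_spec hex
    set N := Nat.find hex with hNdef
    have hNF (y : F) (hy : ‖y‖ = 1) : ‖y ^ N - 1‖ < 1 := by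
      have hy0 : y ≠ 0 := by rw [← norm_ne_zero_iff, hy]; exact one_ne_zero
      obtain ⟨x, hx, hxy⟩ := exists_norm_sub_lt_of_denseRange hu hd hy0
      rw [hy] at hx hxy
      have h3 : ‖y ^ N - algebraMap k F x ^ N‖ < 1 := by
        obtain ⟨c, hc⟩ := sub_dvd_pow_sub_pow
          (⟨y, hy.le⟩ : (NormedField.toAbsoluteValue F).valuationSubring hna)
          ⟨algebraMap k F x, ((hu x).trans hx).le⟩ N
        have hc' := congrArg (fun x : (NormedField.toAbsoluteValue F).valuationSubring hna ↦ (x : F)) hc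
        push_cast at hc'
        rw [hc', norm_mul]
        have : ‖(c : F)‖ ≤ 1 := c.2
        calc _ ≤ ‖y - algebraMap k F x‖ * 1 := by gcongr
          _ < 1 := by simpa using hxy
      have h4 : ‖algebraMap k F x ^ N - 1‖ < 1 := by
        have := hN x hx
        rwa [← hu, map_sub, map_pow, map_one] at this
      rw [← sub_add_sub_cancel]
      exact (IsUltrametricDist.norm_add_le_max _ _).trans_lt (max_lt h3 h4)
    have hprim {i : ℕ} (h : ¬ ℓ ∣ i) : ¬ ‖ζ ^ i - 1‖ < 1 := by
      intro hlt
      have hζi : IsPrimitiveRoot (ζ ^ i) ℓ :=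
        hζ.pow_of_coprime i (((Nat.Prime.coprime_iff_not_dvd hℓ).2 h).symm)
      set ξ := ζ ^ i
      have hξ1 : ‖ξ‖ = 1 := by rw [norm_pow, hζ1, one_pow]
      have hsum := hζi.geom_sum_eq_zero hℓ.one_lt
      -- The powers of `ξ` sum to zero, so `ξ ≡ 1` would make `ℓ` a nonunit.
      have : (ℓ : F) = -∑ j ∈ Finset.range ℓ, (ξ ^ j - 1) := by
        rw [Finset.sum_sub_distrib, hsum]; simp
      rw [this, norm_neg] at heq
      have hle : ‖∑ j ∈ Finset.range ℓ, (ξ ^ j - 1)‖ ≤ ‖ξ - 1‖ := by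
        refine IsUltrametricDist.norm_sum_le_of_forall_le_of_nonneg (norm_nonneg _) fun j _ ↦ ?_
        rw [← geom_sum_mul ξ j, norm_mul]
        refine mul_le_of_le_one_left (norm_nonneg _) ?_
        refine IsUltrametricDist.norm_sum_le_of_forall_le_of_nonneg zero_le_one fun l _ ↦ ?_
        rw [norm_pow, hξ1, one_pow]
      linarith
    have hdvd : ℓ ∣ N := by
      by_contra hnd
      exact hprim hnd (hNF ζ hζ1)
    obtain ⟨M, hM⟩ := hdvd
    have hM0 : 0 < M := Nat.pos_of_ne_zero (by rintro rfl; simp at hM; lia)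
    refine Nat.find_min hex (m := M) ?_ ⟨hM0, fun x hx ↦ ?_⟩
    · rw [← hNdef, hM]; exact lt_mul_of_one_lt_left hM0 hℓ.one_lt
    · obtain ⟨y, hy⟩ := hall x hx
      have := hNF y (hle1 (by rw [← norm_pow, hy, hu, hx]))
      rwa [hM, pow_mul, hy, ← map_pow, ← map_one (algebraMap k F), ← map_sub, hu] at this

/-- If `F` lacks the `ℓ`-th roots of unity, an `ℓ`-th root of `ϖ` in `E` would already give one in
`F`, contradicting its value. If `F` has them, `ϖ` and a nonpower unit `b` cannot both become
powers, since they would be dependent modulo `ℓ`-th powers: either `b` or some `ϖ * b ^ i` would be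
a power in `F`. -/
theorem exists_ne_pow_of_isCyclic {E : Type*} [Field E] [Algebra F E] [Algebra k E]
    [IsScalarTower k F E] [FiniteDimensional F E] [IsGalois F E] [IsCyclic Gal(E/F)]
    (h : IsDiscreteFinite u) {ℓ : ℕ} (hℓ : ℓ.Prime) {ζ : E} (hζ : IsPrimitiveRoot ζ ℓ) :
    ∃ b : k, b ≠ 0 ∧ ∀ y : E, y ^ ℓ ≠ algebraMap k E b := by
  obtain ⟨ϖ, h0, h1, hϖ⟩ := h.exists_max_lt_one
  have hϖ0 : ϖ ≠ 0 := by rintro rfl; simp at h0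
  have hinj := (algebraMap k F).injective
  by_contra! hall
  have hne (y : F) : y ^ ℓ ≠ algebraMap k F ϖ := fun hy ↦
    norm_pow_ne_of_max hu hd h0 h1 hϖ hℓ.two_le y (by rw [← norm_pow, hy, hu])
  obtain ⟨z, hz⟩ := hall ϖ hϖ0
  rw [IsScalarTower.algebraMap_apply k F E] at hz
  by_cases hF : ζ ∈ (algebraMap F E).range
  · obtain ⟨ζ', rfl⟩ := hF
    have hζ' : IsPrimitiveRoot ζ' ℓ := hζ.of_map_of_injective (algebraMap F E).injective
    obtain ⟨b, hb1, hb⟩ := exists_unit_ne_pow hu hd h hℓ hζ'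
    have hb0 : b ≠ 0 := by rintro rfl; simp at hb1
    obtain ⟨y, hy⟩ := hall b hb0
    rw [IsScalarTower.algebraMap_apply k F E] at hy
    rcases exists_pow_mul_eq_pow_of_isCyclic hℓ hζ' ((map_ne_zero _).2 hb0) ((map_ne_zero _).2 hϖ0)
      hy hz with ⟨x, hx⟩ | ⟨i, x, hx⟩
    · exact hb x hx
    · refine norm_pow_ne_of_max hu hd h0 h1 hϖ hℓ.two_le x ?_
      rw [← norm_pow, hx, norm_mul, norm_pow, hu, hu, hb1, one_pow, mul_one]
  · obtain ⟨x, hx⟩ := exists_pow_eq_of_isCyclic hℓ hζ hF ((map_ne_zero _).2 hϖ0) hz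
    exact hne x hx

/-- The Artin–Schreier analogue of `exists_ne_pow_of_isCyclic`. -/
theorem exists_ne_pow_sub_self_of_isCyclic {E : Type*} [Field E] [Algebra F E] [Algebra k E]
    [IsScalarTower k F E] [FiniteDimensional F E] [IsGalois F E] [IsCyclic Gal(E/F)]
    (h : IsDiscreteFinite u) {p : ℕ} [hp : Fact p.Prime] [CharP k p] :
    ∃ b : k, ∀ y : E, y ^ p - y ≠ algebraMap k E b := by
  obtain ⟨ϖ, h0, h1, hϖ⟩ := h.exists_max_lt_one
  have hϖ0 : ϖ ≠ 0 := by rintro rfl; simp at h0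
  have : CharP E p := charP_of_injective_algebraMap (algebraMap k E).injective p
  have : CharP F p := charP_of_injective_algebraMap (algebraMap k F).injective p
  by_contra! hall
  obtain ⟨τ, hτ⟩ := IsCyclic.exists_generator (α := Gal(E/F))
  have hfix (x : E) (hx : τ x = x) : ∃ a : F, algebraMap F E a = x := by
    rw [← Set.mem_range, IsGalois.mem_range_algebraMap_iff_fixed]
    intro f
    have : f ∈ MulAction.stabilizer Gal(E/F) x := by
      refine (Subgroup.zpowers_le.2 ?_) (hτ f)
      exact hx
    exact this
  -- The pole orders `1 + p * i` are distinct and prime to `p`. Among `p + 1` of the roots `y i`,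
  -- two have the same `τ (y i) - y i` in the prime field, so their difference lies in `F`.
  choose y hy using fun i : ℕ ↦ hall (ϖ⁻¹ ^ (1 + p * i))
  have hroot (i : ℕ) : τ (y i) - y i ∈ (ZMod.castHom dvd_rfl E : ZMod p →+* E).range := by
    have h2 : (τ (y i) - y i) ^ p = τ (y i) - y i := by
      rw [sub_pow_char, sub_eq_sub_iff_sub_eq_sub, ← map_pow, ← map_sub, hy,
        IsScalarTower.algebraMap_apply k F E, τ.commutes]
    have h3 := (Subfield.mem_bot_iff_pow_eq_self E p).2 h2
    rw [← ZMod.fieldRange_castHom_eq_bot p] at h3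
    exact h3
  choose c hc using hroot
  have hcard : Fintype.card (ZMod p) < (Finset.range (p + 1)).card := by simp [ZMod.card]
  obtain ⟨i, hi, j, hj, hij, he⟩ := Finset.exists_ne_map_eq_of_card_lt_of_maps_to
    (t := Finset.univ) hcard (f := c) (fun i _ ↦ Finset.mem_univ _)
  wlog hlt : i < j generalizing i j
  · exact this j hj i hi hij.symm he.symm (hij.lt_or_gt.resolve_left hlt)
  have hfx : τ (y j - y i) = y j - y i := by
    rw [map_sub, ← sub_eq_zero, sub_sub_sub_comm, ← hc, ← hc, he, sub_self]
  obtain ⟨a, ha⟩ := hfix _ hfx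
  have hb : a ^ p - a = algebraMap k F (ϖ⁻¹ ^ (1 + p * j) - ϖ⁻¹ ^ (1 + p * i)) := by
    refine (algebraMap F E).injective ?_
    rw [map_sub, map_pow, ha, sub_pow_char, ← IsScalarTower.algebraMap_apply, map_sub, ← hy, ← hy]
    ring
  have hna := isNonarchimedean_toAbsoluteValue F
  have hgt1 : 1 < (u ϖ)⁻¹ := (one_lt_inv₀ h0).2 h1
  have hnb : ‖a ^ p - a‖ = (u ϖ)⁻¹ ^ (1 + p * j) := by
    rw [hb, hu, sub_eq_add_neg, IsNonarchimedean.add_eq_left_of_lt h.nonarch, map_pow, map_inv₀]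
    rw [AbsoluteValue.map_neg, map_pow, map_pow, map_inv₀]
    refine pow_lt_pow_right₀ hgt1 ?_
    have := Nat.mul_lt_mul_of_pos_left hlt hp.out.pos
    lia
  have hap : ‖a‖ ^ p = (u ϖ)⁻¹ ^ (1 + p * j) := by
    have ha1 : 1 < ‖a‖ := by
      by_contra! hle
      have h3 : ‖a ^ p - a‖ ≤ 1 := (AbsoluteValue.sub_le_max hna (a ^ p) a).trans (max_le (by
        change ‖a ^ p‖ ≤ 1
        rw [norm_pow]; exact pow_le_one₀ (norm_nonneg _) hle) hle)
      rw [hnb] at h3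
      exact absurd (one_lt_pow₀ hgt1 (by lia : 1 + p * j ≠ 0)) h3.not_gt
    rw [← hnb, sub_eq_add_neg, ← norm_pow]
    refine (IsNonarchimedean.add_eq_left_of_lt (f := NormedField.toAbsoluteValue F) hna ?_).symm
    change ‖-a‖ < ‖a ^ p‖
    rw [norm_neg, norm_pow]
    exact lt_self_pow₀ ha1 hp.out.one_lt
  -- The pole of `a ^ p - a` comes from `a ^ p`, so `‖a‖ ^ p` is the value of `ϖ⁻¹ ^ (1 + p * j)`;
  -- scaling `a` by `ϖ ^ j` leaves the exponent 1, which is not divisible by `p`.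
  refine norm_pow_ne_of_max hu hd h0 h1 hϖ hp.out.two_le (a * algebraMap k F ϖ ^ j)⁻¹ ?_
  rw [norm_inv, norm_mul, norm_pow, hu, inv_pow, mul_pow, hap, ← pow_mul, mul_comm j p, pow_add,
    pow_one, inv_pow]
  have := h0.ne'
  field_simp

end DenseUltrametric

end

/-! ### Completions of global fields, nonarchimedean and archimedean -/

section

open Filter Topology
open scoped TensorProduct

theorem RingHom.continuous_of_norm_eq_rpow {A B : Type*} [NormedRing A] [NormedRing B] (f : A →+* B)
    {c : ℝ} (hc : 0 < c) (h : ∀ x, ‖f x‖ = ‖x‖ ^ c) : Continuous f := by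
  refine continuous_of_continuousAt_zero f ?_
  rw [ContinuousAt, map_zero, tendsto_zero_iff_norm_tendsto_zero]
  simp only [h]
  have h1 : Tendsto (fun x : A ↦ ‖x‖) (𝓝 0) (𝓝 0) := by
    simpa using (continuous_norm (E := A)).tendsto 0
  have := h1.rpow_const (p := c) (Or.inr hc.le)
  rwa [Real.zero_rpow hc.ne'] at this

section CompletionLift

variable {K N : Type*} [Field K] [NormedField N] [CompleteSpace N] {v : AbsoluteValue K ℝ}

theorem AbsoluteValue.continuous_of_isEquiv {K N : Type*} [Field K] [NormedField N]
    {v : AbsoluteValue K ℝ} (f : K →+* N)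
    (h : v.IsEquiv ((NormedField.toAbsoluteValue N).comp f.injective)) :
    Continuous (f.comp (WithAbs.equiv v).toRingHom) := by
  obtain ⟨c, hc, hvc⟩ := AbsoluteValue.isEquiv_iff_exists_rpow_eq.1 h
  exact RingHom.continuous_of_norm_eq_rpow _ hc fun x ↦ (congrFun hvc x.ofAbs).symm

/-- The extension of an embedding in a complete field to the completion. -/
noncomputable def AbsoluteValue.completionLift (f : K →+* N)
    (h : v.IsEquiv ((NormedField.toAbsoluteValue N).comp f.injective)) : v.Completion →+* N :=
  UniformSpace.Completion.extensionHom _ (AbsoluteValue.continuous_of_isEquiv f h)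

theorem AbsoluteValue.completionLift_algebraMap (f : K →+* N)
    (h : v.IsEquiv ((NormedField.toAbsoluteValue N).comp f.injective)) (x : K) :
    AbsoluteValue.completionLift f h (algebraMap K v.Completion x) = f x :=
  UniformSpace.Completion.extensionHom_coe _ (AbsoluteValue.continuous_of_isEquiv f h)
    (WithAbs.toAbs v x)

end CompletionLift

section CompletionEmbedding

variable {k K : Type*} [Field k] [Field K] [Algebra k K] (u : AbsoluteValue k ℝ)
  (v : AbsoluteValue K ℝ) (h : v.LiesOver u)

theorem completionEmbedding_algebraMap (x : k) :
    completionEmbedding u v h (algebraMap k u.Completion x) = algebraMap k v.Completion x :=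
  Isometry.mapRingHom_coe _ _

theorem isScalarTower_completionEmbedding :
    letI := (completionEmbedding u v h).toAlgebra
    IsScalarTower k u.Completion v.Completion :=
  letI := (completionEmbedding u v h).toAlgebra
  IsScalarTower.of_algebraMap_eq fun x ↦ (completionEmbedding_algebraMap u v h x).symm

theorem compositumMap_completion_surjective [FiniteDimensional k K] (hu : u.IsNontrivial) :
    letI := (completionEmbedding u v h).toAlgebra
    haveI := isScalarTower_completionEmbedding u v h
    Function.Surjective (compositumMap k K u.Completion v.Completion) := by
  let _ := (completionEmbedding u v h).toAlgebra
  have := isScalarTower_completionEmbedding u v h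
  let _ := AbsoluteValue.nontriviallyNormedFieldCompletion hu
  refine compositumMap_surjective_of_denseRange (𝕜 := u.Completion) ?_
    v.denseRange_algebraMap_completion
  exact (isometry_algebraMap_withAbs u v h).isometry_mapRingHom.continuous

theorem AbsoluteValue.liesOver_comp {k K : Type*} [Field k] [Field K] [Algebra k K]
    (v : AbsoluteValue K ℝ) : v.LiesOver (v.comp (algebraMap k K).injective) := ⟨rfl⟩

/-- There is an element of `k` that is not an `ℓ`-th power in the completion of a cyclic extension
of `k`. -/
theorem IsGlobalField.exists_ne_pow_completion (hk : IsGlobalField k) [FiniteDimensional k K]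
    [IsGalois k K] [IsCyclic Gal(K/k)] {v : AbsoluteValue K ℝ} (hv : IsNonarchimedean v)
    (hn : v.IsNontrivial) {ℓ : ℕ} (hℓ : ℓ.Prime) {ζ : K} (hζ : IsPrimitiveRoot ζ ℓ) :
    ∃ b : k, b ≠ 0 ∧ ∀ y : v.Completion, y ^ ℓ ≠ algebraMap k v.Completion b := by
  let u := v.comp (algebraMap k K).injective
  have h : v.LiesOver u := v.liesOver_comp
  have hu := AbsoluteValue.isNontrivial_comp_of_finiteDimensional (F := k) hn
  have hna := (AbsoluteValue.isNonarchimedean_comp_iff (F := k) v).2 hv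
  let _ := (completionEmbedding u v h).toAlgebra
  have := isScalarTower_completionEmbedding u v h
  have hs := compositumMap_completion_surjective u v h hu
  have := finiteDimensional_of_compositumMap_surjective hs
  have := isGalois_of_compositumMap_surjective hs
  have := isCyclic_of_compositumMap_surjective hs
  have := AbsoluteValue.isUltrametricDist_completion hna
  exact exists_ne_pow_of_isCyclic (F := u.Completion) u.norm_algebraMap_completion
    u.denseRange_algebraMap_completion (hk.isDiscreteFinite hna hu) hℓ
    (hζ.map_of_injective (algebraMap K v.Completion).injective)

theorem IsGlobalField.exists_ne_pow_sub_self_completion (hk : IsGlobalField k)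
    [FiniteDimensional k K] [IsGalois k K] [IsCyclic Gal(K/k)] {v : AbsoluteValue K ℝ}
    (hn : v.IsNontrivial) (p : ℕ) [Fact p.Prime] [CharP k p] :
    ∃ b : k, ∀ y : v.Completion, y ^ p - y ≠ algebraMap k v.Completion b := by
  let u := v.comp (algebraMap k K).injective
  have h : v.LiesOver u := v.liesOver_comp
  have hu := AbsoluteValue.isNontrivial_comp_of_finiteDimensional (F := k) hn
  have hna : IsNonarchimedean u := u.isNonarchimedean_of_charP p
  let _ := (completionEmbedding u v h).toAlgebra
  have := isScalarTower_completionEmbedding u v h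
  have hs := compositumMap_completion_surjective u v h hu
  have := finiteDimensional_of_compositumMap_surjective hs
  have := isGalois_of_compositumMap_surjective hs
  have := isCyclic_of_compositumMap_surjective hs
  have := AbsoluteValue.isUltrametricDist_completion hna
  exact exists_ne_pow_sub_self_of_isCyclic (F := u.Completion) u.norm_algebraMap_completion
    u.denseRange_algebraMap_completion (hk.isDiscreteFinite hna hu)

end CompletionEmbedding

section Archimedean

variable {K : Type*} [Field K] {v : AbsoluteValue K ℝ}

theorem IsRealArchimedean.exists_ringHom (h : IsRealArchimedean v) :
    Nonempty (v.Completion →+* ℝ) := by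
  obtain ⟨σ, hσ⟩ := h
  exact ⟨AbsoluteValue.completionLift σ hσ⟩

theorem IsRealArchimedean.not_isNonarchimedean (h : IsRealArchimedean v) :
    ¬ IsNonarchimedean v := by
  obtain ⟨σ, hσ⟩ := h
  intro hna
  have h1 : v 2 ≤ 1 := by exact_mod_cast hna.apply_natCast_le_one (n := 2)
  have h2 := hσ.le_one_iff.1 h1
  change |σ 2| ≤ 1 at h2
  rw [map_ofNat] at h2
  norm_num at h2

/-- By Ostrowski `v` restricts on `ℚ` to a power of the usual absolute value, so `ℝ` embeds in the
completion, which is then finite over `ℝ`. It is therefore `ℝ` or `ℂ`, and `ℝ` would make `v` real.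
-/
theorem isAlgClosed_completion_of_not_isRealArchimedean (hK : IsGlobalField K)
    (hv : ¬ IsNonarchimedean v) (hr : ¬ IsRealArchimedean v) : IsAlgClosed v.Completion := by
  rcases hK with hK | ⟨p, hp, _, hK⟩
  · let u := v.comp (algebraMap ℚ K).injective
    have hub : ¬ ∀ n : ℕ, u n ≤ 1 := fun h ↦ hv <| (AbsoluteValue.isNonarchimedean_comp_iff v).1 <|
      AbsoluteValue.isNonarchimedean_of_natCast_le_one h
    obtain ⟨c, hc, huc⟩ := AbsoluteValue.isEquiv_iff_exists_rpow_eq.1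
      (Rat.AbsoluteValue.equiv_real_of_unbounded hub).symm
    have hcont : Continuous (algebraMap ℚ v.Completion) :=
      RingHom.continuous_of_norm_eq_rpow _ hc fun x ↦ by
        rw [IsScalarTower.algebraMap_apply ℚ K v.Completion, v.norm_algebraMap_completion]
        exact (congrFun huc x).symm
    have hunif : UniformContinuous (algebraMap ℚ v.Completion) :=
      uniformContinuous_addMonoidHom_of_continuous hcont
    have hi : IsUniformInducing (Rat.castHom ℝ) := Rat.isUniformEmbedding_coe_real.isUniformInducing
    have hd : DenseRange (Rat.castHom ℝ) := Rat.denseRange_cast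
    let g : ℝ →+* v.Completion := IsDenseInducing.extendRingHom hi hd hunif
    have hg : Continuous g := (uniformContinuous_uniformly_extend hi hd hunif).continuous
    let _ := g.toAlgebra
    have : IsScalarTower ℚ ℝ v.Completion := IsScalarTower.of_algebraMap_eq fun x ↦
      (IsDenseInducing.extend_eq (hi.isDenseInducing hd) hcont x).symm
    have hs := compositumMap_surjective_of_denseRange (k := ℚ) (K := K) (𝕜 := ℝ) hg
      v.denseRange_algebraMap_completion
    have := finiteDimensional_of_compositumMap_surjective hs
    rcases Real.nonempty_algEquiv_or v.Completion with ⟨⟨e⟩⟩ | ⟨⟨e⟩⟩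
    · refine absurd ⟨(e : v.Completion →+* ℝ).comp (algebraMap K v.Completion), ?_⟩ hr
      have : ContinuousSMul ℝ v.Completion := ⟨by
        simp only [Algebra.smul_def]
        exact (hg.comp continuous_fst).mul continuous_snd⟩
      have he : Continuous e := LinearMap.continuous_of_finiteDimensional e.toLinearMap
      have he' : Continuous e.symm := LinearMap.continuous_of_finiteDimensional e.symm.toLinearMap
      -- Value less than 1 means that the powers tend to zero, a property preserved by the
      -- homeomorphism `e`.
      refine AbsoluteValue.isEquiv_iff_lt_one_iff.2 fun x ↦ ?_
      change v x < 1 ↔ ‖e (algebraMap K v.Completion x)‖ < 1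
      rw [← v.norm_algebraMap_completion, ← tendsto_pow_atTop_nhds_zero_iff_norm_lt_one,
        ← tendsto_pow_atTop_nhds_zero_iff_norm_lt_one]
      refine ⟨fun h ↦ ?_, fun h ↦ ?_⟩
      · simpa [Function.comp_def] using (he.tendsto 0).comp h
      · simpa [Function.comp_def] using (he'.tendsto 0).comp h
    · refine IsAlgClosed.of_exists_root _ fun p _ hp ↦ ?_
      obtain ⟨z, hz⟩ := IsAlgClosed.exists_root (p.map (e : v.Completion →+* ℂ))
        (by rw [Polynomial.degree_map]; exact hp.degree_pos.ne')
      obtain ⟨w, rfl⟩ := e.surjective z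
      refine ⟨w, (map_eq_zero (e : v.Completion →+* ℂ)).1 ?_⟩
      rw [← Polynomial.eval₂_at_apply, ← Polynomial.eval_map]
      exact hz
  · have : CharP K p := charP_of_injective_algebraMap
      (algebraMap (RatFunc (ZMod p)) K).injective p
    exact absurd (v.isNonarchimedean_of_charP p) hv

/-- At a real place, `-1` is not a square, and there are no other roots of unity of prime order. -/
theorem IsRealArchimedean.exists_ne_pow_completion {k : Type*} [Field k] [Algebra k K]
    (h : IsRealArchimedean v) {ℓ : ℕ} (hℓ : ℓ.Prime) {ζ : K} (hζ : IsPrimitiveRoot ζ ℓ) :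
    ∃ b : k, b ≠ 0 ∧ ∀ y : v.Completion, y ^ ℓ ≠ algebraMap k v.Completion b := by
  obtain ⟨ψ⟩ := h.exists_ringHom
  refine ⟨-1, neg_ne_zero.2 one_ne_zero, fun y hy ↦ ?_⟩
  rcases hℓ.eq_two_or_odd' with rfl | hodd
  · have := congrArg ψ hy
    rw [map_pow, map_neg, map_neg, map_one, map_one] at this
    nlinarith [sq_nonneg (ψ y)]
  · have h1 : IsPrimitiveRoot (ψ (algebraMap K v.Completion ζ)) ℓ :=
      (hζ.map_of_injective (algebraMap K v.Completion).injective).map_of_injective ψ.injective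
    have h2 := (Odd.strictMono_pow hodd).injective (by simpa using h1.pow_eq_one : _ ^ ℓ = (1 : ℝ) ^ ℓ)
    rw [h2] at h1
    exact hℓ.one_lt.ne' (h1.unique IsPrimitiveRoot.one)

end Archimedean

end

/-! ### Weak approximation and the choice of the free parameter -/

section

open Filter Topology

namespace AbsoluteValue

theorem IsNontrivial.exists_lt {F : Type*} [Field F] {v : AbsoluteValue F ℝ} (hv : v.IsNontrivial)
    (C : ℝ) : ∃ x, C < v x := by
  obtain ⟨x, hx⟩ := hv.exists_abv_gt_one
  obtain ⟨n, hn⟩ := pow_unbounded_of_one_lt C hx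
  exact ⟨x ^ n, by rwa [map_pow]⟩

theorem exists_forall_lt_one_and_forall_one_lt {F : Type*} [Field F]
    {A B : Set (AbsoluteValue F ℝ)} (hA : A.Finite) (hB : B.Finite)
    (hAn : ∀ v ∈ A, v.IsNontrivial) (hBn : ∀ v ∈ B, v.IsNontrivial)
    (hAB : ∀ v ∈ A, ∀ w ∈ B, ¬ v.IsEquiv w) :
    ∃ x : F, (∀ v ∈ A, v x < 1) ∧ ∀ w ∈ B, 1 < w x := by
  classical
  -- `A` and `B` may each contain equivalent absolute values, so the approximation runs over
  -- equivalence classes: close to 0 on those of `A`, close to an element of value greater than 2 on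
  -- the others.
  let Q : Set (Quotient (inferInstance : Setoid (AbsoluteValue F ℝ))) := (fun v ↦ ⟦v⟧) '' (A ∪ B)
  have : Finite Q := ((hA.union hB).image _).to_subtype
  let r (q : Q) : AbsoluteValue F ℝ := q.1.out
  have hr (v : AbsoluteValue F ℝ) (q : Q) (hq : q.1 = ⟦v⟧) : (r q).IsEquiv v :=
    Quotient.exact ((Quotient.out_eq q.1).trans hq)
  have hrn (q : Q) : (r q).IsNontrivial := by
    obtain ⟨v, hv, hq⟩ := q.2
    refine (hr v q hq.symm).isNontrivial_congr.2 ?_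
    rcases hv with hv | hv
    exacts [hAn v hv, hBn v hv]
  have hrp : Pairwise fun i j ↦ ¬ (r i).IsEquiv (r j) := fun i j hij h ↦
    hij (Subtype.ext (Quotient.out_equiv_out.1 h))
  have hc (q : Q) : ∃ c : F, (q.1 ∈ (fun v ↦ ⟦v⟧) '' A → c = 0) ∧
      (q.1 ∉ (fun v ↦ ⟦v⟧) '' A → 2 < r q c) := by
    by_cases h : q.1 ∈ (fun v ↦ ⟦v⟧) '' A
    · exact ⟨0, fun _ ↦ rfl, fun h' ↦ absurd h h'⟩
    · obtain ⟨c, hc⟩ := (hrn q).exists_lt 2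
      exact ⟨c, fun h' ↦ absurd h' h, fun _ ↦ hc⟩
  choose c hc0 hc2 using hc
  obtain ⟨x, hx⟩ := (denseRange_algebraMap_pi hrn hrp).mem_nhds
    (set_pi_mem_nhds (Set.finite_univ (α := Q)) fun q _ ↦
      Metric.ball_mem_nhds (WithAbs.toAbs (r q) (c q)) one_pos)
  have hx' (q : Q) : r q (x - c q) < 1 := by
    have := hx q trivial
    rwa [Metric.mem_ball, dist_eq_norm] at this
  refine ⟨x, fun v hv ↦ ?_, fun w hw ↦ ?_⟩
  · let q : Q := ⟨⟦v⟧, v, Or.inl hv, rfl⟩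
    have := hx' q
    rw [hc0 q ⟨v, hv, rfl⟩, sub_zero] at this
    exact (hr v q rfl).lt_one_iff.1 this
  · let q : Q := ⟨⟦w⟧, w, Or.inr hw, rfl⟩
    refine (hr w q rfl).one_lt_iff.1 ?_
    have h1 := hc2 q (by
      rintro ⟨v, hv, h⟩
      exact hAB v hv w hw (Quotient.exact h))
    have h2 := (r q).add_le (c q - x) x
    rw [sub_add_cancel, (r q).map_sub] at h2
    linarith [hx' q]

variable {k K : Type*} [Field k] [Field K] [Algebra k K]

/-- Transitivity of the Galois group on the places above one of `k`. Otherwise some `x` is small at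
all conjugates of `v` and large at all conjugates of `v'`, and its norm to `k` is both small and
large at the same place. -/
theorem exists_isEquiv_comp_algEquiv [FiniteDimensional k K] [IsGalois k K]
    {v v' : AbsoluteValue K ℝ} (hv : v.IsNontrivial) (hv' : v'.IsNontrivial)
    (h : (v'.comp (algebraMap k K).injective).IsEquiv (v.comp (algebraMap k K).injective)) :
    ∃ σ : Gal(K/k), v'.IsEquiv (v.comp (f := (σ : K →+* K)) σ.injective) := by
  classical
  by_contra! hne
  let c (v : AbsoluteValue K ℝ) (σ : Gal(K/k)) : AbsoluteValue K ℝ :=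
    v.comp (f := (σ : K →+* K)) σ.injective
  have hcn {v : AbsoluteValue K ℝ} (hv : v.IsNontrivial) (σ : Gal(K/k)) : (c v σ).IsNontrivial := by
    obtain ⟨x, hx0, hx1⟩ := hv
    refine ⟨σ.symm x, by simpa using hx0, ?_⟩
    change v (σ (σ.symm x)) ≠ 1
    rwa [σ.apply_symm_apply]
  obtain ⟨x, hx1, hx2⟩ := exists_forall_lt_one_and_forall_one_lt
    (Set.finite_range (c v)) (Set.finite_range (c v'))
    (by rintro _ ⟨σ, rfl⟩; exact hcn hv σ) (by rintro _ ⟨σ, rfl⟩; exact hcn hv' σ) (by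
      rintro _ ⟨σ, rfl⟩ _ ⟨τ, rfl⟩ he
      refine hne (τ⁻¹.trans σ) fun x y ↦ ?_
      have := (he (τ.symm x) (τ.symm y)).symm
      change v' (τ (τ.symm x)) ≤ v' (τ (τ.symm y)) ↔ _ at this
      rw [τ.apply_symm_apply, τ.apply_symm_apply] at this
      exact this)
  have hx0 : x ≠ 0 := by
    rintro rfl
    have := hx2 _ ⟨1, rfl⟩
    rw [map_zero] at this
    exact absurd this (by norm_num)
  have hN (w : AbsoluteValue K ℝ) :
      w (algebraMap k K (Algebra.norm k x)) = ∏ σ : Gal(K/k), c w σ x := by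
    rw [Algebra.norm_eq_prod_automorphisms, map_prod]
    rfl
  have h1 : v (algebraMap k K (Algebra.norm k x)) < 1 := by
    rw [hN]
    have := Finset.prod_lt_prod_of_nonempty (s := Finset.univ) (f := fun σ ↦ c v σ x)
      (g := fun _ ↦ 1) (fun σ _ ↦ (c v σ).pos hx0) (fun σ _ ↦ hx1 _ ⟨σ, rfl⟩) Finset.univ_nonempty
    rwa [Finset.prod_const_one] at this
  have h2 : 1 < v' (algebraMap k K (Algebra.norm k x)) := by
    rw [hN]
    have := Finset.prod_lt_prod_of_nonempty (s := Finset.univ) (f := fun _ ↦ 1)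
      (g := fun σ ↦ c v' σ x) (fun _ _ ↦ one_pos) (fun σ _ ↦ hx2 _ ⟨σ, rfl⟩) Finset.univ_nonempty
    rwa [Finset.prod_const_one] at this
  exact h1.not_gt (h.one_lt_iff.1 h2)

/-- A local-global principle: elements with prescribed local behaviour. -/
theorem exists_forall_of_exists_local [FiniteDimensional k K] [IsGalois k K]
    (P : AbsoluteValue K ℝ → k → Prop) (G : AbsoluteValue K ℝ → Prop)
    (hloc : ∀ v, G v → v.IsNontrivial → ∃ b, P v b)
    (hopen : ∀ v : AbsoluteValue K ℝ, v.IsNontrivial → ∀ b, P v b →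
      ∃ U ∈ 𝓝 (algebraMap k v.Completion b), ∀ b', algebraMap k v.Completion b' ∈ U → P v b')
    (hconj : ∀ (v v' : AbsoluteValue K ℝ) (σ : Gal(K/k)),
      v'.IsEquiv (v.comp (f := (σ : K →+* K)) σ.injective) → ∀ b, P v b → P v' b)
    {T : Set (AbsoluteValue k ℝ)} (hT : IsFinitePlaceSet T) :
    ∃ b : k, ∀ v, G v → (∃ u ∈ T, (v.comp (algebraMap k K).injective).IsEquiv u) → P v b := by
  classical
  have hnt {v : AbsoluteValue K ℝ} {u : AbsoluteValue k ℝ} (hu : u ∈ T)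
      (h : (v.comp (algebraMap k K).injective).IsEquiv u) : v.IsNontrivial := by
    obtain ⟨x, hx0, hx1⟩ := h.isNontrivial_congr.2 (hT.nontrivial u hu)
    exact ⟨algebraMap k K x, by simpa using hx0, hx1⟩
  let T' : Set (AbsoluteValue k ℝ) :=
    {u ∈ T | ∃ v, G v ∧ (v.comp (algebraMap k K).injective).IsEquiv u}
  have : Finite T' := (hT.finite.subset fun u hu ↦ hu.1).to_subtype
  -- One place above each `u` is enough; `hconj` carries `P` to the conjugate places, which are all
  -- the others.
  choose w hwG hw using fun u : T' ↦ u.2.2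
  choose b hb using fun u : T' ↦ hloc (w u) (hwG u) (hnt u.2.1 (hw u))
  choose U hU hUP using fun u : T' ↦ hopen (w u) (hnt u.2.1 (hw u)) (b u) (hb u)
  have hcont (u : T') : Continuous
      ((algebraMap k (w u).Completion).comp (WithAbs.equiv u.1).toRingHom) := by
    refine continuous_of_isEquiv _ ((hw u).symm.trans fun x y ↦ ?_)
    change _ ↔ ‖algebraMap k (w u).Completion x‖ ≤ ‖algebraMap k (w u).Completion y‖
    rw [IsScalarTower.algebraMap_apply k K, IsScalarTower.algebraMap_apply k K (w u).Completion y,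
      norm_algebraMap_completion, norm_algebraMap_completion]
    rfl
  obtain ⟨x, hx⟩ := (denseRange_algebraMap_pi (v := fun u : T' ↦ u.1)
    (fun u ↦ hT.nontrivial _ u.2.1)
    (fun i j hij ↦ hT.inequivalent i.2.1 j.2.1 (Subtype.coe_injective.ne hij))).mem_nhds
    (set_pi_mem_nhds (Set.finite_univ (α := T')) fun u _ ↦
      (hcont u).continuousAt.preimage_mem_nhds (x := WithAbs.toAbs u.1 (b u)) (hU u))
  refine ⟨x, fun v hvG ⟨u, hu, hvu⟩ ↦ ?_⟩
  let u' : T' := ⟨u, hu, v, hvG, hvu⟩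
  obtain ⟨σ, hσ⟩ := exists_isEquiv_comp_algEquiv (hnt hu (hw u')) (hnt hu hvu)
    (hvu.trans (hw u').symm)
  exact hconj _ _ σ hσ x (hUP u' x (hx u' trivial))

/-- The homomorphism of completions induced by an automorphism. -/
theorem exists_ringHom_completion {v v' : AbsoluteValue K ℝ} (σ : Gal(K/k))
    (h : v'.IsEquiv (v.comp (f := (σ : K →+* K)) σ.injective)) :
    ∃ f : v'.Completion →+* v.Completion,
      ∀ x : K, f (algebraMap K v'.Completion x) = algebraMap K v.Completion (σ x) := by
  refine ⟨completionLift ((algebraMap K v.Completion).comp (σ : K →+* K)) (h.trans fun x y ↦ ?_),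
    fun x ↦ completionLift_algebraMap _ _ _⟩
  change _ ↔ ‖algebraMap K v.Completion (σ x)‖ ≤ ‖algebraMap K v.Completion (σ y)‖
  rw [norm_algebraMap_completion, norm_algebraMap_completion]
  rfl

end AbsoluteValue

/-- By the inverse function theorem, as the derivative of the power map at 1 is `m ≠ 0`. Small
changes of `b` thus alter it only by an `m`-th power. -/
theorem setOf_pow_mem_nhds_one {E : Type*} [NontriviallyNormedField E] [CompleteSpace E] {m : ℕ}
    (hm : (m : E) ≠ 0) : {z : E | ∃ y, y ^ m = z} ∈ 𝓝 (1 : E) := by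
  have h : HasStrictDerivAt (fun y : E ↦ y ^ m) ((m : E) * 1 ^ (m - 1)) 1 := hasStrictDerivAt_pow m 1
  have := h.map_nhds_eq (by simpa using hm)
  rw [one_pow] at this
  rw [← this]
  exact Filter.mem_map.2 (Filter.Eventually.of_forall fun y ↦ ⟨y, rfl⟩)

theorem setOf_pow_sub_self_mem_nhds_zero {E : Type*} [NontriviallyNormedField E] [CompleteSpace E]
    (p : ℕ) [hp : Fact p.Prime] [CharP E p] : {z : E | ∃ y, y ^ p - y = z} ∈ 𝓝 (0 : E) := by
  have h : HasStrictDerivAt (fun y : E ↦ y ^ p - y) ((p : E) * 0 ^ (p - 1) - 1) 0 :=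
    (hasStrictDerivAt_pow p 0).sub (hasStrictDerivAt_id 0)
  have := h.map_nhds_eq (by simp)
  rw [zero_pow hp.out.ne_zero, sub_zero] at this
  rw [← this]
  exact Filter.mem_map.2 (Filter.Eventually.of_forall fun y ↦ ⟨y, rfl⟩)

section Elements

variable {k K : Type*} [Field k] [Field K] [Algebra k K]

/-- The element `a` is not an `ℓ`-th power in the completion at `v`, for all primes `ℓ ∣ m`. -/
def IsNonpowerAt (m : ℕ) (v : AbsoluteValue K ℝ) (a : K) : Prop :=
  ∀ ℓ : ℕ, ℓ.Prime → ℓ ∣ m → ∀ y : v.Completion, y ^ ℓ ≠ algebraMap K v.Completion a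

/-- Nonpowers for single primes are combined one prime at a time. If `a * b` happens to be a `q`-th
power, it is multiplied by a non-`q`-th power raised to an exponent invisible to the earlier primes.
-/
theorem exists_forall_mul_ne_pow {E : Type*} [Field E] [Algebra k E] (a : E) (P : Finset ℕ)
    (hP : ∀ ℓ ∈ P, ℓ.Prime)
    (h : ∀ ℓ ∈ P, ∃ b : k, b ≠ 0 ∧ ∀ y : E, y ^ ℓ ≠ algebraMap k E b) (ha : a ≠ 0) :
    ∃ b : k, b ≠ 0 ∧ ∀ ℓ ∈ P, ∀ y : E, y ^ ℓ ≠ a * algebraMap k E b := by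
  classical
  induction P using Finset.induction_on with
  | empty => exact ⟨1, one_ne_zero, by simp⟩
  | insert q P hq ih =>
    obtain ⟨b, hb0, hb⟩ := ih (fun ℓ hℓ ↦ hP ℓ (Finset.mem_insert_of_mem hℓ))
      (fun ℓ hℓ ↦ h ℓ (Finset.mem_insert_of_mem hℓ))
    by_cases hqb : ∀ y : E, y ^ q ≠ a * algebraMap k E b
    · refine ⟨b, hb0, fun ℓ hℓ ↦ ?_⟩
      rcases Finset.mem_insert.1 hℓ with rfl | hℓ
      exacts [hqb, hb ℓ hℓ]
    push Not at hqb
    obtain ⟨z, hz⟩ := hqb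
    have hqp := hP q (Finset.mem_insert_self q P)
    obtain ⟨d, hd0, hd⟩ := h q (Finset.mem_insert_self q P)
    have hcop : Nat.Coprime q (∏ ℓ ∈ P, ℓ) := Nat.Coprime.prod_right fun ℓ hℓ ↦
      (Nat.coprime_primes hqp (hP ℓ (Finset.mem_insert_of_mem hℓ))).2 (by rintro rfl; exact hq hℓ)
    -- `c ≡ 1` modulo `q` keeps `d ^ c` a nonpower for `q`; `c ≡ 0` modulo each `ℓ` in `P` makes it
    -- an `ℓ`-th power.
    obtain ⟨c, hc1, hc0⟩ := Nat.chineseRemainder hcop 1 0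
    have hd0' : algebraMap k E d ≠ 0 := by simpa using hd0
    refine ⟨b * d ^ c, mul_ne_zero hb0 (pow_ne_zero _ hd0), fun ℓ hℓ y hy ↦ ?_⟩
    rw [map_mul, map_pow, ← mul_assoc] at hy
    rcases Finset.mem_insert.1 hℓ with rfl | hℓ
    · have hc : 1 ≤ c := by
        by_contra! hlt
        have : c = 0 := by lia
        rw [this] at hc1
        exact hqp.one_lt.ne' (Nat.dvd_one.1 ((Nat.modEq_iff_dvd' zero_le_one).1 hc1))
      obtain ⟨s, hs⟩ := (Nat.modEq_iff_dvd' hc).1 hc1.symm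
      have hc' : c = 1 + ℓ * s := by lia
      have hz0 : z ≠ 0 := by
        rintro rfl
        rw [zero_pow hqp.ne_zero, eq_comm, mul_eq_zero] at hz
        simp [ha, hb0] at hz
      refine hd (y / (z * algebraMap k E d ^ s)) ?_
      rw [div_pow, hy, mul_pow, hz, hc', pow_add, pow_one, ← pow_mul, mul_comm s ℓ, ← hz]
      field_simp
    · have : ℓ ∣ c := (Finset.dvd_prod_of_mem (fun ℓ ↦ ℓ) hℓ).trans (Nat.modEq_zero_iff_dvd.1 hc0)
      obtain ⟨s, rfl⟩ := this
      refine hb ℓ hℓ (y / algebraMap k E d ^ s) ?_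
      rw [div_pow, hy, ← pow_mul, mul_comm s ℓ]
      field_simp

/-- The hypothesis `ha` makes the local condition on `a * b` the same at conjugate places, because
`σ (a * b)` and `a * b` differ by an `m`-th power. -/
theorem IsGlobalField.exists_forall_isNonpowerAt (hk : IsGlobalField k) [FiniteDimensional k K]
    [IsGalois k K] [IsCyclic Gal(K/k)] {m : ℕ} (hm : (m : k) ≠ 0) {ζ : K}
    (hζ : IsPrimitiveRoot ζ m) {a : K} (ha0 : a ≠ 0)
    (ha : ∀ σ : Gal(K/k), ∃ x : K, σ a = x ^ m * a)
    {T : Set (AbsoluteValue k ℝ)} (hT : IsFinitePlaceSet T) :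
    ∃ b : k, ∀ v : AbsoluteValue K ℝ, (IsNonarchimedean v ∨ IsRealArchimedean v) →
      (∃ u ∈ T, (v.comp (algebraMap k K).injective).IsEquiv u) →
      b ≠ 0 ∧ IsNonpowerAt m v (a * algebraMap k K b) := by
  have hm0 : m ≠ 0 := by rintro rfl; simp at hm
  refine AbsoluteValue.exists_forall_of_exists_local
    (fun v b ↦ b ≠ 0 ∧ IsNonpowerAt m v (a * algebraMap k K b)) _ ?_ ?_ ?_ hT
  · intro v hG hn
    have hloc (ℓ : ℕ) (hℓ : ℓ ∈ m.primeFactors) :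
        ∃ b : k, b ≠ 0 ∧ ∀ y : v.Completion, y ^ ℓ ≠ algebraMap k v.Completion b := by
      have hℓp := Nat.prime_of_mem_primeFactors hℓ
      obtain ⟨q, hq⟩ := Nat.dvd_of_mem_primeFactors hℓ
      have hζℓ : IsPrimitiveRoot (ζ ^ q) ℓ := hζ.pow (Nat.pos_of_ne_zero hm0) (by rw [hq, mul_comm])
      rcases hG with hv | hv
      · exact hk.exists_ne_pow_completion hv hn hℓp hζℓ
      · exact hv.exists_ne_pow_completion hℓp hζℓ
    obtain ⟨b, hb0, hb⟩ := exists_forall_mul_ne_pow (k := k) (algebraMap K v.Completion a)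
      m.primeFactors (fun ℓ hℓ ↦ Nat.prime_of_mem_primeFactors hℓ) hloc (by simpa using ha0)
    refine ⟨b, hb0, fun ℓ hℓ hℓm y ↦ ?_⟩
    rw [map_mul, ← IsScalarTower.algebraMap_apply]
    exact hb ℓ (Nat.mem_primeFactors.2 ⟨hℓ, hℓm, hm0⟩) y
  · rintro v hn b ⟨hb0, hb⟩
    let _ := AbsoluteValue.nontriviallyNormedFieldCompletion hn
    have hmE : (m : v.Completion) ≠ 0 := by
      rw [← map_natCast (algebraMap k v.Completion)]; exact (map_ne_zero _).2 hm
    have hbE : algebraMap k v.Completion b ≠ 0 := by simpa using hb0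
    refine ⟨_, Filter.inter_mem (isOpen_ne.mem_nhds hbE)
      ((continuous_id.div_const (algebraMap k v.Completion b)).continuousAt.preimage_mem_nhds
      (show _ ∈ 𝓝 (algebraMap k v.Completion b / algebraMap k v.Completion b) by
        rw [div_self hbE]; exact setOf_pow_mem_nhds_one hmE)), fun b' hb' ↦ ⟨?_, ?_⟩⟩
    · rintro rfl
      exact hb'.1 (map_zero _)
    · obtain ⟨h0, z, hz⟩ := hb'
      intro ℓ hℓ hℓm y hy
      obtain ⟨q, rfl⟩ := hℓm
      simp only [id] at hz
      have hz' : algebraMap k v.Completion b' = z ^ (ℓ * q) * algebraMap k v.Completion b := by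
        rw [hz, div_mul_cancel₀ _ hbE]
      have hz0 : z ≠ 0 := by
        rintro rfl
        rw [zero_pow hm0, zero_mul] at hz'
        exact h0 hz'
      refine hb ℓ hℓ (Dvd.intro q rfl) (y / z ^ q) ?_
      rw [map_mul, ← IsScalarTower.algebraMap_apply] at hy ⊢
      rw [div_pow, hy, hz', ← pow_mul, mul_comm q]
      field_simp
  · rintro v v' σ hσ b ⟨hb0, hb⟩
    refine ⟨hb0, fun ℓ hℓ hℓm y hy ↦ ?_⟩
    obtain ⟨f, hf⟩ := AbsoluteValue.exists_ringHom_completion σ hσ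
    obtain ⟨x, hx⟩ := ha σ
    have hx0 : x ≠ 0 := by
      rintro rfl
      rw [zero_pow hm0, zero_mul, map_eq_zero] at hx
      exact ha0 hx
    have hxE : algebraMap K v.Completion x ≠ 0 := by simpa using hx0
    have hlm := hℓm
    obtain ⟨q, rfl⟩ := hlm
    refine hb ℓ hℓ hℓm (f y / algebraMap K v.Completion x ^ q) ?_
    rw [div_pow, ← map_pow, hy, hf, map_mul, hx, σ.commutes, ← pow_mul, mul_comm q]
    simp only [map_mul, map_pow]
    field_simp

theorem IsGlobalField.exists_forall_ne_pow_sub_self (hk : IsGlobalField k) [FiniteDimensional k K]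
    [IsGalois k K] [IsCyclic Gal(K/k)] (p : ℕ) [Fact p.Prime] [CharP k p] {a : K}
    (ha : ∀ σ : Gal(K/k), ∃ x : K, σ a = x ^ p - x + a)
    {T : Set (AbsoluteValue k ℝ)} (hT : IsFinitePlaceSet T) :
    ∃ b : k, ∀ v : AbsoluteValue K ℝ,
      (∃ u ∈ T, (v.comp (algebraMap k K).injective).IsEquiv u) →
      ∀ y : v.Completion, y ^ p - y ≠ algebraMap K v.Completion (a + algebraMap k K b) := by
  suffices h : ∃ b : k, ∀ v : AbsoluteValue K ℝ, True →
      (∃ u ∈ T, (v.comp (algebraMap k K).injective).IsEquiv u) →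
      ∀ y : v.Completion, y ^ p - y ≠ algebraMap K v.Completion (a + algebraMap k K b) by
    simpa using h
  refine AbsoluteValue.exists_forall_of_exists_local (K := K)
    (fun v b ↦ ∀ y : v.Completion, y ^ p - y ≠ algebraMap K v.Completion (a + algebraMap k K b))
    (fun _ ↦ True) (fun v _ hn ↦ ?_) (fun v hn b hb ↦ ?_) (fun v v' σ hσ b hb y hy ↦ ?_) hT
  · have : CharP v.Completion p :=
      charP_of_injective_algebraMap (algebraMap k v.Completion).injective p
    by_cases h : ∀ y : v.Completion, y ^ p - y ≠ algebraMap K v.Completion a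
    · exact ⟨0, by simpa using h⟩
    push Not at h
    obtain ⟨z, hz⟩ := h
    obtain ⟨b, hb⟩ := hk.exists_ne_pow_sub_self_completion (K := K) hn p
    refine ⟨b, fun y hy ↦ hb (y - z) ?_⟩
    rw [map_add, ← IsScalarTower.algebraMap_apply] at hy
    rw [sub_pow_char]
    linear_combination hy - hz
  · have : CharP v.Completion p :=
      charP_of_injective_algebraMap (algebraMap k v.Completion).injective p
    let _ := AbsoluteValue.nontriviallyNormedFieldCompletion hn
    refine ⟨_, (continuous_id.sub continuous_const).continuousAt.preimage_mem_nhds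
      (show _ ∈ 𝓝 (algebraMap k v.Completion b - algebraMap k v.Completion b) by
        rw [sub_self]; exact setOf_pow_sub_self_mem_nhds_zero p), fun b' hb' y hy ↦ ?_⟩
    obtain ⟨z, hz⟩ := hb'
    refine hb (y - z) ?_
    rw [map_add, ← IsScalarTower.algebraMap_apply] at hy ⊢
    replace hz : z ^ p - z = algebraMap k v.Completion b' - algebraMap k v.Completion b := hz
    rw [sub_pow_char]
    linear_combination hy - hz
  · obtain ⟨f, hf⟩ := AbsoluteValue.exists_ringHom_completion σ hσ
    obtain ⟨x, hx⟩ := ha σ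
    have : CharP v.Completion p :=
      charP_of_injective_algebraMap (algebraMap k v.Completion).injective p
    refine hb (f y - algebraMap K v.Completion x) ?_
    have h1 := congrArg f hy
    rw [map_sub, map_pow, hf, map_add, hx, σ.commutes] at h1
    simp only [map_add, map_sub, map_pow] at h1 ⊢
    rw [sub_pow_char]
    linear_combination h1

end Elements

end

/-! ### Irreducible Kummer and Artin–Schreier polynomials and their Galois groups -/

section

open Polynomial

section Eval

variable {R S : Type*} [CommRing R] [CommRing S] (i : R →+* S) (y : S) (m : ℕ) (a : R)

theorem eval₂_X_pow_sub_C : (X ^ m - C a).eval₂ i y = y ^ m - i a := by simp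

theorem eval₂_X_pow_sub_X_sub_C : (X ^ m - X - C a).eval₂ i y = y ^ m - y - i a := by simp

end Eval

section Irreducibility

variable {E : Type*} [Field E]

/-- Bézout turns the relation into `c' ^ m = a ^ e` with `e = gcd(d, m) < m`. Then `a` equals `c' ^
(m / e)` up to an `e`-th root of unity, which is itself an `(m / e)`-th power of a power of `ζ`. -/
theorem exists_pow_eq_of_pow_eq_pow {m d : ℕ} (hd : 0 < d) (hdm : d < m) {ζ : E}
    (hζ : IsPrimitiveRoot ζ m) {a c : E} (ha : a ≠ 0) (hc : c ^ m = a ^ d) :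
    ∃ ℓ, ℓ.Prime ∧ ℓ ∣ m ∧ ∃ y : E, y ^ ℓ = a := by
  have hm : 0 < m := hd.trans hdm
  have hc0 : c ≠ 0 := by
    rintro rfl
    rw [zero_pow hm.ne'] at hc
    exact pow_ne_zero d ha hc.symm
  obtain ⟨m₁, hm₁⟩ := Nat.gcd_dvd_right d m
  set e := d.gcd m with he
  have he0 : 0 < e := Nat.gcd_pos_of_pos_left _ hd
  have hed : e ≤ d := Nat.le_of_dvd hd (Nat.gcd_dvd_left d m)
  have hm₁1 : m₁ ≠ 1 := by rintro rfl; omega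
  have hm₁0 : m₁ ≠ 0 := by rintro rfl; omega
  let c' : E := c ^ (d.gcdA m) * a ^ (d.gcdB m)
  have hc'0 : c' ≠ 0 := mul_ne_zero (zpow_ne_zero _ hc0) (zpow_ne_zero _ ha)
  have hc' : c' ^ m = a ^ e := by
    have h1 : (e : ℤ) = d * d.gcdA m + m * d.gcdB m := Nat.gcd_eq_gcd_ab d m
    have h2 : a ^ e = a ^ ((e : ℕ) : ℤ) := (zpow_natCast a e).symm
    rw [h2, h1, zpow_add₀ ha, zpow_mul, zpow_natCast, ← hc, mul_pow, ← zpow_natCast c m, ← zpow_mul,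
      mul_comm (m : ℤ), zpow_mul, zpow_natCast, zpow_mul, zpow_natCast,
      ← zpow_natCast (a ^ d.gcdB m) m, ← zpow_mul, mul_comm _ (m : ℤ), zpow_mul, zpow_natCast]
  have hroot : (a / c' ^ m₁) ^ e = 1 := by
    rw [div_pow, ← pow_mul, mul_comm m₁, ← hm₁, hc', div_self (pow_ne_zero _ ha)]
  have hζe : IsPrimitiveRoot (ζ ^ m₁) e := hζ.pow hm (by rw [hm₁, mul_comm])
  have : NeZero e := ⟨he0.ne'⟩
  obtain ⟨i, -, hi⟩ := hζe.eq_pow_of_pow_eq_one hroot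
  have ha' : a = (ζ ^ i * c') ^ m₁ := by
    rw [mul_pow, ← pow_mul, mul_comm i, pow_mul, hi, div_mul_cancel₀ _ (pow_ne_zero _ hc'0)]
  obtain ⟨ℓ, hℓ, t, rfl⟩ := Nat.exists_prime_and_dvd hm₁1
  refine ⟨ℓ, hℓ, ⟨e * t, by rw [hm₁]; ring⟩, (ζ ^ i * c') ^ t, ?_⟩
  rw [← pow_mul, mul_comm t, ← ha']

/-- A root of degree `d < m` has norm `c` with `c ^ m = a ^ d`. The presence of `ζ` removes the
usual exception for `4 ∣ m`. -/
theorem irreducible_X_pow_sub_C_of_isPrimitiveRoot {m : ℕ} (hm : 0 < m) {ζ : E}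
    (hζ : IsPrimitiveRoot ζ m) {a : E} (ha : a ≠ 0)
    (h : ∀ ℓ, ℓ.Prime → ℓ ∣ m → ∀ y : E, y ^ ℓ ≠ a) : Irreducible (X ^ m - C a) := by
  have hmonic : (X ^ m - C a).Monic := monic_X_pow_sub_C a hm.ne'
  have hdeg : (X ^ m - C a).natDegree = m := natDegree_X_pow_sub_C
  obtain ⟨α, hα⟩ := IsAlgClosed.exists_aeval_eq_zero (AlgebraicClosure E) (X ^ m - C a)
    (by rw [degree_X_pow_sub_C hm]; exact_mod_cast hm.ne')
  have hint : IsIntegral E α := ⟨_, hmonic, hα⟩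
  have hdvd : minpoly E α ∣ X ^ m - C a := minpoly.dvd E α hα
  have hle : (minpoly E α).natDegree ≤ m :=
    hdeg ▸ natDegree_le_of_dvd hdvd hmonic.ne_zero
  rcases hle.eq_or_lt with hd | hd
  · rw [eq_of_monic_of_dvd_of_natDegree_le (minpoly.monic hint) hmonic hdvd (by rw [hdeg, hd])]
    exact minpoly.irreducible hint
  · exfalso
    have hfr : Module.finrank E (IntermediateField.adjoin E {α}) = (minpoly E α).natDegree :=
      IntermediateField.adjoin.finrank hint
    have hgen : (IntermediateField.AdjoinSimple.gen E α) ^ m = algebraMap E _ a := by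
      apply (algebraMap (IntermediateField.adjoin E {α}) (AlgebraicClosure E)).injective
      rw [map_pow, IntermediateField.AdjoinSimple.algebraMap_gen,
        ← IsScalarTower.algebraMap_apply]
      simpa [sub_eq_zero] using hα
    have hnorm := congrArg (Algebra.norm E) hgen
    rw [map_pow, Algebra.norm_algebraMap, hfr] at hnorm
    obtain ⟨ℓ, h1, h2, y, hy⟩ :=
      exists_pow_eq_of_pow_eq_pow (minpoly.natDegree_pos hint) hd hζ ha hnorm
    exact h ℓ h1 h2 y hy

section ArtinSchreier

variable (p : ℕ) [hp : Fact p.Prime] (a : E)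

theorem natDegree_X_pow_sub_X_sub_C : (X ^ p - X - C a : E[X]).natDegree = p := by
  have hp1 := hp.out.one_lt
  rw [sub_sub]
  rw [natDegree_sub_eq_left_of_natDegree_lt] <;> rw [natDegree_X_pow]
  rwa [natDegree_X_add_C]

theorem monic_X_pow_sub_X_sub_C : (X ^ p - X - C a : E[X]).Monic := by
  have hp1 := hp.out.one_lt
  rw [sub_sub]
  exact (monic_X_pow p).sub_of_left (by rw [degree_X_add_C, degree_X_pow]; exact_mod_cast hp1)

omit hp in
theorem separable_X_pow_sub_X_sub_C [CharP E p] : (X ^ p - X - C a : E[X]).Separable := by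
  rw [Polynomial.Separable]
  have : derivative (X ^ p - X - C a : E[X]) = -1 := by
    simp [derivative_X_pow]
  rw [this]
  exact isCoprime_one_right.neg_right

theorem Algebra.trace_pow_char [CharP E p] {L : Type*} [Field L] [Algebra E L]
    [FiniteDimensional E L] [Algebra.IsSeparable E L] (x : L) :
    Algebra.trace E L (x ^ p) = Algebra.trace E L x ^ p := by
  have : CharP (AlgebraicClosure E) p :=
    charP_of_injective_algebraMap (algebraMap E (AlgebraicClosure E)).injective p
  apply (algebraMap E (AlgebraicClosure E)).injective
  rw [(algebraMap E (AlgebraicClosure E)).map_pow, trace_eq_sum_embeddings (AlgebraicClosure E),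
    trace_eq_sum_embeddings (AlgebraicClosure E), sum_pow_char p]
  simp

/-- For a root of degree `d < p`, the trace divided by `d` would be a solution in `E`. -/
theorem irreducible_X_pow_sub_X_sub_C [CharP E p] (h : ∀ y : E, y ^ p - y ≠ a) :
    Irreducible (X ^ p - X - C a) := by
  have hmonic := monic_X_pow_sub_X_sub_C p a
  have hdeg := natDegree_X_pow_sub_X_sub_C p a
  obtain ⟨α, hα⟩ := IsAlgClosed.exists_aeval_eq_zero (AlgebraicClosure E) (X ^ p - X - C a)
    (by
      rw [degree_eq_natDegree hmonic.ne_zero, hdeg]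
      exact_mod_cast hp.out.ne_zero)
  have hint : IsIntegral E α := ⟨_, hmonic, hα⟩
  have hdvd : minpoly E α ∣ X ^ p - X - C a := minpoly.dvd E α hα
  have hle : (minpoly E α).natDegree ≤ p :=
    (natDegree_le_of_dvd hdvd hmonic.ne_zero).trans hdeg.le
  rcases hle.eq_or_lt with hd | hd
  · rw [eq_of_monic_of_dvd_of_natDegree_le (minpoly.monic hint) hmonic hdvd (by rw [hdeg, hd])]
    exact minpoly.irreducible hint
  · exfalso
    have hfr : Module.finrank E (IntermediateField.adjoin E {α}) = (minpoly E α).natDegree :=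
      IntermediateField.adjoin.finrank hint
    have : FiniteDimensional E (IntermediateField.adjoin E {α}) :=
      IntermediateField.adjoin.finiteDimensional hint
    have hsep : Algebra.IsSeparable E (IntermediateField.adjoin E {α}) :=
      (IntermediateField.isSeparable_adjoin_simple_iff_isSeparable E _).2
        ((separable_X_pow_sub_X_sub_C p a).of_dvd hdvd)
    let g := IntermediateField.AdjoinSimple.gen E α
    have hgen : g ^ p - g = algebraMap E _ a := by
      apply (algebraMap (IntermediateField.adjoin E {α}) (AlgebraicClosure E)).injective
      rw [map_sub, map_pow, IntermediateField.AdjoinSimple.algebraMap_gen,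
        ← IsScalarTower.algebraMap_apply]
      simpa [sub_eq_zero] using hα
    have htr := congrArg (Algebra.trace E _) hgen
    rw [map_sub, Algebra.trace_pow_char, Algebra.trace_algebraMap, hfr] at htr
    set d := (minpoly E α).natDegree
    have hd0 : (d : E) ≠ 0 := by
      rw [Ne, CharP.cast_eq_zero_iff E p]
      exact Nat.not_dvd_of_pos_of_lt (minpoly.natDegree_pos hint) hd
    apply h (Algebra.trace E _ g / d)
    have hdp : (d : E) ^ p = d := by
      rw [← frobenius_def, map_natCast]
    rw [div_pow, hdp, ← sub_div, htr, nsmul_eq_mul, mul_div_cancel_left₀ _ hd0]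

end ArtinSchreier

end Irreducibility

section Lifting

variable {k K : Type*} [Field k] [Field K] [Algebra k K] [FiniteDimensional k K]

theorem AdjoinRoot.finiteDimensional_base (f : K[X]) [hf : Fact (Irreducible f)] :
    FiniteDimensional k (AdjoinRoot f) :=
  have : FiniteDimensional K (AdjoinRoot f) := (AdjoinRoot.powerBasis hf.out.ne_zero).finite
  FiniteDimensional.trans k K (AdjoinRoot f)

theorem AdjoinRoot.exists_algEquiv (f : K[X]) [Fact (Irreducible f)] (g : Gal(K/k))
    (y : AdjoinRoot f) (hy : f.eval₂ ((algebraMap K (AdjoinRoot f)).comp (g : K →+* K)) y = 0) :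
    ∃ τ : Gal(AdjoinRoot f/k), (∀ x, τ (algebraMap K _ x) = algebraMap K _ (g x)) ∧
      τ (AdjoinRoot.root f) = y := by
  have := AdjoinRoot.finiteDimensional_base (k := k) f
  let i : K →ₐ[k] AdjoinRoot f := (IsScalarTower.toAlgHom k K (AdjoinRoot f)).comp g.toAlgHom
  let φ : AdjoinRoot f →ₐ[k] AdjoinRoot f := AdjoinRoot.liftAlgHom f i y hy
  have hφ : Function.Bijective φ :=
    ⟨φ.toRingHom.injective, φ.toLinearMap.injective_iff_surjective.1 φ.toRingHom.injective⟩
  refine ⟨AlgEquiv.ofBijective φ hφ, fun x ↦ ?_, AdjoinRoot.liftAlgHom_root f i y hy⟩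
  exact AdjoinRoot.liftAlgHom_of f i y hy x

omit [FiniteDimensional k K] in
theorem AdjoinRoot.algEquiv_ext {f : K[X]} {s t : Gal(AdjoinRoot f/k)}
    (h : ∀ x : K, s (algebraMap K _ x) = t (algebraMap K _ x))
    (hr : s (AdjoinRoot.root f) = t (AdjoinRoot.root f)) : s = t := by
  have : (s : AdjoinRoot f →+* AdjoinRoot f) = t := AdjoinRoot.ringHom_ext (RingHom.ext h) hr
  exact AlgEquiv.ext fun x ↦ congrArg (fun u : AdjoinRoot f →+* AdjoinRoot f ↦ u x) this

variable {L : Type*} [Field L] [Algebra K L] [Algebra k L] [IsScalarTower k K L]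

omit [FiniteDimensional k K] [IsScalarTower k K L] in
theorem AlgEquiv.pow_algebraMap {σ : Gal(K/k)} {τ : Gal(L/k)}
    (h : ∀ x, τ (algebraMap K L x) = algebraMap K L (σ x)) (n : ℕ) (x : K) :
    (τ ^ n) (algebraMap K L x) = algebraMap K L ((σ ^ n) x) := by
  induction n generalizing x with
  | zero => rfl
  | succ n ih => rw [pow_succ, AlgEquiv.mul_apply, h, ih, pow_succ, AlgEquiv.mul_apply]

/-- An element fixed by `Gal(L/k)` lies in `K`, since `Gal(L/K)` fixes it, and then in `k` by the
lifts. -/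
theorem IsGalois.of_forall_exists_lift [FiniteDimensional K L] [IsGalois k K] [IsGalois K L]
    (h : ∀ g : Gal(K/k), ∃ τ : Gal(L/k), ∀ x, τ (algebraMap K L x) = algebraMap K L (g x)) :
    IsGalois k L := by
  have : FiniteDimensional k L := FiniteDimensional.trans k K L
  apply IsGalois.of_fixedField_eq_bot
  rw [eq_bot_iff]
  intro x hx
  have hx' : ∀ τ : Gal(L/k), τ x = x := fun τ ↦ hx ⟨τ, trivial⟩
  obtain ⟨y, rfl⟩ := (IsGalois.mem_range_algebraMap_iff_fixed (F := K) x).2 fun ρ ↦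
    hx' (ρ.restrictScalars k)
  obtain ⟨z, rfl⟩ := (IsGalois.mem_range_algebraMap_iff_fixed (F := k) y).2 fun g ↦ by
    obtain ⟨τ, hτ⟩ := h g
    exact (algebraMap K L).injective ((hτ y).symm.trans (hx' τ))
  exact IntermediateField.mem_bot.2 ⟨z, IsScalarTower.algebraMap_apply k K L z⟩

end Lifting

section Cyclic

variable {k K L : Type*} [Field k] [Field K] [Field L] [Algebra k K] [Algebra K L] [Algebra k L]
  [IsScalarTower k K L]

theorem IsCyclicExtension.of_orderOf_eq_finrank [FiniteDimensional k K] {τ : Gal(K/k)}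
    (h : orderOf τ = Module.finrank k K) : IsCyclicExtension k K := by
  have h1 : Nat.card Gal(K/k) ≤ Module.finrank k K := by
    rw [Nat.card_eq_fintype_card]; exact AlgEquiv.card_le
  have h2 : Nat.card Gal(K/k) = Module.finrank k K :=
    le_antisymm h1 (h ▸ orderOf_le_card)
  exact ⟨inferInstance, IsGalois.of_card_aut_eq_finrank k K h2,
    isCyclic_of_orderOf_eq_card τ (h.trans h2.symm)⟩

theorem IsCyclicExtension.tower_top (h : IsCyclicExtension k L) : IsCyclicExtension K L := by
  have := h.finite
  have := h.galois
  have := h.cyclic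
  refine ⟨FiniteDimensional.right k K L, IsGalois.tower_top_of_isGalois k K L, ?_⟩
  exact isCyclic_of_injective (AlgEquiv.restrictScalarsHom k : Gal(L/K) →* Gal(L/k))
    (AlgEquiv.restrictScalars_injective k)

theorem IsCyclicExtension.exists_generator (h : IsCyclicExtension k K) :
    ∃ σ : Gal(K/k), (∀ x, x ∈ Subgroup.zpowers σ) ∧ orderOf σ = Module.finrank k K := by
  have := h.finite
  have := h.galois
  obtain ⟨σ, hσ⟩ := h.cyclic.exists_generator
  exact ⟨σ, hσ, by rw [orderOf_eq_card_of_forall_mem_zpowers hσ, IsGalois.card_aut_eq_finrank]⟩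

/-- The order of `τ` is a multiple of `[K : k]`, so it is `[K : k]` times the order of that power of
`τ`, which is `[L : k]`. -/
theorem IsCyclicExtension.of_lift [FiniteDimensional k L] {σ : Gal(K/k)}
    (hσ : orderOf σ = Module.finrank k K) {τ : Gal(L/k)}
    (hτ : ∀ x, τ (algebraMap K L x) = algebraMap K L (σ x))
    (h : orderOf (τ ^ Module.finrank k K) = Module.finrank K L) : IsCyclicExtension k L := by
  have hK : FiniteDimensional k K := FiniteDimensional.left k K L
  have hdvd : Module.finrank k K ∣ orderOf τ := by
    rw [← hσ]
    apply orderOf_dvd_of_pow_eq_one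
    ext x
    apply (algebraMap K L).injective
    rw [← AlgEquiv.pow_algebraMap hτ, pow_orderOf_eq_one]
    rfl
  apply IsCyclicExtension.of_orderOf_eq_finrank (τ := τ)
  rw [orderOf_pow_of_dvd (Module.finrank_pos.ne') hdvd] at h
  rw [← Module.finrank_mul_finrank k K L, ← h, Nat.mul_div_cancel' hdvd]

variable {σ : Gal(K/k)}

theorem Algebra.algebraMap_norm_eq_prod_range [FiniteDimensional k K] [IsGalois k K]
    (hg : ∀ x, x ∈ Subgroup.zpowers σ) (hσ : orderOf σ = Module.finrank k K) (x : K) :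
    algebraMap k K (Algebra.norm k x) = ∏ i ∈ Finset.range (Module.finrank k K), (σ ^ i) x := by
  classical
  rw [Algebra.norm_eq_prod_automorphisms, ← IsCyclic.image_range_orderOf hg,
    Finset.prod_image, hσ]
  intro i hi j hj hij
  exact pow_injOn_Iio_orderOf (by simpa using hi) (by simpa using hj) hij

theorem Algebra.algebraMap_trace_eq_sum_range [FiniteDimensional k K] [IsGalois k K]
    (hg : ∀ x, x ∈ Subgroup.zpowers σ) (hσ : orderOf σ = Module.finrank k K) (x : K) :
    algebraMap k K (Algebra.trace k K x) = ∑ i ∈ Finset.range (Module.finrank k K), (σ ^ i) x := by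
  classical
  rw [trace_eq_sum_automorphisms, ← IsCyclic.image_range_orderOf hg, Finset.sum_image, hσ]
  intro i hi j hj hij
  exact pow_injOn_Iio_orderOf (by simpa using hi) (by simpa using hj) hij

omit [IsScalarTower k K L] in
theorem AlgEquiv.pow_apply_eq_prod_mul {τ : Gal(L/k)}
    (hτ : ∀ x, τ (algebraMap K L x) = algebraMap K L (σ x)) {α : L} {x : K}
    (hα : τ α = algebraMap K L x * α) (n : ℕ) :
    (τ ^ n) α = algebraMap K L (∏ i ∈ Finset.range n, (σ ^ i) x) * α := by
  induction n with
  | zero => simp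
  | succ n ih =>
    rw [pow_succ, AlgEquiv.mul_apply, hα, map_mul, ih, AlgEquiv.pow_algebraMap hτ,
      Finset.prod_range_succ, map_mul]
    ring

omit [IsScalarTower k K L] in
theorem AlgEquiv.pow_apply_eq_sum_add {τ : Gal(L/k)}
    (hτ : ∀ x, τ (algebraMap K L x) = algebraMap K L (σ x)) {α : L} {x : K}
    (hα : τ α = algebraMap K L x + α) (n : ℕ) :
    (τ ^ n) α = algebraMap K L (∑ i ∈ Finset.range n, (σ ^ i) x) + α := by
  induction n with
  | zero => simp
  | succ n ih =>
    rw [pow_succ, AlgEquiv.mul_apply, hα, map_add, ih, AlgEquiv.pow_algebraMap hτ,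
      Finset.sum_range_succ, map_add]
    ring

theorem exists_eq_pow_mul_of_generator [FiniteDimensional k K] (hg : ∀ g, g ∈ Subgroup.zpowers σ) {m : ℕ}
    {a x : K} (h : σ a = x ^ m * a) (g : Gal(K/k)) : ∃ y : K, g a = y ^ m * a := by
  obtain ⟨n, rfl⟩ := (mem_powers_iff_mem_zpowers.2 (hg g) : g ∈ Submonoid.powers σ)
  refine ⟨∏ i ∈ Finset.range n, (σ ^ i) x, ?_⟩
  have h' : σ a = algebraMap K K (x ^ m) * a := h
  have := AlgEquiv.pow_apply_eq_prod_mul (L := K) (σ := σ) (τ := σ) (fun _ ↦ rfl) h' n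
  simp only [map_pow, Finset.prod_pow] at this
  exact this

theorem exists_eq_pow_sub_self_add_of_generator (p : ℕ) [Fact p.Prime] [CharP K p]
    [FiniteDimensional k K] (hg : ∀ g, g ∈ Subgroup.zpowers σ)
    {a c : K} (h : σ a = c ^ p - c + a) (g : Gal(K/k)) : ∃ y : K, g a = y ^ p - y + a := by
  obtain ⟨n, rfl⟩ := (mem_powers_iff_mem_zpowers.2 (hg g) : g ∈ Submonoid.powers σ)
  refine ⟨∑ i ∈ Finset.range n, (σ ^ i) c, ?_⟩
  have h' : σ a = algebraMap K K (c ^ p - c) + a := h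
  have := AlgEquiv.pow_apply_eq_sum_add (L := K) (σ := σ) (τ := σ) (fun _ ↦ rfl) h' n
  simp only [map_pow, map_sub, Finset.sum_sub_distrib] at this
  rw [sum_pow_char p]
  exact this

end Cyclic

section Kummer

variable {k K : Type*} [Field k] [Field K] [Algebra k K]

/-- The relation `hx` allows a lift of `σ` multiplying the root by `x`. Its `[K : k]`-th power is
trivial on `K` and multiplies the root by the norm of `x`, so it has order `m`. -/
theorem isCyclicExtension_adjoinRoot_X_pow_sub_C (hK : IsCyclicExtension k K) {m : ℕ}
    {a x : K} [hirr : Fact (Irreducible (X ^ m - C a))] (ha : a ≠ 0) {σ : Gal(K/k)}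
    (hg : ∀ g, g ∈ Subgroup.zpowers σ) (hσ : orderOf σ = Module.finrank k K)
    (hx : σ a = x ^ m * a) (hN : IsPrimitiveRoot (Algebra.norm k x) m) :
    IsCyclicExtension k (AdjoinRoot (X ^ m - C a)) := by
  have := hK.finite
  have := hK.galois
  have hm : 0 < m := Nat.pos_of_ne_zero (ne_zero_of_irreducible_X_pow_sub_C hirr.out)
  set f : K[X] := X ^ m - C a with hf
  have := AdjoinRoot.finiteDimensional_base (k := k) f
  have hroot : AdjoinRoot.root f ^ m = algebraMap K _ a := root_X_pow_sub_C_pow m a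
  have hr0 : AdjoinRoot.root f ≠ 0 := by
    intro h0
    rw [h0, zero_pow hm.ne'] at hroot
    exact ha ((map_eq_zero _).1 hroot.symm)
  obtain ⟨τ, hτ, hτr⟩ := AdjoinRoot.exists_algEquiv f σ
    (algebraMap K _ x * AdjoinRoot.root f) (by
      refine (eval₂_X_pow_sub_C _ _ _ _).trans ?_
      rw [mul_pow, hroot, RingHom.comp_apply, ← map_pow, ← map_mul, sub_eq_zero]
      exact congrArg _ hx.symm)
  have hfin : Module.finrank K (AdjoinRoot f) = m := by
    rw [(AdjoinRoot.powerBasis hirr.out.ne_zero).finrank, AdjoinRoot.powerBasis_dim,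
      natDegree_X_pow_sub_C]
  have hpow : ∀ j, ((τ ^ Module.finrank k K) ^ j) (AdjoinRoot.root f) =
      algebraMap k _ (Algebra.norm k x ^ j) * AdjoinRoot.root f := by
    intro j
    have h1 := AlgEquiv.pow_apply_eq_prod_mul hτ hτr (Module.finrank k K)
    rw [← Algebra.algebraMap_norm_eq_prod_range hg hσ, ← IsScalarTower.algebraMap_apply] at h1
    induction j with
    | zero => simp
    | succ j ih =>
      rw [pow_succ', AlgEquiv.mul_apply, ih, map_mul, AlgEquiv.commutes, h1, pow_succ, map_mul]
      ring
  refine IsCyclicExtension.of_lift (K := K) hσ hτ ?_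
  rw [hfin]
  apply Nat.dvd_antisymm
  · apply orderOf_dvd_of_pow_eq_one
    refine AdjoinRoot.algEquiv_ext (fun y ↦ ?_) ?_
    · rw [← pow_mul, AlgEquiv.pow_algebraMap hτ, pow_mul, ← hσ, pow_orderOf_eq_one, one_pow]
      rfl
    · rw [hpow, hN.pow_eq_one, map_one, one_mul]
      rfl
  · apply hN.dvd_of_pow_eq_one
    have := hpow (orderOf (τ ^ Module.finrank k K))
    rw [pow_orderOf_eq_one, AlgEquiv.one_apply] at this
    apply (algebraMap k (AdjoinRoot f)).injective
    rw [map_one]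
    exact mul_right_cancel₀ hr0 (by rw [one_mul]; exact this.symm)

theorem isGalois_adjoinRoot_X_pow_sub_C [FiniteDimensional k K] [IsGalois k K] {m : ℕ} {ζ : K}
    (hζ : IsPrimitiveRoot ζ m) (b : k) [hirr : Fact (Irreducible (X ^ m - C (algebraMap k K b)))] :
    IsGalois k (AdjoinRoot (X ^ m - C (algebraMap k K b))) := by
  have hm : 0 < m := Nat.pos_of_ne_zero (ne_zero_of_irreducible_X_pow_sub_C hirr.out)
  have hne : (primitiveRoots m K).Nonempty := ⟨ζ, (mem_primitiveRoots hm).2 hζ⟩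
  have := isSplittingField_AdjoinRoot_X_pow_sub_C hne hirr.out
  have := isGalois_of_isSplittingField_X_pow_sub_C hne hirr.out
    (AdjoinRoot (X ^ m - C (algebraMap k K b)))
  have : FiniteDimensional K (AdjoinRoot (X ^ m - C (algebraMap k K b))) :=
    AdjoinRoot.finiteDimensional_base _
  apply IsGalois.of_forall_exists_lift (K := K)
  intro g
  obtain ⟨τ, hτ, -⟩ := AdjoinRoot.exists_algEquiv (X ^ m - C (algebraMap k K b)) g
    (AdjoinRoot.root _) (by
      rw [eval₂_sub, eval₂_X_pow, eval₂_C, root_X_pow_sub_C_pow, RingHom.comp_apply]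
      rw [RingHom.coe_coe, AlgEquiv.commutes, AdjoinRoot.algebraMap_eq, sub_self])
  exact ⟨τ, hτ⟩

/-- Every automorphism scales the root by an element of `k` and acts on `K` through a cyclic group;
both actions commute. -/
theorem isAbelianGalois_adjoinRoot_X_pow_sub_C (hK : IsCyclicExtension k K) {m : ℕ} {ζ : k}
    (hζ : IsPrimitiveRoot ζ m) (b : k) [hirr : Fact (Irreducible (X ^ m - C (algebraMap k K b)))] :
    IsAbelianGalois k (AdjoinRoot (X ^ m - C (algebraMap k K b))) := by
  have := hK.finite
  have := hK.galois
  have := hK.cyclic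
  have hm : 0 < m := Nat.pos_of_ne_zero (ne_zero_of_irreducible_X_pow_sub_C hirr.out)
  have : NeZero m := ⟨hm.ne'⟩
  have hgal := isGalois_adjoinRoot_X_pow_sub_C (k := k)
    (hζ.map_of_injective (algebraMap k K).injective) b
  set f : K[X] := X ^ m - C (algebraMap k K b) with hf
  have hroot : AdjoinRoot.root f ^ m = algebraMap k _ b := by
    rw [root_X_pow_sub_C_pow m, ← AdjoinRoot.algebraMap_eq, ← IsScalarTower.algebraMap_apply]
  have key : ∀ s : Gal(AdjoinRoot f/k), ∃ c : k,
      s (AdjoinRoot.root f) = algebraMap k _ c * AdjoinRoot.root f := by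
    intro s
    by_cases hr0 : AdjoinRoot.root f = 0
    · exact ⟨1, by rw [hr0, map_zero, mul_zero]⟩
    have h1 : (s (AdjoinRoot.root f) / AdjoinRoot.root f) ^ m = 1 := by
      rw [div_pow, ← map_pow, hroot, AlgEquiv.commutes, div_self]
      rw [← hroot]
      exact pow_ne_zero _ hr0
    obtain ⟨i, -, hi⟩ := (hζ.map_of_injective
      (algebraMap k (AdjoinRoot f)).injective).eq_pow_of_pow_eq_one h1
    exact ⟨ζ ^ i, by rw [map_pow, hi, div_mul_cancel₀ _ hr0]⟩
  refine { hgal with is_comm := ⟨fun s t ↦ AdjoinRoot.algEquiv_ext (fun x ↦ ?_) ?_⟩ }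
  · have hres : ∀ (u : Gal(AdjoinRoot f/k)) (x : K), u (algebraMap K _ x) =
        algebraMap K _ (u.restrictNormal K x) := fun u x ↦
      (AlgEquiv.restrictNormal_commutes u K x).symm
    let := IsCyclic.commGroup (α := Gal(K/k))
    rw [AlgEquiv.mul_apply, AlgEquiv.mul_apply, hres, hres, hres, hres, ← AlgEquiv.mul_apply,
      mul_comm, AlgEquiv.mul_apply]
  · obtain ⟨c, hc⟩ := key s
    obtain ⟨d, hd⟩ := key t
    rw [AlgEquiv.mul_apply, AlgEquiv.mul_apply, hc, hd, map_mul, map_mul, AlgEquiv.commutes,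
      AlgEquiv.commutes, hc, hd]
    ring

end Kummer

section ArtinSchreier

variable {k K : Type*} [Field k] [Field K] [Algebra k K]

/-- Additive analogue of the Kummer case: the lift adds `c` to the root, and its `[K : k]`-th power
adds the trace 1, so it has order `p`. -/
theorem isCyclicExtension_adjoinRoot_X_pow_sub_X_sub_C (hK : IsCyclicExtension k K) (p : ℕ)
    [hp : Fact p.Prime] [CharP k p] {a c : K} [hirr : Fact (Irreducible (X ^ p - X - C a))]
    {σ : Gal(K/k)} (hg : ∀ g, g ∈ Subgroup.zpowers σ) (hσ : orderOf σ = Module.finrank k K)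
    (hc : σ a = c ^ p - c + a) (hT : Algebra.trace k K c = 1) :
    IsCyclicExtension k (AdjoinRoot (X ^ p - X - C a)) := by
  have := hK.finite
  have := hK.galois
  set f : K[X] := X ^ p - X - C a with hf
  have : CharP (AdjoinRoot f) p :=
    charP_of_injective_algebraMap (algebraMap k (AdjoinRoot f)).injective p
  have := AdjoinRoot.finiteDimensional_base (k := k) f
  have hroot : AdjoinRoot.root f ^ p - AdjoinRoot.root f = algebraMap K _ a :=
    sub_eq_zero.1 ((eval₂_X_pow_sub_X_sub_C _ _ _ _).symm.trans (AdjoinRoot.eval₂_root f))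
  obtain ⟨τ, hτ, hτr⟩ := AdjoinRoot.exists_algEquiv f σ
    (algebraMap K _ c + AdjoinRoot.root f) (by
      refine (eval₂_X_pow_sub_X_sub_C _ _ _ _).trans ?_
      rw [add_pow_char, sub_eq_zero, add_sub_add_comm, hroot, RingHom.comp_apply, RingHom.coe_coe,
        hc, map_add, map_sub, map_pow])
  have hfin : Module.finrank K (AdjoinRoot f) = p := by
    rw [(AdjoinRoot.powerBasis hirr.out.ne_zero).finrank, AdjoinRoot.powerBasis_dim,
      natDegree_X_pow_sub_X_sub_C]
  have hpow : ∀ j : ℕ, ((τ ^ Module.finrank k K) ^ j) (AdjoinRoot.root f) =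
      j + AdjoinRoot.root f := by
    intro j
    have h1 := AlgEquiv.pow_apply_eq_sum_add hτ hτr (Module.finrank k K)
    rw [← Algebra.algebraMap_trace_eq_sum_range hg hσ, hT, map_one, map_one] at h1
    induction j with
    | zero => simp
    | succ j ih =>
      rw [pow_succ', AlgEquiv.mul_apply, ih, map_add, map_natCast, h1, Nat.cast_succ]
      ring
  refine IsCyclicExtension.of_lift (K := K) hσ hτ ?_
  rw [hfin]
  apply Nat.dvd_antisymm
  · apply orderOf_dvd_of_pow_eq_one
    refine AdjoinRoot.algEquiv_ext (fun y ↦ ?_) ?_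
    · rw [← pow_mul, AlgEquiv.pow_algebraMap hτ, pow_mul, ← hσ, pow_orderOf_eq_one, one_pow]
      rfl
    · rw [hpow, CharP.cast_eq_zero, zero_add]
      rfl
  · have := hpow (orderOf (τ ^ Module.finrank k K))
    rw [pow_orderOf_eq_one, AlgEquiv.one_apply, right_eq_add] at this
    exact (CharP.cast_eq_zero_iff _ p _).1 this

theorem exists_trace_eq_one_and_map_eq [FiniteDimensional k K] [IsGalois k K] (p : ℕ)
    [hp : Fact p.Prime] [CharP k p] {σ : Gal(K/k)} (hg : ∀ g, g ∈ Subgroup.zpowers σ)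
    (hσ : orderOf σ = Module.finrank k K) :
    ∃ a c : K, Algebra.trace k K c = 1 ∧ σ a = c ^ p - c + a := by
  have : CharP K p := charP_of_injective_algebraMap (algebraMap k K).injective p
  obtain ⟨c, hc⟩ := Algebra.trace_surjective k K 1
  set n := Module.finrank k K with hn
  set d : K := c ^ p - c with hd
  have hd0 : ∑ i ∈ Finset.range n, (σ ^ i) d = 0 := by
    rw [← Algebra.algebraMap_trace_eq_sum_range hg hσ, hd, map_sub, Algebra.trace_pow_char p, hc]
    simp
  have hc1 : ∑ i ∈ Finset.range n, (σ ^ i) c = 1 := by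
    rw [← Algebra.algebraMap_trace_eq_sum_range hg hσ, hc, map_one]
  let S : ℕ → K := fun i ↦ ∑ j ∈ Finset.range i, (σ ^ j) d
  have hS : ∀ i, σ (S i) = S (i + 1) - d := by
    intro i
    simp only [S, map_sum, Finset.sum_range_succ', pow_zero, AlgEquiv.one_apply, add_sub_cancel_right,
      pow_succ', AlgEquiv.mul_apply]
  have hσn : σ ^ n = 1 := by rw [← hσ, pow_orderOf_eq_one]
  -- The explicit additive Hilbert 90 solution for `d = c ^ p - c`, which has trace zero because `c`
  -- has trace 1; `c` also serves as the normalizing element.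
  refine ⟨-∑ i ∈ Finset.range n, S i * (σ ^ i) c, c, hc, ?_⟩
  have h1 : σ (∑ i ∈ Finset.range n, S i * (σ ^ i) c) =
      ∑ i ∈ Finset.range n, S (i + 1) * (σ ^ (i + 1)) c -
        d * ∑ i ∈ Finset.range n, (σ ^ (i + 1)) c := by
    rw [map_sum, Finset.mul_sum, ← Finset.sum_sub_distrib]
    refine Finset.sum_congr rfl fun i _ ↦ ?_
    rw [map_mul, hS, pow_succ', AlgEquiv.mul_apply]
    ring
  have h2 : ∑ i ∈ Finset.range n, S (i + 1) * (σ ^ (i + 1)) c =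
      ∑ i ∈ Finset.range n, S i * (σ ^ i) c := by
    have := Finset.sum_range_succ' (fun i ↦ S i * (σ ^ i) c) n
    rw [Finset.sum_range_succ] at this
    have h0 : S 0 = 0 := rfl
    have hSn : S n = 0 := hd0
    rw [h0, hSn, zero_mul, zero_mul, add_zero, add_zero] at this
    exact this.symm
  have h3 : ∑ i ∈ Finset.range n, (σ ^ (i + 1)) c = 1 := by
    have := Finset.sum_range_succ' (fun i ↦ (σ ^ i) c) n
    rw [Finset.sum_range_succ, hσn, hc1, pow_zero] at this
    exact (add_right_cancel this).symm
  rw [map_neg, h1, h2, h3]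
  ring

end ArtinSchreier

end

/-! ### Local degrees and simultaneous local irreducibility -/

section

open Polynomial

section LocalDegree

variable {K M L : Type*} [Field K] [Field M] [Field L] [Algebra K M] [Algebra M L] [Algebra K L]
  [IsScalarTower K M L]

theorem AbsoluteValue.LiesOver.isNontrivial {v : AbsoluteValue K ℝ} {w : AbsoluteValue L ℝ}
    (h : w.LiesOver v) (hv : v.IsNontrivial) : w.IsNontrivial := by
  obtain ⟨x, hx0, hx⟩ := hv
  refine ⟨algebraMap K L x, (_root_.map_ne_zero _).2 hx0, ?_⟩
  rwa [← h.comp_eq] at hx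

theorem AbsoluteValue.LiesOver.isNonarchimedean_iff {v : AbsoluteValue K ℝ} {w : AbsoluteValue L ℝ}
    (h : w.LiesOver v) : IsNonarchimedean v ↔ IsNonarchimedean w := by
  rw [← AbsoluteValue.isNonarchimedean_comp_iff (F := K) w, h.comp_eq]

theorem localDegree_le [FiniteDimensional K L] {v : AbsoluteValue K ℝ} {w : AbsoluteValue L ℝ}
    (h : w.LiesOver v) (hv : v.IsNontrivial) : localDegree v w h ≤ Module.finrank K L := by
  let _ := (completionEmbedding v w h).toAlgebra
  have := isScalarTower_completionEmbedding v w h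
  exact finrank_le_of_compositumMap_surjective (compositumMap_completion_surjective v w h hv)

theorem localDegree_pos [FiniteDimensional K L] {v : AbsoluteValue K ℝ} {w : AbsoluteValue L ℝ}
    (h : w.LiesOver v) (hv : v.IsNontrivial) : 0 < localDegree v w h := by
  let _ := (completionEmbedding v w h).toAlgebra
  have := isScalarTower_completionEmbedding v w h
  have := finiteDimensional_of_compositumMap_surjective
    (compositumMap_completion_surjective v w h hv)
  exact Module.finrank_pos (R := v.Completion) (M := w.Completion)

/-- The root generates an extension of degree `f.natDegree` inside the completion of `L`, and the
global degree is always an upper bound. -/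
theorem localDegree_eq_of_irreducible [FiniteDimensional K L] {v : AbsoluteValue K ℝ}
    {w : AbsoluteValue L ℝ} (h : w.LiesOver v) (hv : v.IsNontrivial) {f : K[X]}
    (hf : Module.finrank K L = f.natDegree) {α : L} (hα : aeval α f = 0)
    (hirr : Irreducible (f.map (algebraMap K v.Completion))) :
    localDegree v w h = Module.finrank K L := by
  refine (localDegree_le h hv).antisymm ?_
  let _ := (completionEmbedding v w h).toAlgebra
  have := isScalarTower_completionEmbedding v w h
  have := finiteDimensional_of_compositumMap_surjective
    (compositumMap_completion_surjective v w h hv)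
  have hroot : aeval (algebraMap L w.Completion α) (f.map (algebraMap K v.Completion)) = 0 := by
    rw [aeval_map_algebraMap, aeval_algebraMap_apply, hα, map_zero]
  have hmin := minpoly.eq_of_irreducible hirr hroot
  have hdeg : (minpoly v.Completion (algebraMap L w.Completion α)).natDegree = f.natDegree := by
    rw [← hmin, natDegree_mul_C, natDegree_map]
    exact inv_ne_zero (leadingCoeff_ne_zero.2 hirr.ne_zero)
  rw [hf, ← hdeg]
  exact minpoly.natDegree_le _

theorem localDegree_eq_one_of_isAlgClosed [FiniteDimensional K L] {v : AbsoluteValue K ℝ}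
    {w : AbsoluteValue L ℝ} (h : w.LiesOver v) (hv : v.IsNontrivial) [IsAlgClosed v.Completion] :
    localDegree v w h = 1 := by
  let _ := (completionEmbedding v w h).toAlgebra
  have := isScalarTower_completionEmbedding v w h
  have := finiteDimensional_of_compositumMap_surjective
    (compositumMap_completion_surjective v w h hv)
  have hb := IsAlgClosed.algebraMap_bijective_of_isIntegral (k := v.Completion) (K := w.Completion)
  have := (LinearEquiv.ofBijective (Algebra.linearMap v.Completion w.Completion) hb).finrank_eq
  exact this.symm.trans (Module.finrank_self _)

theorem completionEmbedding_comp {u : AbsoluteValue K ℝ} {v : AbsoluteValue M ℝ}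
    {w : AbsoluteValue L ℝ} (huv : v.LiesOver u) (hvw : w.LiesOver v) (huw : w.LiesOver u) :
    (completionEmbedding v w hvw).comp (completionEmbedding u v huv) =
      completionEmbedding u w huw := by
  have h1 : Continuous (completionEmbedding v w hvw) :=
    (isometry_algebraMap_withAbs v w hvw).isometry_mapRingHom.continuous
  have h2 : Continuous (completionEmbedding u v huv) :=
    (isometry_algebraMap_withAbs u v huv).isometry_mapRingHom.continuous
  have h3 : Continuous (completionEmbedding u w huw) :=
    (isometry_algebraMap_withAbs u w huw).isometry_mapRingHom.continuous
  refine RingHom.ext (congrFun (u.denseRange_algebraMap_completion.equalizer (h1.comp h2) h3 ?_))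
  funext x
  change completionEmbedding v w hvw (completionEmbedding u v huv (algebraMap K u.Completion x)) =
    completionEmbedding u w huw (algebraMap K u.Completion x)
  rw [completionEmbedding_algebraMap, completionEmbedding_algebraMap,
    IsScalarTower.algebraMap_apply K M v.Completion, completionEmbedding_algebraMap,
    IsScalarTower.algebraMap_apply K L w.Completion,
    IsScalarTower.algebraMap_apply M L w.Completion, ← IsScalarTower.algebraMap_apply K M L]

theorem localDegree_mul_localDegree {u : AbsoluteValue K ℝ} {v : AbsoluteValue M ℝ}
    {w : AbsoluteValue L ℝ} (huv : v.LiesOver u) (hvw : w.LiesOver v) (huw : w.LiesOver u) :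
    localDegree u v huv * localDegree v w hvw = localDegree u w huw := by
  let _ := (completionEmbedding u v huv).toAlgebra
  let _ := (completionEmbedding v w hvw).toAlgebra
  let _ := (completionEmbedding u w huw).toAlgebra
  have : IsScalarTower u.Completion v.Completion w.Completion := IsScalarTower.of_algebraMap_eq'
    (completionEmbedding_comp huv hvw huw).symm
  exact Module.finrank_mul_finrank u.Completion v.Completion w.Completion

theorem AbsoluteValue.LiesOver.comp {u : AbsoluteValue K ℝ} {w : AbsoluteValue L ℝ}
    (h : w.LiesOver u) : (w.comp (algebraMap M L).injective).LiesOver u := by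
  refine ⟨?_⟩
  rw [← h.comp_eq]
  ext x
  exact congrArg w (IsScalarTower.algebraMap_apply K M L x).symm

theorem AbsoluteValue.LiesOver.comp_algebraMap {k : Type*} [Field k] [Algebra k K] [Algebra k L]
    [IsScalarTower k K L] {v : AbsoluteValue K ℝ} {w : AbsoluteValue L ℝ} (h : w.LiesOver v) :
    w.comp (algebraMap k L).injective = v.comp (algebraMap k K).injective := by
  rw [← h.comp_eq]
  ext x
  exact congrArg w (IsScalarTower.algebraMap_apply k K L x)

end LocalDegree

section Places

theorem IsGlobalField.of_finiteDimensional {F E : Type*} [Field F] [Field E] [Algebra F E]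
    [FiniteDimensional F E] (hF : IsGlobalField F) : IsGlobalField E := by
  rcases hF with hF | ⟨p, hp, _, hF⟩
  · exact Or.inl (NumberField.of_module_finite F E)
  · let _ : Algebra (RatFunc (ZMod p)) E :=
      ((algebraMap F E).comp (algebraMap (RatFunc (ZMod p)) F)).toAlgebra
    have : IsScalarTower (RatFunc (ZMod p)) F E := IsScalarTower.of_algebraMap_eq' rfl
    exact Or.inr ⟨p, hp, inferInstance, FiniteDimensional.trans (RatFunc (ZMod p)) F E⟩

/-- Inequivalent places of `K` can have equivalent restrictions to `k`; approximation requires a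
choice of one per class. -/
theorem exists_isFinitePlaceSet {k : Type*} [Field k] {A : Set (AbsoluteValue k ℝ)}
    (hA : A.Finite) (hn : ∀ v ∈ A, v.IsNontrivial) :
    ∃ T, IsFinitePlaceSet T ∧ ∀ v ∈ A, ∃ u ∈ T, v.IsEquiv u := by
  induction A, hA using Set.Finite.induction_on with
  | empty => exact ⟨∅, ⟨Set.finite_empty, by simp, by simp⟩, by simp⟩
  | @insert a s _ _ ih =>
    obtain ⟨T, hT, h⟩ := ih fun v hv ↦ hn v (Set.mem_insert_of_mem _ hv)
    by_cases ha : ∃ u ∈ T, a.IsEquiv u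
    · refine ⟨T, hT, fun v hv ↦ ?_⟩
      rcases Set.mem_insert_iff.1 hv with rfl | hv
      exacts [ha, h v hv]
    · push Not at ha
      refine ⟨insert a T, ⟨hT.finite.insert a, ?_, ?_⟩, fun v hv ↦ ?_⟩
      · rintro v (rfl | hv)
        exacts [hn v (Set.mem_insert _ _), hT.nontrivial v hv]
      · refine hT.inequivalent.insert fun b hb _ ↦ ⟨ha b hb, fun hba ↦ ha b hb hba.symm⟩
      · rcases Set.mem_insert_iff.1 hv with rfl | hv
        · exact ⟨v, Set.mem_insert _ _, AbsoluteValue.IsEquiv.refl v⟩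
        · obtain ⟨u, hu, hvu⟩ := h v hv
          exact ⟨u, Set.mem_insert_of_mem _ hu, hvu⟩

variable {k K : Type*} [Field k] [Field K] [Algebra k K]

theorem IsGlobalField.exists_irreducible_X_pow_sub_C (hk : IsGlobalField k)
    (hK : IsCyclicExtension k K) {m : ℕ} (hm : (m : k) ≠ 0) {ζ : K} (hζ : IsPrimitiveRoot ζ m)
    {a : K} (ha0 : a ≠ 0) (ha : ∀ σ : Gal(K/k), ∃ x : K, σ a = x ^ m * a)
    {A : Set (AbsoluteValue k ℝ)} (hA : A.Finite) (hn : ∀ u ∈ A, u.IsNontrivial) :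
    ∃ b : k, b ≠ 0 ∧ Irreducible (X ^ m - C (a * algebraMap k K b)) ∧
      ∀ v : AbsoluteValue K ℝ, (IsNonarchimedean v ∨ IsRealArchimedean v) →
        v.comp (algebraMap k K).injective ∈ A →
        Irreducible ((X ^ m - C (a * algebraMap k K b)).map (algebraMap K v.Completion)) := by
  have := hK.finite
  have := hK.galois
  have := hK.cyclic
  have hm0 : 0 < m := Nat.pos_of_ne_zero fun h ↦ hm (by rw [h, Nat.cast_zero])
  -- The auxiliary place forces `b ≠ 0` and irreducibility over `K`, whatever `A` is.
  obtain ⟨v₀, hv₀, hv₀n⟩ := (hk.of_finiteDimensional (E := K)).exists_isNonarchimedean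
  obtain ⟨T, hT, hAT⟩ := exists_isFinitePlaceSet
    (hA.insert (v₀.comp (algebraMap k K).injective)) (by
      rintro v (rfl | hv)
      exacts [AbsoluteValue.isNontrivial_comp_of_finiteDimensional hv₀n, hn v hv])
  obtain ⟨b, hb⟩ := hk.exists_forall_isNonpowerAt hm hζ ha0 ha hT
  have hb0 : b ≠ 0 := (hb v₀ (Or.inl hv₀) (hAT _ (Set.mem_insert _ _))).1
  have key : ∀ v : AbsoluteValue K ℝ, IsNonpowerAt m v (a * algebraMap k K b) →
      Irreducible ((X ^ m - C (a * algebraMap k K b)).map (algebraMap K v.Completion)) := by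
    intro v hv
    rw [Polynomial.map_sub, Polynomial.map_pow, map_X, map_C]
    exact irreducible_X_pow_sub_C_of_isPrimitiveRoot hm0
      (hζ.map_of_injective (algebraMap K v.Completion).injective)
      ((_root_.map_ne_zero _).2 (mul_ne_zero ha0 ((_root_.map_ne_zero _).2 hb0))) hv
  refine ⟨b, hb0, ?_, fun v hv hvA ↦ key v (hb v hv (hAT _ (Set.mem_insert_of_mem _ hvA))).2⟩
  exact (monic_X_pow_sub_C _ hm0.ne').irreducible_of_irreducible_map _ _
    (key v₀ (hb v₀ (Or.inl hv₀) (hAT _ (Set.mem_insert _ _))).2)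

theorem IsGlobalField.exists_irreducible_X_pow_sub_X_sub_C (hk : IsGlobalField k)
    (hK : IsCyclicExtension k K) (p : ℕ) [Fact p.Prime] [CharP k p] {a : K}
    (ha : ∀ σ : Gal(K/k), ∃ x : K, σ a = x ^ p - x + a)
    {A : Set (AbsoluteValue k ℝ)} (hA : A.Finite) (hn : ∀ u ∈ A, u.IsNontrivial) :
    ∃ b : k, Irreducible (X ^ p - X - C (a + algebraMap k K b)) ∧
      ∀ v : AbsoluteValue K ℝ, v.comp (algebraMap k K).injective ∈ A →
        Irreducible ((X ^ p - X - C (a + algebraMap k K b)).map (algebraMap K v.Completion)) := by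
  have := hK.finite
  have := hK.galois
  have := hK.cyclic
  obtain ⟨v₀, -, hv₀n⟩ := (hk.of_finiteDimensional (E := K)).exists_isNonarchimedean
  obtain ⟨T, hT, hAT⟩ := exists_isFinitePlaceSet
    (hA.insert (v₀.comp (algebraMap k K).injective)) (by
      rintro v (rfl | hv)
      exacts [AbsoluteValue.isNontrivial_comp_of_finiteDimensional hv₀n, hn v hv])
  obtain ⟨b, hb⟩ := hk.exists_forall_ne_pow_sub_self p ha hT
  have key : ∀ v : AbsoluteValue K ℝ,
      (∀ y : v.Completion, y ^ p - y ≠ algebraMap K v.Completion (a + algebraMap k K b)) →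
      Irreducible ((X ^ p - X - C (a + algebraMap k K b)).map (algebraMap K v.Completion)) := by
    intro v hv
    have : CharP v.Completion p := charP_of_injective_algebraMap
      (algebraMap k v.Completion).injective p
    rw [Polynomial.map_sub, Polynomial.map_sub, Polynomial.map_pow, map_X, map_C]
    exact irreducible_X_pow_sub_X_sub_C p _ hv
  refine ⟨b, ?_, fun v hvA ↦ key v (hb v (hAT _ (Set.mem_insert_of_mem _ hvA)))⟩
  exact (monic_X_pow_sub_X_sub_C p _).irreducible_of_irreducible_map _ _
    (key v₀ (hb v₀ (hAT _ (Set.mem_insert _ _))))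

end Places

end

/-! ### Splitting the degree into a power of the characteristic and a prime-to-characteristic part
-/

section

open Polynomial

section PrimePowerDegree

variable {k : Type u} {K : Type v} [Field k] [Field K] [Algebra k K]

theorem localDegree_self {v w : AbsoluteValue K ℝ} (h : w.LiesOver v) (hv : v.IsNontrivial) :
    localDegree v w h = 1 :=
  le_antisymm ((localDegree_le h hv).trans (Module.finrank_self K).le) (localDegree_pos h hv)

theorem IsRealArchimedean.dvd_two {v : AbsoluteValue K ℝ} (h : IsRealArchimedean v) {m : ℕ} {ζ : K}
    (hζ : IsPrimitiveRoot ζ m) (hm : m ≠ 0) : m ∣ 2 := by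
  obtain ⟨σ, -⟩ := h
  have h1 : IsPrimitiveRoot (σ ζ) m := hζ.map_of_injective σ.injective
  refine h1.dvd_of_pow_eq_one 2 ?_
  have h2 : |σ ζ| = 1 := (pow_eq_one_iff_of_nonneg (abs_nonneg _) hm).1 (by
    rw [← abs_pow, h1.pow_eq_one, abs_one])
  rw [← sq_abs, h2, one_pow]

/-- A cyclic extension of `k` containing `K` of given degree `p ^ r` over `K`, with prescribed full
local degrees. -/
theorem IsGlobalField.exists_isCyclicExtension_pow (hk : IsGlobalField k)
    (hK : IsCyclicExtension k K) (p : ℕ) [Fact p.Prime] [CharP k p]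
    {A : Set (AbsoluteValue k ℝ)} (hA : A.Finite) (hn : ∀ u ∈ A, u.IsNontrivial) (r : ℕ) :
    ∃ (M : Type v) (_ : Field M) (_ : Algebra K M) (_ : Algebra k M) (_ : IsScalarTower k K M),
      IsCyclicExtension k M ∧ Module.finrank K M = p ^ r ∧
      ∀ (v : AbsoluteValue K ℝ) (w : AbsoluteValue M ℝ) (h : w.LiesOver v),
        v.comp (algebraMap k K).injective ∈ A → localDegree v w h = p ^ r := by
  have hn' : ∀ v : AbsoluteValue K ℝ, v.comp (algebraMap k K).injective ∈ A → v.IsNontrivial :=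
    fun v hv ↦ (AbsoluteValue.liesOver_comp (k := k) v).isNontrivial (hn _ hv)
  induction r with
  | zero =>
    refine ⟨K, inferInstance, inferInstance, inferInstance, inferInstance, hK,
      by rw [Module.finrank_self, pow_zero], fun v w h hv ↦ ?_⟩
    rw [localDegree_self h (hn' v hv), pow_zero]
  | succ r ih =>
    obtain ⟨M, _, _, _, _, hM, hdeg, hloc⟩ := ih
    have := hM.finite
    have := hM.galois
    obtain ⟨σ, hg, hσ⟩ := hM.exists_generator
    have : CharP M p := charP_of_injective_algebraMap (algebraMap k M).injective p
    obtain ⟨a, c, hc, hac⟩ := exists_trace_eq_one_and_map_eq p hg hσ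
    obtain ⟨b, hirr, hb⟩ := hk.exists_irreducible_X_pow_sub_X_sub_C hM p
      (exists_eq_pow_sub_self_add_of_generator p hg hac) hA hn
    have hfact := Fact.mk hirr
    -- Adding an element of `k` leaves `σ a - a` unchanged, so cyclicity over `k` survives the
    -- choice of `b`.
    have hab : σ (a + algebraMap k M b) = c ^ p - c + (a + algebraMap k M b) := by
      rw [map_add, hac, AlgEquiv.commutes, add_assoc]
    have hfin : Module.finrank M (AdjoinRoot (X ^ p - X - C (a + algebraMap k M b))) =
        (X ^ p - X - C (a + algebraMap k M b)).natDegree := by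
      rw [(AdjoinRoot.powerBasis hirr.ne_zero).finrank, AdjoinRoot.powerBasis_dim]
    have hL := isCyclicExtension_adjoinRoot_X_pow_sub_X_sub_C hM p hg hσ hab hc
    have hroot := AdjoinRoot.aeval_eq (f := X ^ p - X - C (a + algebraMap k M b))
      (X ^ p - X - C (a + algebraMap k M b))
    rw [AdjoinRoot.mk_self] at hroot
    have : FiniteDimensional M (AdjoinRoot (X ^ p - X - C (a + algebraMap k M b))) :=
      AdjoinRoot.finiteDimensional_base _
    refine ⟨AdjoinRoot (X ^ p - X - C (a + algebraMap k M b)), inferInstance, inferInstance,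
      inferInstance, inferInstance, hL, ?_, fun v w h hv ↦ ?_⟩
    · rw [← Module.finrank_mul_finrank K M, hdeg, hfin, natDegree_X_pow_sub_X_sub_C, pow_succ]
    · have h1 : (w.comp (algebraMap M _).injective).LiesOver v := h.comp
      have h2 : w.LiesOver (w.comp (algebraMap M _).injective) := w.liesOver_comp
      rw [← localDegree_mul_localDegree h1 h2 h, hloc v _ h1 hv,
        localDegree_eq_of_irreducible h2 (h1.isNontrivial (hn' v hv)) hfin hroot
          (hb _ (by rwa [h1.comp_algebraMap])), hfin, natDegree_X_pow_sub_X_sub_C, pow_succ]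

/-- Reduction to the case where the degree is prime to the characteristic. -/
theorem IsGlobalField.exists_isCyclicExtension_of_pos (hk : IsGlobalField k)
    (hK : IsCyclicExtension k K) {A : Set (AbsoluteValue k ℝ)} (hA : A.Finite)
    (hn : ∀ u ∈ A, u.IsNontrivial) {m : ℕ} (hm : 0 < m) :
    ∃ q n : ℕ, m = q * n ∧ (n : k) ≠ 0 ∧ q.Coprime n ∧
    ∃ (M : Type v) (_ : Field M) (_ : Algebra K M) (_ : Algebra k M) (_ : IsScalarTower k K M),
      IsCyclicExtension k M ∧ Module.finrank K M = q ∧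
      ∀ (v : AbsoluteValue K ℝ) (w : AbsoluteValue M ℝ) (h : w.LiesOver v),
        v.comp (algebraMap k K).injective ∈ A →
        localDegree v w h = q ∧ (IsRealArchimedean v → IsRealArchimedean w ∧ q = 1) := by
  have hn' : ∀ v : AbsoluteValue K ℝ, v.comp (algebraMap k K).injective ∈ A → v.IsNontrivial :=
    fun v hv ↦ (AbsoluteValue.liesOver_comp (k := k) v).isNontrivial (hn _ hv)
  obtain ⟨p, hp⟩ := CharP.exists k
  rcases CharP.char_is_prime_or_zero k p with hprime | rfl
  · have := Fact.mk hprime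
    obtain ⟨r, n, hpn, rfl⟩ := Nat.exists_eq_pow_mul_and_not_dvd hm.ne' p hprime.ne_one
    obtain ⟨M, _, _, _, _, hM, hdeg, hloc⟩ := hk.exists_isCyclicExtension_pow hK p hA hn r
    refine ⟨p ^ r, n, rfl, by rwa [Ne, CharP.cast_eq_zero_iff k p],
      ((Nat.Prime.coprime_iff_not_dvd hprime).2 hpn).pow_left r, M, inferInstance, inferInstance,
      inferInstance, inferInstance, hM, hdeg, fun v w h hv ↦ ⟨hloc v w h hv, fun hr ↦ ?_⟩⟩
    have : CharP K p := charP_of_injective_algebraMap (algebraMap k K).injective p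
    exact absurd (v.isNonarchimedean_of_charP p) hr.not_isNonarchimedean
  -- In characteristic 0 there is no Artin–Schreier step: `M = K` and `q = 1`, so real places remain
  -- real.
  · have := CharP.charP_to_charZero k
    refine ⟨1, m, (one_mul m).symm, Nat.cast_ne_zero.2 hm.ne', Nat.coprime_one_left m, K,
      inferInstance, inferInstance, inferInstance, inferInstance, hK, Module.finrank_self K,
      fun v w h hv ↦ ⟨localDegree_self h (hn' v hv), fun hr ↦ ⟨?_, rfl⟩⟩⟩
    have : w = v := by
      rw [← h.comp_eq]
      rfl
    rwa [this]

end PrimePowerDegree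

section RootsOfUnity

theorem ContainsRootsOfUnity.exists_isPrimitiveRoot {F : Type u} [Field F] {m : ℕ}
    (h : ContainsRootsOfUnity m F) {n : ℕ} (hnm : n ∣ m) (hn : (n : F) ≠ 0) :
    ∃ ζ : F, IsPrimitiveRoot ζ n := by
  have : NeZero (n : AlgebraicClosure F) := ⟨by
    rw [← map_natCast (algebraMap F (AlgebraicClosure F))]
    exact (_root_.map_ne_zero _).2 hn⟩
  obtain ⟨z, hz⟩ := HasEnoughRootsOfUnity.exists_primitiveRoot (AlgebraicClosure F) n
  obtain ⟨t, rfl⟩ := hnm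
  obtain ⟨ζ, rfl⟩ := h z (by rw [pow_mul, hz.pow_eq_one, one_pow])
  exact ⟨ζ, hz.of_map_of_injective (algebraMap F (AlgebraicClosure F)).injective⟩

end RootsOfUnity

section FullLocalDegree

variable {k : Type*} {K M L : Type*} [Field k] [Field K] [Field M] [Field L] [Algebra k K]
  [Algebra K M] [Algebra M L] [Algebra K L] [IsScalarTower K M L]

/-- Local degrees multiply in the tower. At a real place `q = 1` and `n ∣ 2`, so `gcd(2, n) = n`; at
a complex place the completion is algebraically closed. -/
theorem hasFullLocalDegreeAt_of_localDegree (hK : IsGlobalField K) [FiniteDimensional K M]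
    [FiniteDimensional M L] {v : AbsoluteValue K ℝ} (hv : v.IsNontrivial) {q n : ℕ}
    (hKM : Module.finrank K M = q) (hML : Module.finrank M L = n)
    (hloc : ∀ (w : AbsoluteValue M ℝ) (h : w.LiesOver v), localDegree v w h = q ∧
      (IsRealArchimedean v → IsRealArchimedean w ∧ q = 1))
    (hloc' : ∀ w : AbsoluteValue M ℝ, w.LiesOver v → (IsNonarchimedean w ∨ IsRealArchimedean w) →
      ∀ (w' : AbsoluteValue L ℝ) (h : w'.LiesOver w), localDegree w w' h = n)
    (hn : IsRealArchimedean v → n ∣ 2) : HasFullLocalDegreeAt L v := by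
  intro w h
  have : FiniteDimensional K L := FiniteDimensional.trans K M L
  have h1 : (w.comp (algebraMap M L).injective).LiesOver v := h.comp
  have h2 : w.LiesOver (w.comp (algebraMap M L).injective) := w.liesOver_comp
  have hfin : Module.finrank K L = q * n := by
    rw [← Module.finrank_mul_finrank K M L, hKM, hML]
  have key : IsNonarchimedean v ∨ IsRealArchimedean v → localDegree v w h = q * n := by
    intro hv'
    rw [← localDegree_mul_localDegree h1 h2 h, (hloc _ h1).1, hloc' _ h1 ?_ w h2]
    exact hv'.imp h1.isNonarchimedean_iff.1 fun hr ↦ ((hloc _ h1).2 hr).1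
  rw [localDegreeBound]
  split_ifs with hna hr
  · rw [key (Or.inl hna), hfin]
  · rw [key (Or.inr hr), hfin, ((hloc _ h1).2 hr).2, one_mul, Nat.gcd_eq_right (hn hr)]
  · have := isAlgClosed_completion_of_not_isRealArchimedean hK hna hr
    exact localDegree_eq_one_of_isAlgClosed h hv

end FullLocalDegree

end

open Polynomial

/-! ### Hilbert 90 and necessity of the norm condition -/

section Necessity

variable {k K L : Type*} [Field k] [Field K] [Field L] [Algebra k K] [Algebra K L] [Algebra k L]
  [IsScalarTower k K L]

/-- Hilbert's theorem 90 for a cyclic extension. -/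
theorem IsCyclicExtension.exists_hilbert90 (hK : IsCyclicExtension k K) {σ : Gal(K/k)}
    (hg : ∀ x, x ∈ Subgroup.zpowers σ) {x : K} (hx : Algebra.norm k x = 1) :
    ∃ y : K, y ≠ 0 ∧ σ y = x * y := by
  have := hK.finite
  have := hK.galois
  set n := Module.finrank k K with hn
  have hσ : orderOf σ = n := by
    rw [orderOf_eq_card_of_forall_mem_zpowers hg, IsGalois.card_aut_eq_finrank]
  have hσn : σ ^ n = 1 := by rw [← hσ, pow_orderOf_eq_one]
  have hn0 : 0 < n := Module.finrank_pos
  -- With partial products of `x⁻¹` as coefficients, the sum `y` satisfies `z * σ y = y`, which is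
  -- the desired relation.
  let z : K := x⁻¹
  have hx0 : x ≠ 0 := by
    rintro rfl
    rw [Algebra.norm_zero] at hx
    exact zero_ne_one hx
  let P : ℕ → K := fun i ↦ ∏ j ∈ Finset.range i, (σ ^ j) z
  have hP0 : P 0 = 1 := rfl
  have hPn : P n = 1 := by
    change ∏ i ∈ Finset.range n, (σ ^ i) x⁻¹ = 1
    simp only [map_inv₀, Finset.prod_inv_distrib]
    rw [← Algebra.algebraMap_norm_eq_prod_range hg hσ, hx, map_one, inv_one]
  have hP : ∀ i, z * σ (P i) = P (i + 1) := by
    intro i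
    simp only [P, map_prod, Finset.prod_range_succ', pow_zero, AlgEquiv.one_apply, pow_succ',
      AlgEquiv.mul_apply]
    rw [mul_comm]
  -- Independence of the distinct characters `σ ^ i`; the coefficient `P 0` is 1.
  have hex : ∃ c : K, ∑ i ∈ Finset.range n, P i * (σ ^ i) c ≠ 0 := by
    by_contra! h0
    have hli := (linearIndependent_monoidHom K K).comp
      (fun i : Fin n ↦ ((σ ^ (i : ℕ) : Gal(K/k)) : K →* K)) (by
        intro i j hij
        have h1 : σ ^ (i : ℕ) = σ ^ (j : ℕ) := AlgEquiv.ext fun y ↦ DFunLike.congr_fun hij y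
        exact Fin.ext (pow_injOn_Iio_orderOf (by rw [hσ]; exact i.2) (by rw [hσ]; exact j.2) h1))
    have h1 := Fintype.linearIndependent_iff.1 hli (fun i ↦ P i) (by
      funext c
      have := h0 c
      rw [Finset.sum_range] at this
      simpa using this) ⟨0, hn0⟩
    exact one_ne_zero (hP0.symm.trans h1)
  obtain ⟨c, hc⟩ := hex
  refine ⟨_, hc, ?_⟩
  have h1 : z * σ (∑ i ∈ Finset.range n, P i * (σ ^ i) c) =
      ∑ i ∈ Finset.range n, P (i + 1) * (σ ^ (i + 1)) c := by
    rw [map_sum, Finset.mul_sum]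
    refine Finset.sum_congr rfl fun i _ ↦ ?_
    rw [map_mul, ← mul_assoc, hP, pow_succ', AlgEquiv.mul_apply]
  have h2 : ∑ i ∈ Finset.range n, P (i + 1) * (σ ^ (i + 1)) c =
      ∑ i ∈ Finset.range n, P i * (σ ^ i) c := by
    have := Finset.sum_range_succ' (fun i ↦ P i * (σ ^ i) c) n
    rw [Finset.sum_range_succ, hPn, hP0, hσn, pow_zero] at this
    exact (add_right_cancel this).symm
  rw [h2] at h1
  rw [← h1, ← mul_assoc, mul_inv_cancel₀ hx0, one_mul, h1]

/-- If a cyclic extension of `k` contains `K` with relative degree `m`, then the `m`-th roots of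
unity in `k` are norms. -/
theorem IsCyclicExtension.rootsOfUnityAreNorms (hK : IsCyclicExtension k K)
    (hL : IsCyclicExtension k L) {m : ℕ} (hm : Module.finrank K L = m) :
    RootsOfUnityAreNorms m k K := by
  intro ζ hζ
  have := hK.finite
  have := hK.galois
  have := hL.finite
  have := hL.galois
  have hLK : IsCyclicExtension K L := hL.tower_top
  have := hLK.finite
  have := hLK.galois
  set n := Module.finrank k K with hn
  have hn0 : n ≠ 0 := Module.finrank_pos.ne'
  obtain ⟨τ, hgτ, hτ⟩ := hL.exists_generator
  set σ : Gal(K/k) := τ.restrictNormal K with hσdef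
  have hτσ : ∀ x, τ (algebraMap K L x) = algebraMap K L (σ x) := fun x ↦
    (AlgEquiv.restrictNormal_commutes τ K x).symm
  have hg : ∀ x, x ∈ Subgroup.zpowers σ := by
    intro g
    obtain ⟨g', rfl⟩ := AlgEquiv.restrictNormalHom_surjective (F := k) (K₁ := K) L g
    obtain ⟨j, rfl⟩ := hgτ g'
    exact ⟨j, (map_zpow (AlgEquiv.restrictNormalHom (F := k) K) τ j).symm⟩
  have hσ : orderOf σ = n := by
    rw [orderOf_eq_card_of_forall_mem_zpowers hg, IsGalois.card_aut_eq_finrank]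
  let ρ : Gal(L/K) := AlgEquiv.ofRingEquiv (f := (τ ^ n : Gal(L/k)).toRingEquiv) fun x ↦ by
    change (τ ^ n) (algebraMap K L x) = algebraMap K L x
    rw [AlgEquiv.pow_algebraMap hτσ, ← hσ, pow_orderOf_eq_one]
    rfl
  have hρ : AlgEquiv.restrictScalarsHom k ρ = τ ^ n := AlgEquiv.ext fun _ ↦ rfl
  have hρo : orderOf ρ = Nat.card Gal(L/K) := by
    rw [← orderOf_injective (AlgEquiv.restrictScalarsHom k : Gal(L/K) →* Gal(L/k))
      (AlgEquiv.restrictScalars_injective k), hρ, IsGalois.card_aut_eq_finrank,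
      orderOf_pow_of_dvd hn0 (by rw [hτ, ← Module.finrank_mul_finrank k K L]; exact dvd_mul_right _ _),
      hτ, ← Module.finrank_mul_finrank k K L]
    exact Nat.mul_div_cancel_left _ (Nat.pos_of_ne_zero hn0)
  have hgρ : ∀ x, x ∈ Subgroup.zpowers ρ := by
    intro x
    rw [Subgroup.eq_top_of_card_eq (Subgroup.zpowers ρ) (by rw [Nat.card_zpowers, hρo])]
    trivial
  have hζ0 : ζ ≠ 0 := by
    rintro rfl
    rw [zero_pow (hm ▸ Module.finrank_pos.ne')] at hζ
    exact zero_ne_one hζ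
  -- The norm of `ζ` from `L` to `K` is `ζ ^ m = 1`.
  obtain ⟨α, hα0, hα⟩ := hLK.exists_hilbert90 hgρ (x := algebraMap K L (algebraMap k K ζ)) (by
    rw [Algebra.norm_algebraMap, hm, ← map_pow, hζ, map_one])
  have hα' : (τ ^ n) α = algebraMap k L ζ * α := by
    rw [IsScalarTower.algebraMap_apply k K L, ← hα]
    rfl
  -- `τ` commutes with `ρ = τ ^ n`, and both fix `ζ`, so the ratio is fixed by `ρ`. The product of
  -- its conjugates is `τ ^ n α / α = ζ`.
  have hτα : ∃ x : K, algebraMap K L x = τ α / α := by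
    have hfix : ∀ s : Gal(L/K), s (τ α / α) = τ α / α := by
      intro s
      suffices hs : Subgroup.zpowers ρ ≤ MulAction.stabilizer Gal(L/K) (τ α / α) from hs (hgρ s)
      rw [Subgroup.zpowers_le]
      change (τ ^ n) (τ α / α) = τ α / α
      rw [map_div₀, ← AlgEquiv.mul_apply, ← pow_succ, pow_succ', AlgEquiv.mul_apply, hα', map_mul,
        AlgEquiv.commutes, mul_div_mul_left]
      exact (_root_.map_ne_zero _).2 hζ0
    exact (IsGalois.mem_range_algebraMap_iff_fixed (F := K) _).2 hfix
  obtain ⟨x, hx⟩ := hτα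
  refine ⟨x, (algebraMap k L).injective ?_⟩
  have h1 := AlgEquiv.pow_apply_eq_prod_mul hτσ (α := α) (x := x)
    (by rw [hx, div_mul_cancel₀ _ hα0]) n
  rw [← Algebra.algebraMap_norm_eq_prod_range hg hσ, ← IsScalarTower.algebraMap_apply, hα'] at h1
  exact (mul_right_cancel₀ hα0 h1).symm

end Necessity

/-! ### Construction of the solutions -/

section Sufficiency

variable {k : Type u} {K : Type v} [Field k] [Field K] [Algebra k K]
  {M : Type v} [Field M] [Algebra K M] [Algebra k M] [IsScalarTower k K M]

/-- The free parameter is chosen at the places of `k` below `S`. The variable `c` allows the case `a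
= 1` to use the polynomial `X ^ n - b` itself, whose coefficients come from `k`. -/
theorem IsGlobalField.exists_hasFullLocalDegreeAt (hk : IsGlobalField k) (hK : IsGlobalField K)
    (hM : IsCyclicExtension k M) {q n : ℕ} (hn : (n : k) ≠ 0) {ζ : K} (hζ : IsPrimitiveRoot ζ n)
    {S : Set (AbsoluteValue K ℝ)} (hS : IsFinitePlaceSet S)
    (hKM : Module.finrank K M = q) [FiniteDimensional k K]
    (hloc : ∀ v ∈ S, ∀ (w : AbsoluteValue M ℝ) (h : w.LiesOver v), localDegree v w h = q ∧
      (IsRealArchimedean v → IsRealArchimedean w ∧ q = 1))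
    {a : M} (ha0 : a ≠ 0) (ha : ∀ σ : Gal(M/k), ∃ x : M, σ a = x ^ n * a) :
    ∃ b : k, b ≠ 0 ∧ ∀ c : M, c = a * algebraMap k M b →
      ∃ _ : Fact (Irreducible (X ^ n - C c)), Module.finrank K (AdjoinRoot (X ^ n - C c)) = q * n ∧
      ∀ v ∈ S, HasFullLocalDegreeAt (AdjoinRoot (X ^ n - C c)) v := by
  have hn0 : n ≠ 0 := by
    rintro rfl
    exact hn Nat.cast_zero
  obtain ⟨b, hb0, hirr, hb⟩ := hk.exists_irreducible_X_pow_sub_C hM hn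
    (hζ.map_of_injective (algebraMap K M).injective) ha0 ha
    (A := (fun v : AbsoluteValue K ℝ ↦ v.comp (algebraMap k K).injective) '' S)
    (hS.finite.image _) (by
      rintro _ ⟨v, hv, rfl⟩
      exact AbsoluteValue.isNontrivial_comp_of_finiteDimensional (hS.nontrivial v hv))
  refine ⟨b, hb0, ?_⟩
  rintro c rfl
  set f : M[X] := X ^ n - C (a * algebraMap k M b) with hf
  have hfact := Fact.mk hirr
  have hdim : Module.finrank M (AdjoinRoot f) = f.natDegree := by
    rw [(AdjoinRoot.powerBasis hirr.ne_zero).finrank, AdjoinRoot.powerBasis_dim]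
  have hnat : f.natDegree = n := natDegree_X_pow_sub_C
  have hroot := AdjoinRoot.aeval_eq (f := f) f
  rw [AdjoinRoot.mk_self] at hroot
  have := hM.finite
  have : FiniteDimensional K M := FiniteDimensional.right k K M
  have : FiniteDimensional M (AdjoinRoot f) := AdjoinRoot.finiteDimensional_base f
  refine ⟨hfact, by rw [← Module.finrank_mul_finrank K M, hKM, hdim, hnat], fun v hv ↦ ?_⟩
  refine hasFullLocalDegreeAt_of_localDegree hK (hS.nontrivial v hv) hKM (hdim.trans hnat)
    (hloc v hv) (fun w h hw w' h' ↦ ?_) fun hr ↦ hr.dvd_two hζ hn0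
  rw [localDegree_eq_of_irreducible h' (h.isNontrivial (hS.nontrivial v hv)) hdim hroot
    (hb w hw ⟨v, hv, h.comp_algebraMap.symm⟩), hdim, hnat]

end Sufficiency

section Main

theorem ContainsRootsOfUnity.map {k : Type u} [Field k] {m : ℕ} (h : ContainsRootsOfUnity m k)
    (K : Type v) [Field K] [Algebra k K] [Algebra.IsAlgebraic k K] : ContainsRootsOfUnity m K := by
  intro x hx
  have : Algebra.IsAlgebraic k (AlgebraicClosure K) :=
    Algebra.IsAlgebraic.trans k K (AlgebraicClosure K)
  have : IsAlgClosure k (AlgebraicClosure K) := ⟨inferInstance, inferInstance⟩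
  obtain ⟨y, rfl⟩ := (IsAlgClosure.equiv k (AlgebraicClosure k) (AlgebraicClosure K)).surjective x
  rw [← map_pow, EmbeddingLike.map_eq_one_iff] at hx
  obtain ⟨z, rfl⟩ := h y hx
  exact ⟨algebraMap k K z, by
    rw [AlgEquiv.commutes, ← IsScalarTower.algebraMap_apply]⟩

variable {k : Type u} {K : Type v} [Field k] [Field K] [Algebra k K]

theorem IsGlobalField.exists_isSolution (hk : IsGlobalField k) (hK : IsGlobalField K)
    (hKk : IsCyclicExtension k K) {m : ℕ} (hm : 0 < m) {S : Set (AbsoluteValue K ℝ)}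
    (hS : IsFinitePlaceSet S) (hμ : ContainsRootsOfUnity m K) :
    ∃ (L : Type v) (_ : Field L) (_ : Algebra K L) (_ : Algebra k L) (_ : IsScalarTower k K L),
      IsSolution k K m S L ∧ (ContainsRootsOfUnity m k → IsAbelianGalois k L) := by
  have := hKk.finite
  obtain ⟨q, n, rfl, hn, hqn, M, _, _, _, _, hM, hKM, hloc⟩ := hk.exists_isCyclicExtension_of_pos hKk
    (A := (fun v : AbsoluteValue K ℝ ↦ v.comp (algebraMap k K).injective) '' S)
    (hS.finite.image _) (by
      rintro _ ⟨v, hv, rfl⟩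
      exact AbsoluteValue.isNontrivial_comp_of_finiteDimensional (hS.nontrivial v hv)) hm
  obtain ⟨ζ, hζ⟩ := hμ.exists_isPrimitiveRoot (dvd_mul_left n q) (by
    rw [← map_natCast (algebraMap k K)]
    exact (_root_.map_ne_zero _).2 hn)
  obtain ⟨b, hb0, hb⟩ := hk.exists_hasFullLocalDegreeAt hK hM hn hζ hS hKM
    (fun v hv w h ↦ hloc v w h ⟨v, hv, rfl⟩) (a := 1) one_ne_zero fun σ ↦ ⟨1, by simp⟩
  obtain ⟨hirr, hdeg, hfull⟩ := hb (algebraMap k M b) (one_mul _).symm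
  have := hM.finite
  have := hM.galois
  have hKM' : IsCyclicExtension K M := hM.tower_top
  obtain ⟨σ, hg, hσ⟩ := hKM'.exists_generator
  have hbK : σ (algebraMap k M b) = algebraMap k M b := by
    rw [IsScalarTower.algebraMap_apply k K M, AlgEquiv.commutes]
  refine ⟨AdjoinRoot (X ^ n - C (algebraMap k M b)), inferInstance, inferInstance, inferInstance,
    inferInstance, ⟨?_, hdeg, hfull, ?_⟩, fun hμk ↦ ?_⟩
  -- The cyclicity criterion is applied over the base `K` with `x = ζ`: the norm of `ζ` from `M` is
  -- `ζ ^ q`, still primitive because `q` is prime to `n`.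
  · refine isCyclicExtension_adjoinRoot_X_pow_sub_C hKM' ((_root_.map_ne_zero _).2 hb0) hg hσ
      (x := algebraMap K M ζ) ?_ ?_
    · rw [hbK, ← map_pow, hζ.pow_eq_one, map_one, one_mul]
    · rw [Algebra.norm_algebraMap, hKM]
      exact hζ.pow_of_coprime q hqn
  · exact isGalois_adjoinRoot_X_pow_sub_C (hζ.map_of_injective (algebraMap K M).injective) b
  · obtain ⟨ξ, hξ⟩ := hμk.exists_isPrimitiveRoot (dvd_mul_left n q) hn
    exact isAbelianGalois_adjoinRoot_X_pow_sub_C hM hξ b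

theorem IsGlobalField.hasCyclicSolution (hk : IsGlobalField k) (hK : IsGlobalField K)
    (hKk : IsCyclicExtension k K) {m : ℕ} (hm : 0 < m) {S : Set (AbsoluteValue K ℝ)}
    (hS : IsFinitePlaceSet S) (hμ : ContainsRootsOfUnity m k) (hN : RootsOfUnityAreNorms m k K) :
    HasCyclicSolution k K m S := by
  have := hKk.finite
  obtain ⟨q, n, rfl, hn, hqn, M, _, _, _, _, hM, hKM, hloc⟩ := hk.exists_isCyclicExtension_of_pos hKk
    (A := (fun v : AbsoluteValue K ℝ ↦ v.comp (algebraMap k K).injective) '' S)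
    (hS.finite.image _) (by
      rintro _ ⟨v, hv, rfl⟩
      exact AbsoluteValue.isNontrivial_comp_of_finiteDimensional (hS.nontrivial v hv)) hm
  have := hM.finite
  have := hM.galois
  obtain ⟨ζ, hζ⟩ := hμ.exists_isPrimitiveRoot (dvd_mul_left n q) hn
  obtain ⟨x, hx⟩ := hN ζ (by rw [mul_comm, pow_mul, hζ.pow_eq_one, one_pow])
  -- The norm from `M` is the `q`-th power of the norm from `K`, that is `ζ ^ q`. Hence `x ^ n` has
  -- norm 1 from `M`, and Hilbert 90 provides `a`.
  have hxM : IsPrimitiveRoot (Algebra.norm k (algebraMap K M x)) n := by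
    rw [← Algebra.norm_norm (S := K), Algebra.norm_algebraMap, hKM, map_pow, hx]
    exact hζ.pow_of_coprime q hqn
  obtain ⟨σ, hg, hσ⟩ := hM.exists_generator
  obtain ⟨a, ha0, ha⟩ := hM.exists_hilbert90 hg (x := algebraMap K M x ^ n)
    (by rw [map_pow, hxM.pow_eq_one])
  obtain ⟨b, hb0, hb⟩ := hk.exists_hasFullLocalDegreeAt hK hM hn
    (hζ.map_of_injective (algebraMap k K).injective) hS hKM
    (fun v hv w h ↦ hloc v w h ⟨v, hv, rfl⟩) ha0 (exists_eq_pow_mul_of_generator hg ha)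
  obtain ⟨hirr, hdeg, hfull⟩ := hb _ rfl
  have hL : IsCyclicExtension k (AdjoinRoot (X ^ n - C (a * algebraMap k M b))) :=
    isCyclicExtension_adjoinRoot_X_pow_sub_C hM
      (mul_ne_zero ha0 ((_root_.map_ne_zero _).2 hb0)) hg hσ
      (by rw [map_mul, ha, AlgEquiv.commutes, mul_assoc]) hxM
  exact ⟨AdjoinRoot (X ^ n - C (a * algebraMap k M b)), inferInstance, inferInstance,
    inferInstance, inferInstance, ⟨hL.tower_top, hdeg, hfull, hL.galois⟩, hL⟩

end Main

theorem mainTheorem1 (k : Type u) (K : Type v) [Field k] [Field K] [Algebra k K]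
    (hk : IsGlobalField k) (hK : IsGlobalField K) (hKk : IsCyclicExtension k K)
    (m : ℕ) (hm : 0 < m) (S : Set (AbsoluteValue K ℝ)) (hS : IsFinitePlaceSet S) :
    (ContainsRootsOfUnity m K → HasSolution k K m S) ∧
    (ContainsRootsOfUnity m k → HasAbelianSolution k K m S) ∧
    (ContainsRootsOfUnity m k → (HasCyclicSolution k K m S ↔ RootsOfUnityAreNorms m k K)) ∧
    (∀ p r : ℕ, p.Prime → CharP k p → m = p ^ r → HasCyclicSolution k K m S) := by
  have := hKk.finite
  refine ⟨fun hμ ↦ ?_, fun hμ ↦ ?_, fun hμ ↦ ⟨?_, hk.hasCyclicSolution hK hKk hm hS hμ⟩,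
    fun p r hp hchar hmpr ↦ ?_⟩
  · obtain ⟨L, _, _, _, _, hL, -⟩ := hk.exists_isSolution hK hKk hm hS hμ
    exact ⟨L, inferInstance, inferInstance, inferInstance, inferInstance, hL⟩
  · obtain ⟨L, _, _, _, _, hL, hab⟩ := hk.exists_isSolution hK hKk hm hS (hμ.map K)
    exact ⟨L, inferInstance, inferInstance, inferInstance, inferInstance, hL, hab hμ⟩
  · rintro ⟨L, _, _, _, _, hL, hcyc⟩
    exact hKk.rootsOfUnityAreNorms hcyc hL.degree
  · have := Fact.mk hp
    -- In characteristic `p` the only `p ^ r`-th root of unity is 1, the norm of 1, so part (iii)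
    -- applies.
    have key : ∀ {F : Type u} [Field F] [CharP F p] (x : F), x ^ m = 1 → x = 1 := by
      intro F _ _ x hx
      rw [hmpr] at hx
      simpa using (ExpChar.pow_prime_pow_mul_eq_one_iff p r 1 x).1 (by simpa using hx)
    have : CharP (AlgebraicClosure k) p :=
      charP_of_injective_algebraMap (algebraMap k (AlgebraicClosure k)).injective p
    refine hk.hasCyclicSolution hK hKk hm hS (fun x hx ↦ ⟨1, ?_⟩) fun ζ hζ ↦ ⟨1, ?_⟩
    · rw [map_one, key x hx]
    · rw [map_one, key ζ hζ]
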